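/- **Setting.** Let $N\ge 1$, $T>0$, $\mathcal N=\{1,\dots,N\}$, $Q_T=(0,T)\times\mathbb R$. For $k\in\mathcal N$ let $f^k(u)=u\,g^k(u)$ with $g^k:\mathbb R\to\mathbb R$ Lipschitz, non-increasing, $g^k(1)=0$; let $\nu^k:\mathbb R\times\mathbb R\to\mathbb R$ be bounded and non-negative on $\mathbb R\times[0,1]$, with $\nu^k(\cdot,A)\in C^2(\mathbb R)$ and $\nu^k(x,\cdot)\in C^2(\mathbb R)\cap W^{2,\infty}(\mathbb R)$ for all $A,x$, and with $|\nu^k(x,A)-\nu^k(y,A)|\le \mathcal C_0|a_0(x)-a_0(y)|$ for all $x,y,A$, for some constant $\mathcal C_0$ and some function $a_0$ of bounded variation. Let $0<\eta<\infty$ and let $\omega_\eta\in C^2([0,\eta])$ be non-negative and non-increasing with $\int_0^\eta\omega_\eta=1$, extended by $0$ to $\mathbb R$. Put $(w*\omega_\eta)(x)=\int_x^{x+\eta}\omega_\eta(y-x)w(y)\,dy$. For $1\le k<N$ put $$S^k(x,a,b,A,B)=\big(g^{k+1}(b)\nu^{k+1}(x,B)-g^k(a)\nu^k(x,A)\big)^+a-\big(g^{k+1}(b)\nu^{k+1}(x,B)-g^k(a)\nu^k(x,A)\big)^-b,$$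 where $z^+=\max(z,0)$, $z^-=-\min(z,0)$, and $S^0=S^N=0$. For $\boldsymbol U,\boldsymbol A\in\mathbb R^N$ put $$R^k(x,\boldsymbol U,\boldsymbol A)=S^{k-1}(x,U^{k-1},U^k,A^{k-1},A^k)-S^k(x,U^k,U^{k+1},A^k,A^{k+1}).$$ For $\boldsymbol v=(v^1,\dots,v^N)$ on $[0,T]\times\mathbb R$ let $\mathcal V^k(t,x)=\nu^k(x,(v^k(t)*\omega_\eta)(x))$, $\mathcal R^k_{\boldsymbol v}(t,x)=R^k\big(x,\boldsymbol v(t,x),(v^j(t)*\omega_\eta)(x)_{j\in\mathcal N}\big)$ and $\mathcal G^k(a,b)=\operatorname{sgn}(a-b)(f^k(a)-f^k(b))$, with $\operatorname{sgn}0=0$. **Entropy solution.** Let $\boldsymbol u_0\in((L^1\cap BV)(\mathbb R;[0,1]))^N$. A function $\boldsymbol u\in(\mathrm{Lip}([0,T];L^1(\mathbb R;[0,1]))\cap L^\infty([0,T];BV(\mathbb R)))^N$ with $\boldsymbol u(0,\cdot)=\boldsymbol u_0$ a.e. is an entropy solution if for all $k\in\mathcal N$, $\alpha\in\mathbb R$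 and $0\le\phi\in C_c^\infty([0,T)\times\mathbb R)$, with $\mathcal U^k(t,x)=\nu^k(x,(u^k(t)*\omega_\eta)(x))$, $$\int_{Q_T}\!|u^k-\alpha|\phi_t+\int_{Q_T}\!\mathcal G^k(u^k,\alpha)\,\mathcal U^k\phi_x-\int_{Q_T}\!\operatorname{sgn}(u^k-\alpha)f^k(\alpha)\,\mathcal U^k_x\phi+\int_{\mathbb R}|u^k(0,x)-\alpha|\phi(0,x)\,dx\ \ge\ -\int_{Q_T}\!\operatorname{sgn}(u^k-\alpha)\mathcal R^k_{\boldsymbol u}\phi .$$ **Scheme.** Let $0<\beta<2/3$ and $\lambda>0$ be fixed. Let $\Delta x>0$, $\Delta t=\lambda\Delta x$, with $\eta=N_\eta\Delta x$ and $T=N_T\Delta t$ for integers $N_\eta,N_T$. Let $x_r=r\Delta x$, $t^n=n\Delta t$, $C_i=[x_{i-1/2},x_{i+1/2})$, $u^{k,0}_i=\frac1{\Delta x}\int_{C_i}u^k_0$, $\zeta_{p+1/2}=\int_{p\Delta x}^{(p+1)\Delta x}\omega_\eta$, $c^{k,n}_{i+1/2}=\sum_{p=0}^{N_\eta-1}\zeta_{p+1/2}u^{k,n}_{i+p+1}$,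 $c^{k,n}_i=\frac12(c^{k,n}_{i+1/2}+c^{k,n}_{i+3/2})$, $$\mathcal F^{k,n}_{i+1/2}=\tfrac12\nu^k(x_{i+1/2},c^{k,n}_{i+1/2})\big(f^k(u^{k,n}_i)+f^k(u^{k,n}_{i+1})\big)-\tfrac{\beta}{2\lambda}(u^{k,n}_{i+1}-u^{k,n}_i),\qquad \mathcal R^{k,n}_i=R^k\big(x_i,(u^{j,n}_i)_j,(c^{j,n}_i)_j\big),$$ $$u^{k,n+1}_i=u^{k,n}_i-\lambda\big(\mathcal F^{k,n}_{i+1/2}-\mathcal F^{k,n}_{i-1/2}\big)+\Delta t\,\mathcal R^{k,n}_i ,$$ and $u^k_\Delta(t,x)=u^{k,n}_i$ for $(t,x)\in[t^n,t^{n+1})\times C_i$. Let $|f^k|_{\mathrm{Lip}}$ be the Lipschitz constant of $f^k$ on $[0,1]$, $\|\nu^k\|_\infty=\sup_{\mathbb R\times[0,1]}|\nu^k|$, and let $|\boldsymbol S|$ be the least constant with $|S^k(x,a,b,A,B)-S^k(x,a',b',A',B')|\le|\boldsymbol S|(|a-a'|+|b-b'|+|A-A'|+|B-B'|)$ for all $1\le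 k<N$, $x\in\mathbb R$ and all arguments in $[0,1]$ ($|\boldsymbol S|=0$ if $N=1$). Assume for every $k$ the CFL condition $$\lambda\le\frac{\min(1,\,4-6\beta,\,6\beta,\,1-2\Delta t|\boldsymbol S|)}{1+6|f^k|_{\mathrm{Lip}}\|\nu^k\|_\infty}\qquad\text{and}\qquad \beta+\lambda|f^k|_{\mathrm{Lip}}\|\nu^k\|_\infty+2\Delta t|\boldsymbol S|\le1 .$$ **Relative entropy.** Let $\Theta\in C_c^\infty(\mathbb R)$ be a fixed non-negative even function supported in $[-1,1]$ with $\int\Theta=1$, $\Theta_a(x)=\frac1a\Theta(\frac xa)$, and for $\varepsilon,\varepsilon_0>0$ let $\Phi(t,x,s,y)=\Theta_\varepsilon(x-y)\Theta_{\varepsilon_0}(t-s)$. Put $$\begin{aligned}\Lambda^k_T(v^k,\phi,\alpha)={}&\int_{Q_T}\big(|v^k-\alpha|\phi_t+\mathcal G^k(v^k,\alpha)\mathcal V^k\phi_x\big)-\int_{Q_T}\operatorname{sgn}(v^k-\alpha)f^k(\alpha)\mathcal V^k_x\phi+\int_{Q_T}\operatorname{sgn}(v^k-\alpha)\mathcal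 R^k_{\boldsymbol v}\phi\\&-\int_{\mathbb R}|v^k(T,x)-\alpha|\phi(T,x)\,dx+\int_{\mathbb R}|v^k(0,x)-\alpha|\phi(0,x)\,dx,\end{aligned}$$ $$\Lambda^k_{\varepsilon,\varepsilon_0}(v^k,w^k)=\int_{Q_T}\Lambda^k_T\big(v^k,\Phi(\cdot,\cdot,s,y),w^k(s,y)\big)\,ds\,dy .$$ **Lemma (relative entropy estimate).** Let $\boldsymbol u$ be an entropy solution with initial data $\boldsymbol u_0$. Then for every $k\in\mathcal N$ and all $\varepsilon,\varepsilon_0>0$, $$-\Lambda^k_{\varepsilon,\varepsilon_0}(u^k_\Delta,u^k)\le\mathcal L\Big(\frac{\Delta x}{\varepsilon}+\frac{\Delta t}{\varepsilon_0}+\Delta t\Big),$$ where $\mathcal L$ depends only on $T$, $N$, $\beta$, $\lambda$, $\Theta$, on the norms $\|D_1\nu^j\|$, $\|D_2\nu^j\|$, $\|D_{11}\nu^j\|$, $\|D_{12}\nu^j\|$, $\|D_{21}\nu^j\|$, $\|D_{22}\nu^j\|$ in $L^\infty(\mathbb R\times[0,1])$ (assumed finite) and $|f^j|_{\mathrm{Lip}}$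 for $j\in\mathcal N$, and on $|\omega_\eta|_{BV(\mathbb R)}$, $\|\boldsymbol u_0\|_{(L^1(\mathbb R))^N}$, $|\boldsymbol u_0|_{(BV(\mathbb R))^N}$ and $|\boldsymbol S|$ (assumed finite). In particular $\mathcal L$ is independent of $\Delta x$ and $\Delta t=\lambda\Delta x$, of $\varepsilon$ and of $\varepsilon_0$. -/

import Mathlib

open MeasureTheory Set
open scoped ENNReal NNReal ContDiff

noncomputable section

namespace Multilane

/-- The open time-space strip `(0,T) × ℝ`. -/
def QT (T : ℝ) : Set (ℝ × ℝ) := Ioo 0 T ×ˢ univ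

/-- The `BV` seminorm of an `L¹_loc` class on the line: the least pointwise total variation
among all functions that agree with `v` almost everywhere. -/
def essVariation (v : ℝ → ℝ) : ℝ≥0∞ :=
  ⨅ (w : ℝ → ℝ) (_ : w =ᵐ[volume] v), eVariationOn w univ

/-- The data of the `N`-lane model: `g k u * ν k x A` is the speed in lane `k`, and `ker` (written
`ω_η` in the comments) on `[0, η]` is the convolution kernel. -/
structure LaneModel (N : ℕ) where
  g : Fin N → ℝ → ℝ
  ν : Fin N → ℝ → ℝ → ℝ
  η : ℝ
  ker : ℝ → ℝ

namespace LaneModel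

variable {N : ℕ}

/-- `f^k(u) = u g^k(u)`. -/
def f (P : LaneModel N) (k : Fin N) (u : ℝ) : ℝ := u * P.g k u

/-- `(w * ω_η)(x) = ∫_x^{x+η} ω_η(y - x) w(y) dy`. -/
def conv (P : LaneModel N) (w : ℝ → ℝ) (x : ℝ) : ℝ :=
  ∫ y in x..(x + P.η), P.ker (y - x) * w y

/-- `S(x,a,b,A,B) = (g^l(b) ν^l(x,B) - g^k(a) ν^k(x,A))⁺ a - (g^l(b) ν^l(x,B) - g^k(a) ν^k(x,A))⁻ b`,
the exchange rate from lane `k` to lane `l`, where `z⁺ = max z 0` and `z⁻ = -min z 0`. -/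
def exchange (P : LaneModel N) (k l : Fin N) (x a b A B : ℝ) : ℝ :=
  max (P.g l b * P.ν l x B - P.g k a * P.ν k x A) 0 * a
    - (-min (P.g l b * P.ν l x B - P.g k a * P.ν k x A) 0) * b

/-- `S^k`, evaluated at lane densities `U` and averaged densities `A`: the exchange between the
lanes `k` and `k+1`, and zero for the last lane. -/
def S (P : LaneModel N) (k : Fin N) (x : ℝ) (U A : Fin N → ℝ) : ℝ :=
  if h : (k : ℕ) + 1 < N then
    P.exchange k ⟨(k : ℕ) + 1, h⟩ x (U k) (U ⟨(k : ℕ) + 1, h⟩) (A k) (A ⟨(k : ℕ) + 1, h⟩)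
  else 0

/-- `R^k = S^{k-1} - S^k`, where the first term is absent for the first lane. -/
def R (P : LaneModel N) (k : Fin N) (x : ℝ) (U A : Fin N → ℝ) : ℝ :=
  (if 0 < (k : ℕ) then P.S ⟨(k : ℕ) - 1, lt_of_le_of_lt (Nat.sub_le _ _) k.isLt⟩ x U A else 0)
    - P.S k x U A

/-- The standing assumptions on the data. -/
structure Admissible (P : LaneModel N) : Prop where
  g_lip : ∀ k, ∃ C : ℝ≥0, LipschitzWith C (P.g k)
  g_one : ∀ k, P.g k 1 = 0
  g_antitone : ∀ k, Antitone (P.g k)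
  ν_bounded : ∀ k, ∃ C : ℝ, ∀ x, ∀ A ∈ Icc (0 : ℝ) 1, |P.ν k x A| ≤ C
  ν_nonneg : ∀ k x, ∀ A ∈ Icc (0 : ℝ) 1, 0 ≤ P.ν k x A
  ν_contDiff_left : ∀ k A, ContDiff ℝ 2 (fun x => P.ν k x A)
  ν_contDiff_right : ∀ k x, ContDiff ℝ 2 (P.ν k x)
  ν_sobolev : ∀ k x, ∃ C : ℝ, ∀ A, |P.ν k x A| ≤ C ∧ |deriv (P.ν k x) A| ≤ C ∧
    |iteratedDeriv 2 (P.ν k x) A| ≤ C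
  ν_bv : ∀ k, ∃ (C₀ : ℝ) (a₀ : ℝ → ℝ), BoundedVariationOn a₀ univ ∧
    ∀ x y A, |P.ν k x A - P.ν k y A| ≤ C₀ * |a₀ x - a₀ y|
  η_pos : 0 < P.η
  ker_contDiff : ContDiffOn ℝ 2 P.ker (Icc 0 P.η)
  ker_nonneg : ∀ y ∈ Icc 0 P.η, 0 ≤ P.ker y
  ker_antitone : AntitoneOn P.ker (Icc 0 P.η)
  ker_mass : ∫ y in (0 : ℝ)..P.η, P.ker y = 1

/-- `𝒰^k(t,x) = ν^k(x, (v^k(t) * ω_η)(x))`. -/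
def velocity (P : LaneModel N) (v : Fin N → ℝ → ℝ → ℝ) (k : Fin N) (t x : ℝ) : ℝ :=
  P.ν k x (P.conv (v k t) x)

/-- `ℛ^k_v(t,x) = R^k(x, v(t,x), (v(t) ⊛ ω_η)(x))`. -/
def sourceTerm (P : LaneModel N) (v : Fin N → ℝ → ℝ → ℝ) (k : Fin N) (t x : ℝ) : ℝ :=
  P.R k x (fun j => v j t x) (fun j => P.conv (v j t) x)

/-- `𝒢^k(a,b) = sgn(a - b) (f^k(a) - f^k(b))`. -/
def G (P : LaneModel N) (k : Fin N) (a b : ℝ) : ℝ :=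
  Real.sign (a - b) * (P.f k a - P.f k b)

/-- Entropy solutions on `[0,T]` with initial data `u₀`: functions in
`Lip([0,T]; L¹(ℝ;[0,1])) ∩ L^∞([0,T]; BV(ℝ))` that attain `u₀` and satisfy the Kruzhkov inequality
for all constants `α` and all nonnegative `φ ∈ C_c^∞([0,T) × ℝ)`. -/
structure IsEntropySolution (P : LaneModel N) (T : ℝ) (u₀ : Fin N → ℝ → ℝ)
    (u : Fin N → ℝ → ℝ → ℝ) : Prop where
  measurable : ∀ k, AEStronglyMeasurable (fun z : ℝ × ℝ => u k z.1 z.2)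
    (volume.restrict (QT T))
  integrable : ∀ k, ∀ t ∈ Icc 0 T, Integrable (u k t)
  range : ∀ k, ∀ t ∈ Icc 0 T, ∀ᵐ x, u k t x ∈ Icc (0 : ℝ) 1
  lip_time : ∃ C : ℝ, ∀ k, ∀ s ∈ Icc 0 T, ∀ t ∈ Icc 0 T,
    ∫ x, |u k s x - u k t x| ≤ C * |s - t|
  bv : ∃ C : ℝ≥0, ∀ k, ∀ t ∈ Icc 0 T, essVariation (u k t) ≤ C
  initial : ∀ k, u k 0 =ᵐ[volume] u₀ k
  entropy : ∀ (k : Fin N) (α : ℝ) (φ : ℝ → ℝ → ℝ),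
    ContDiff ℝ ∞ (fun z : ℝ × ℝ => φ z.1 z.2) →
    HasCompactSupport (fun z : ℝ × ℝ => φ z.1 z.2) →
    tsupport (fun z : ℝ × ℝ => φ z.1 z.2) ⊆ Iio T ×ˢ univ →
    (∀ t, 0 ≤ t → ∀ x, 0 ≤ φ t x) →
    -(∫ z in QT T, Real.sign (u k z.1 z.2 - α) * P.sourceTerm u k z.1 z.2 * φ z.1 z.2) ≤
      (∫ z in QT T, |u k z.1 z.2 - α| * deriv (fun t => φ t z.2) z.1)
      + (∫ z in QT T, P.G k (u k z.1 z.2) α * P.velocity u k z.1 z.2 * deriv (φ z.1) z.2)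
      - (∫ z in QT T, Real.sign (u k z.1 z.2 - α) * P.f k α
          * deriv (P.velocity u k z.1) z.2 * φ z.1 z.2)
      + ∫ x, |u k 0 x - α| * φ 0 x

/-- `Λ^k_T(v^k, φ, α)`; the system `v` enters through `𝒱^k` and `ℛ^k_v`, and `v^k(0,·)` is the
initial value. -/
def LambdaT (P : LaneModel N) (T : ℝ) (k : Fin N) (v : Fin N → ℝ → ℝ → ℝ)
    (φ : ℝ → ℝ → ℝ) (α : ℝ) : ℝ :=
  (∫ z in QT T, (|v k z.1 z.2 - α| * deriv (fun t => φ t z.2) z.1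
      + P.G k (v k z.1 z.2) α * P.velocity v k z.1 z.2 * deriv (φ z.1) z.2))
  - (∫ z in QT T, Real.sign (v k z.1 z.2 - α) * P.f k α
      * deriv (P.velocity v k z.1) z.2 * φ z.1 z.2)
  + (∫ z in QT T, Real.sign (v k z.1 z.2 - α) * P.sourceTerm v k z.1 z.2 * φ z.1 z.2)
  - (∫ x, |v k T x - α| * φ T x)
  + ∫ x, |v k 0 x - α| * φ 0 x

end LaneModel

/-- A standard symmetric mollifier. -/
structure IsMollifier (Θ : ℝ → ℝ) : Prop where
  smooth : ContDiff ℝ ∞ Θ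
  nonneg : ∀ x, 0 ≤ Θ x
  even : ∀ x, Θ (-x) = Θ x
  supp : tsupport Θ ⊆ Icc (-1) 1
  mass : ∫ x, Θ x = 1

/-- `Θ_a(x) = Θ(x/a)/a`. -/
def scaled (Θ : ℝ → ℝ) (a x : ℝ) : ℝ := 1 / a * Θ (x / a)

/-- `Φ(t,x,s,y) = Θ_ε(x - y) Θ_{ε₀}(t - s)`. -/
def kernelPhi (Θ : ℝ → ℝ) (ε ε₀ t x s y : ℝ) : ℝ :=
  scaled Θ ε (x - y) * scaled Θ ε₀ (t - s)

namespace LaneModel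

variable {N : ℕ}

/-- The relative entropy functional
`Λ^k_{ε,ε₀}(v^k, w^k) = ∫_{Q_T} Λ^k_T(v^k, Φ(·,·,s,y), w^k(s,y)) ds dy`. -/
def relEntropy (P : LaneModel N) (T : ℝ) (Θ : ℝ → ℝ) (ε ε₀ : ℝ) (k : Fin N)
    (v w : Fin N → ℝ → ℝ → ℝ) : ℝ :=
  ∫ z in QT T, P.LambdaT T k v (fun t x => kernelPhi Θ ε ε₀ t x z.1 z.2) (w k z.1 z.2)

/-- `u^{k,0}_i`, the average of `w` over `C_i = [(i-1/2)Δx, (i+1/2)Δx)`. -/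
def cellAverage (Δx : ℝ) (w : ℝ → ℝ) (i : ℤ) : ℝ :=
  1 / Δx * ∫ x in Ico (((i : ℝ) - 1 / 2) * Δx) (((i : ℝ) + 1 / 2) * Δx), w x

/-- `ζ_{p+1/2} = ∫_{pΔx}^{(p+1)Δx} ω_η`. -/
def zeta (P : LaneModel N) (Δx : ℝ) (p : ℕ) : ℝ :=
  ∫ y in ((p : ℝ) * Δx)..(((p : ℝ) + 1) * Δx), P.ker y

/-- `c_{i+1/2} = ∑_{p=0}^{N_η - 1} ζ_{p+1/2} u_{i+p+1}` for one lane. -/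
def cHalf (P : LaneModel N) (Δx : ℝ) (Nη : ℕ) (U : ℤ → ℝ) (i : ℤ) : ℝ :=
  ∑ p ∈ Finset.range Nη, P.zeta Δx p * U (i + p + 1)

/-- `c_i = (c_{i+1/2} + c_{i+3/2}) / 2` for one lane. -/
def cFull (P : LaneModel N) (Δx : ℝ) (Nη : ℕ) (U : ℤ → ℝ) (i : ℤ) : ℝ :=
  1 / 2 * (P.cHalf Δx Nη U i + P.cHalf Δx Nη U (i + 1))

/-- The Lax–Friedrichs type flux `ℱ^k_{i+1/2}(u_i, u_{i+1})`, with `lam = Δt/Δx`. -/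
def numFlux (P : LaneModel N) (β lam Δx : ℝ) (Nη : ℕ) (k : Fin N) (U : ℤ → ℝ) (i : ℤ) : ℝ :=
  1 / 2 * P.ν k (((i : ℝ) + 1 / 2) * Δx) (P.cHalf Δx Nη U i) * (P.f k (U i) + P.f k (U (i + 1)))
    - β / (2 * lam) * (U (i + 1) - U i)

/-- `ℛ^k_i = R^k(x_i, (u^j_i)_j, (c^j_i)_j)`. -/
def numSource (P : LaneModel N) (Δx : ℝ) (Nη : ℕ) (U : Fin N → ℤ → ℝ) (k : Fin N) (i : ℤ) : ℝ :=
  P.R k ((i : ℝ) * Δx) (fun j => U j i) (fun j => P.cFull Δx Nη (U j) i)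

/-- The grid values `u^{k,n}_i` generated by the marching formula. -/
def scheme (P : LaneModel N) (β Δx Δt : ℝ) (Nη : ℕ) (u₀ : Fin N → ℝ → ℝ) :
    ℕ → Fin N → ℤ → ℝ
  | 0 => fun k i => cellAverage Δx (u₀ k) i
  | n + 1 => fun k i =>
      let U := scheme P β Δx Δt Nη u₀ n
      U k i
        - Δt / Δx * (P.numFlux β (Δt / Δx) Δx Nη k (U k) i
            - P.numFlux β (Δt / Δx) Δx Nη k (U k) (i - 1))
        + Δt * P.numSource Δx Nη U k i

/-- The piecewise constant approximation: `u_Δ^k(t,x) = u^{k,n}_i` for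
`t ∈ [nΔt, (n+1)Δt)` and `x ∈ [(i-1/2)Δx, (i+1/2)Δx)`. -/
def approx (P : LaneModel N) (β Δx Δt : ℝ) (Nη : ℕ) (u₀ : Fin N → ℝ → ℝ)
    (k : Fin N) (t x : ℝ) : ℝ :=
  P.scheme β Δx Δt Nη u₀ ⌊t / Δt⌋₊ k ⌊x / Δx + 1 / 2⌋

end LaneModel

/-- The numbers on which the constant of the estimate may depend: upper bounds for the norms of
the data. -/
structure DataBounds (N : ℕ) where
  f : Fin N → ℝ
  D₁ν : ℝ
  D₂ν : ℝ
  D₁₁ν : ℝ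
  D₁₂ν : ℝ
  D₂₁ν : ℝ
  D₂₂ν : ℝ
  ker : ℝ
  S : ℝ
  mass : ℝ
  tv : ℝ

/-- The norms of the model and of the initial data are at most the numbers in `M`. All norms of
`ν^k` are over `ℝ × [0,1]`; those of the mixed derivatives are expressed as Lipschitz constants of
the first derivatives, and that of the kernel is the variation of its extension by zero. -/
structure LaneModel.BoundedBy {N : ℕ} (P : LaneModel N) (u₀ : Fin N → ℝ → ℝ)
    (M : DataBounds N) : Prop where
  f_le : ∀ k, ∀ a ∈ Icc (0 : ℝ) 1, ∀ b ∈ Icc (0 : ℝ) 1, |P.f k a - P.f k b| ≤ M.f k * |a - b|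
  D₁ν_le : ∀ k x, ∀ A ∈ Icc (0 : ℝ) 1, |deriv (fun y => P.ν k y A) x| ≤ M.D₁ν
  D₂ν_le : ∀ k x, ∀ A ∈ Icc (0 : ℝ) 1, |deriv (P.ν k x) A| ≤ M.D₂ν
  D₁₁ν_le : ∀ k x, ∀ A ∈ Icc (0 : ℝ) 1, |iteratedDeriv 2 (fun y => P.ν k y A) x| ≤ M.D₁₁ν
  D₁₂ν_le : ∀ k x, ∀ A ∈ Icc (0 : ℝ) 1, ∀ B ∈ Icc (0 : ℝ) 1,
    |deriv (fun y => P.ν k y A) x - deriv (fun y => P.ν k y B) x| ≤ M.D₁₂ν * |A - B|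
  D₂₁ν_le : ∀ k x y, ∀ A ∈ Icc (0 : ℝ) 1,
    |deriv (P.ν k x) A - deriv (P.ν k y) A| ≤ M.D₂₁ν * |x - y|
  D₂₂ν_le : ∀ k x, ∀ A ∈ Icc (0 : ℝ) 1, |iteratedDeriv 2 (P.ν k x) A| ≤ M.D₂₂ν
  ker_le : eVariationOn (indicator (Icc 0 P.η) P.ker) univ ≤ ENNReal.ofReal M.ker
  S_le : ∀ k l : Fin N, (k : ℕ) + 1 = (l : ℕ) → ∀ x,
    ∀ a ∈ Icc (0 : ℝ) 1, ∀ b ∈ Icc (0 : ℝ) 1, ∀ A ∈ Icc (0 : ℝ) 1, ∀ B ∈ Icc (0 : ℝ) 1,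
    ∀ a' ∈ Icc (0 : ℝ) 1, ∀ b' ∈ Icc (0 : ℝ) 1, ∀ A' ∈ Icc (0 : ℝ) 1, ∀ B' ∈ Icc (0 : ℝ) 1,
    |P.exchange k l x a b A B - P.exchange k l x a' b' A' B'| ≤
      M.S * (|a - a'| + |b - b'| + |A - A'| + |B - B'|)
  mass_le : ∑ k, ∫ x, |u₀ k x| ≤ M.mass
  tv_le : ∀ k, essVariation (u₀ k) ≤ ENNReal.ofReal M.tv

end Multilane

end

open Multilane

noncomputable section

namespace Multilane

/-! The solution enters the relative entropy only through the value α = u(s,y) in [0,1]. It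
therefore suffices to bound -Λ for a fixed constant α and then to average over the centre (s,y) of
the mollifier. For fixed α the approximation nearly satisfies Kruzhkov's inequality: the CFL
condition makes the Lax–Friedrichs update monotone, and comparison with the updates of max(·,α) and
min(·,α) gives the discrete inequality `cell_entropy`. What has to be measured is the gap between -Λ
and the sum of these inequalities weighted by the test function p(x)q(t).

Since the approximation is constant on cells, `neg_lambdaT_eq` evaluates -Λ exactly. The entropy
flux and the weight of the velocity gradient are shifted by ∓f(α) so that both vanish at zero
density; the shift is free because V p' + V_x p has integral zero. After it, every error is
dominated by densities, jumps or time increments, hence summable over infinitely many cells. In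
space, `cell_flux_le` sums by parts: what does not telescope contains an oscillation of p over a
cell or of q over a time step. The discrete inequality takes signs at the new level but velocities
and sources at the old one; `time_shift_le` repairs this at the price of oscillations of q,
increments of the scheme and two boundary terms of order Δt. The outcome is `ofReal_neg_lambdaT_le`.

The error weights are summed with a priori bounds on the scheme: values in [0,1] (`march_mem`), mass
(`march_mass`), variation (`march_jump`) and time increments (`march_sub`), the mass and variation
bounds being iterated by a discrete Gronwall argument. The nonlocal velocity is tame because
differences of a convolution fall on the monotone kernel: first differences are O(Δx), and second
ones O(Δx²) plus a term controlled in ℓ¹.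

Averaging over (s,y) (`meanLe_errorTerms`) turns an oscillation of Θ_ε over a cell into Δx/ε and one
of Θ_{ε₀} over a step into Δt/ε₀, up to the factor ∫|Θ'|. Terms without a derivative carry a full
cell length and, after summation over T/Δt steps, give Δt. -/

/-! ### Summable grid functions. -/

/-- The `ℓ¹(ℤ)` norm of `a` is at most `C`. -/
def SumAbsLe (a : ℤ → ℝ) (C : ℝ) : Prop := ∀ s : Finset ℤ, ∑ i ∈ s, |a i| ≤ C

namespace SumAbsLe

variable {a b : ℤ → ℝ} {C D : ℝ}

lemma nonneg (h : SumAbsLe a C) : 0 ≤ C := by simpa using h ∅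

lemma of_le (h : SumAbsLe a C) (hCD : C ≤ D) : SumAbsLe a D := fun s => (h s).trans hCD

lemma mono (h : SumAbsLe b C) (hab : ∀ i, |a i| ≤ |b i|) : SumAbsLe a C :=
  fun s => (Finset.sum_le_sum fun i _ => hab i).trans (h s)

lemma mono' (h : SumAbsLe b C) (hab : ∀ i, |a i| ≤ b i) : SumAbsLe a C :=
  h.mono fun i => (hab i).trans (le_abs_self _)

lemma add (h : SumAbsLe a C) (h' : SumAbsLe b D) : SumAbsLe (fun i => a i + b i) (C + D) :=
  fun s => calc
    ∑ i ∈ s, |a i + b i| ≤ ∑ i ∈ s, (|a i| + |b i|) :=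
      Finset.sum_le_sum fun _ _ => abs_add_le _ _
    _ = ∑ i ∈ s, |a i| + ∑ i ∈ s, |b i| := Finset.sum_add_distrib
    _ ≤ C + D := add_le_add (h s) (h' s)

lemma const_mul (h : SumAbsLe a C) {c : ℝ} (hc : 0 ≤ c) :
    SumAbsLe (fun i => c * a i) (c * C) := fun s => by
  simp_rw [abs_mul, abs_of_nonneg hc, ← Finset.mul_sum]
  exact mul_le_mul_of_nonneg_left (h s) hc

lemma sum {ι : Type*} {t : Finset ι} {a : ι → ℤ → ℝ} {C : ι → ℝ}
    (h : ∀ k ∈ t, SumAbsLe (a k) (C k)) : SumAbsLe (fun i => ∑ k ∈ t, a k i) (∑ k ∈ t, C k) :=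
  fun s => calc
    ∑ i ∈ s, |∑ k ∈ t, a k i| ≤ ∑ i ∈ s, ∑ k ∈ t, |a k i| :=
      Finset.sum_le_sum fun _ _ => Finset.abs_sum_le_sum_abs _ _
    _ = ∑ k ∈ t, ∑ i ∈ s, |a k i| := Finset.sum_comm
    _ ≤ ∑ k ∈ t, C k := Finset.sum_le_sum fun k hk => h k hk s

lemma shift (h : SumAbsLe a C) (j : ℤ) : SumAbsLe (fun i => a (i + j)) C := fun s => by
  have := h (s.map (addRightEmbedding j))
  simpa using this

/-- A three-point combination whose weights at each point add up to at most `m`. -/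
lemma of_three_point {d A B E m r : ℤ → ℝ}
    (hd : ∀ i, |d i| ≤ A (i + 1) + B i + E (i - 1) + r i)
    (hA : ∀ i, 0 ≤ A i) (hB : ∀ i, 0 ≤ B i) (hE : ∀ i, 0 ≤ E i)
    (hm : ∀ i, A i + B i + E i ≤ m i) (hmC : SumAbsLe m C) (hr : SumAbsLe r D) :
    SumAbsLe d (C + D) := fun s => by
  -- Regroup by the point of evaluation instead of by `i`: each point then carries `A + B + E ≤ m`.
  -- Nonnegativity allows enlarging the index sets to the common set `t`.
  set s₁ := s.map (addRightEmbedding (1 : ℤ))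
  set s₂ := s.map (addRightEmbedding (-1 : ℤ))
  set t := s₁ ∪ s ∪ s₂
  have e₁ : ∑ i ∈ s, A (i + 1) = ∑ i ∈ s₁, A i := by simp [s₁]
  have e₂ : ∑ i ∈ s, E (i - 1) = ∑ i ∈ s₂, E i := by simp [s₂, sub_eq_add_neg]
  have hs₁ : s₁ ⊆ t := fun x hx => by simp [t, hx]
  have hs : s ⊆ t := fun x hx => by simp [t, hx]
  have hs₂ : s₂ ⊆ t := fun x hx => by simp [t, hx]
  calc
    ∑ i ∈ s, |d i| ≤ ∑ i ∈ s, (A (i + 1) + B i + E (i - 1) + r i) :=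
      Finset.sum_le_sum fun i _ => hd i
    _ = ∑ i ∈ s₁, A i + ∑ i ∈ s, B i + ∑ i ∈ s₂, E i + ∑ i ∈ s, r i := by
      rw [Finset.sum_add_distrib, Finset.sum_add_distrib, Finset.sum_add_distrib, e₁, e₂]
    _ ≤ ∑ i ∈ t, A i + ∑ i ∈ t, B i + ∑ i ∈ t, E i + ∑ i ∈ s, |r i| := by
      gcongr with i hi
      · exact fun i _ _ => hA i
      · exact fun i _ _ => hB i
      · exact fun i _ _ => hE i
      · exact le_abs_self _
    _ = ∑ i ∈ t, (A i + B i + E i) + ∑ i ∈ s, |r i| := by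
      rw [Finset.sum_add_distrib, Finset.sum_add_distrib]
    _ ≤ ∑ i ∈ t, |m i| + ∑ i ∈ s, |r i| := by
      gcongr with i hi
      exact (hm i).trans (le_abs_self _)
    _ ≤ C + D := add_le_add (hmC t) (hr s)

lemma tsum_ofReal_le (h : SumAbsLe a C) : ∑' i, ENNReal.ofReal |a i| ≤ ENNReal.ofReal C := by
  rw [ENNReal.tsum_eq_iSup_sum]
  refine iSup_le fun s => ?_
  rw [← ENNReal.ofReal_sum_of_nonneg fun i _ => abs_nonneg _]
  exact ENNReal.ofReal_le_ofReal (h s)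

end SumAbsLe

/-! ### Normalized hypotheses. -/

/-- The bounds on the data of a lane model and of the discretization that are used in the
estimates. -/
structure Regime {N : ℕ} (P : LaneModel N) (β lam Δx : ℝ) (Nη : ℕ) (F V : Fin N → ℝ)
    (Fm D₁ D₂ D₁₁ D₂₁ D₂₂ κ S : ℝ) : Prop where
  f_lip : ∀ k, ∀ a ∈ Icc (0 : ℝ) 1, ∀ b ∈ Icc (0 : ℝ) 1, |P.f k a - P.f k b| ≤ F k * |a - b|
  F_nonneg : ∀ k, 0 ≤ F k
  F_le : ∀ k, F k ≤ Fm
  Fm_nonneg : 0 ≤ Fm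
  g_cont : ∀ k, Continuous (P.g k)
  g_one : ∀ k, P.g k 1 = 0
  g_antitone : ∀ k, Antitone (P.g k)
  g_le : ∀ k, ∀ a ∈ Icc (0 : ℝ) 1, P.g k a ≤ Fm
  ν_nonneg : ∀ k x, ∀ A ∈ Icc (0 : ℝ) 1, 0 ≤ P.ν k x A
  ν_le : ∀ k x, ∀ A ∈ Icc (0 : ℝ) 1, P.ν k x A ≤ V k
  V_nonneg : ∀ k, 0 ≤ V k
  ν_x : ∀ k x y, ∀ A ∈ Icc (0 : ℝ) 1, |P.ν k x A - P.ν k y A| ≤ D₁ * |x - y|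
  ν_A : ∀ k x, ∀ A ∈ Icc (0 : ℝ) 1, ∀ B ∈ Icc (0 : ℝ) 1,
    |P.ν k x A - P.ν k x B| ≤ D₂ * |A - B|
  ν_xx : ∀ k x h, 0 ≤ h → ∀ A ∈ Icc (0 : ℝ) 1,
    |P.ν k (x + h) A - 2 * P.ν k x A + P.ν k (x - h) A| ≤ D₁₁ * h ^ 2
  ν_xA : ∀ k x y, ∀ A ∈ Icc (0 : ℝ) 1, ∀ B ∈ Icc (0 : ℝ) 1,
    |(P.ν k x A - P.ν k x B) - (P.ν k y A - P.ν k y B)| ≤ D₂₁ * |x - y| * |A - B|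
  ν_AA : ∀ k x, ∀ A ∈ Icc (0 : ℝ) 1, ∀ A' ∈ Icc (0 : ℝ) 1, ∀ B ∈ Icc (0 : ℝ) 1,
    ∀ B' ∈ Icc (0 : ℝ) 1, |(P.ν k x A - P.ν k x A') - (P.ν k x B - P.ν k x B')| ≤
      D₂ * |A - A' - (B - B')| + D₂₂ * |A - A'| * (|A - B| + |A' - B'|)
  D₁_nonneg : 0 ≤ D₁
  D₂_nonneg : 0 ≤ D₂
  D₁₁_nonneg : 0 ≤ D₁₁
  D₂₁_nonneg : 0 ≤ D₂₁
  D₂₂_nonneg : 0 ≤ D₂₂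
  ker_nonneg : ∀ y ∈ Icc 0 P.η, 0 ≤ P.ker y
  ker_le : ∀ y ∈ Icc 0 P.η, P.ker y ≤ κ
  ker_antitone : AntitoneOn P.ker (Icc 0 P.η)
  ker_cont : ContinuousOn P.ker (Icc 0 P.η)
  ker_mass : ∫ y in (0 : ℝ)..P.η, P.ker y = 1
  κ_nonneg : 0 ≤ κ
  η_pos : 0 < P.η
  η_eq : P.η = Nη * Δx
  S_nonneg : 0 ≤ S
  S_lip : ∀ k l : Fin N, (k : ℕ) + 1 = (l : ℕ) → ∀ x,
    ∀ a ∈ Icc (0 : ℝ) 1, ∀ b ∈ Icc (0 : ℝ) 1, ∀ A ∈ Icc (0 : ℝ) 1, ∀ B ∈ Icc (0 : ℝ) 1,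
    ∀ a' ∈ Icc (0 : ℝ) 1, ∀ b' ∈ Icc (0 : ℝ) 1, ∀ A' ∈ Icc (0 : ℝ) 1, ∀ B' ∈ Icc (0 : ℝ) 1,
    |P.exchange k l x a b A B - P.exchange k l x a' b' A' B'| ≤
      S * (|a - a'| + |b - b'| + |A - A'| + |B - B'|)
  β_pos : 0 < β
  lam_pos : 0 < lam
  Δx_pos : 0 < Δx
  cfl_side : ∀ k, lam * F k * V k ≤ β
  cfl : ∀ k, β + lam * F k * V k + 2 * (lam * Δx) * S ≤ 1

namespace Regime

variable {N : ℕ} {P : LaneModel N} {β lam Δx : ℝ} {Nη : ℕ} {F V : Fin N → ℝ}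
  {Fm D₁ D₂ D₁₁ D₂₁ D₂₂ κ S : ℝ}

/-! ### Lane exchange: signs and Lipschitz bounds. -/

section Exchange

variable (H : Regime P β lam Δx Nη F V Fm D₁ D₂ D₁₁ D₂₁ D₂₂ κ S)
include H

lemma g_nonneg (k : Fin N) {a : ℝ} (ha : a ∈ Icc (0 : ℝ) 1) : 0 ≤ P.g k a := by
  rw [← H.g_one k]; exact H.g_antitone k ha.2

omit H in
lemma f_zero (k : Fin N) : P.f k 0 = 0 := by simp [LaneModel.f]

lemma f_one (k : Fin N) : P.f k 1 = 0 := by simp [LaneModel.f, H.g_one]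

lemma f_nonneg (k : Fin N) {a : ℝ} (ha : a ∈ Icc (0 : ℝ) 1) : 0 ≤ P.f k a :=
  mul_nonneg ha.1 (H.g_nonneg k ha)

lemma f_le (k : Fin N) {a : ℝ} (ha : a ∈ Icc (0 : ℝ) 1) : P.f k a ≤ F k * a := by
  have := H.f_lip k a ha 0 (by simp)
  rw [f_zero, sub_zero, sub_zero, abs_of_nonneg ha.1] at this
  exact (le_abs_self _).trans this

omit H in
lemma exchange_zero_left_nonpos (k l : Fin N) (x A B : ℝ) {b : ℝ} (hb : 0 ≤ b) :
    P.exchange k l x 0 b A B ≤ 0 := by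
  have := min_le_right (P.g l b * P.ν l x B - P.g k 0 * P.ν k x A) 0
  simp only [LaneModel.exchange, mul_zero, zero_sub, Left.neg_nonpos_iff]
  exact mul_nonneg (neg_nonneg.2 this) hb

omit H in
lemma exchange_zero_right_nonneg (k l : Fin N) (x A B : ℝ) {a : ℝ} (ha : 0 ≤ a) :
    0 ≤ P.exchange k l x a 0 A B := by
  simp only [LaneModel.exchange, mul_zero, sub_zero]
  exact mul_nonneg (le_max_right _ _) ha

lemma exchange_one_right_nonpos (k l : Fin N) (x : ℝ) {a A B : ℝ} (ha : a ∈ Icc (0 : ℝ) 1)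
    (hA : A ∈ Icc (0 : ℝ) 1) : P.exchange k l x a 1 A B ≤ 0 := by
  have h0 : P.g l 1 * P.ν l x B - P.g k a * P.ν k x A ≤ 0 := by
    rw [H.g_one, zero_mul, zero_sub]
    exact neg_nonpos.2 (mul_nonneg (H.g_nonneg k ha) (H.ν_nonneg k x A hA))
  simp only [LaneModel.exchange, max_eq_right h0, min_eq_left h0]
  linarith

lemma exchange_one_left_nonneg (k l : Fin N) (x : ℝ) {b A B : ℝ} (hb : b ∈ Icc (0 : ℝ) 1)
    (hB : B ∈ Icc (0 : ℝ) 1) : 0 ≤ P.exchange k l x 1 b A B := by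
  have h0 : 0 ≤ P.g l b * P.ν l x B - P.g k 1 * P.ν k x A := by
    rw [H.g_one, zero_mul, sub_zero]
    exact mul_nonneg (H.g_nonneg l hb) (H.ν_nonneg l x B hB)
  simp only [LaneModel.exchange, max_eq_left h0, min_eq_right h0]
  linarith

/-- The exchange has a sign on each face of the unit square: nonpositive for `a = 0` or `b = 1`,
nonnegative for `b = 0` or `a = 1`. The Lipschitz constant `S` then bounds it by the distance to
that face. -/
lemma exchange_bounds {k l : Fin N} (hkl : (k : ℕ) + 1 = l) (x : ℝ) {a b A B : ℝ}
    (ha : a ∈ Icc (0 : ℝ) 1) (hb : b ∈ Icc (0 : ℝ) 1) (hA : A ∈ Icc (0 : ℝ) 1)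
    (hB : B ∈ Icc (0 : ℝ) 1) :
    P.exchange k l x a b A B ≤ S * a ∧ -(S * b) ≤ P.exchange k l x a b A B ∧
      P.exchange k l x a b A B ≤ S * (1 - b) ∧ -(S * (1 - a)) ≤ P.exchange k l x a b A B := by
  have z : (0 : ℝ) ∈ Icc (0 : ℝ) 1 := by simp
  have o : (1 : ℝ) ∈ Icc (0 : ℝ) 1 := by simp
  have h1 := H.S_lip k l hkl x a ha b hb A hA B hB 0 z b hb A hA B hB
  have h2 := H.S_lip k l hkl x a ha b hb A hA B hB a ha 0 z A hA B hB
  have h3 := H.S_lip k l hkl x a ha b hb A hA B hB a ha 1 o A hA B hB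
  have h4 := H.S_lip k l hkl x a ha b hb A hA B hB 1 o b hb A hA B hB
  simp only [sub_self, abs_zero, add_zero, sub_zero, zero_add, abs_of_nonneg ha.1,
    abs_of_nonneg hb.1] at h1 h2 h3 h4
  rw [abs_sub_comm b 1, abs_of_nonneg (sub_nonneg.2 hb.2)] at h3
  rw [abs_sub_comm a 1, abs_of_nonneg (sub_nonneg.2 ha.2)] at h4
  have e1 := exchange_zero_left_nonpos (P := P) k l x A B hb.1
  have e2 := exchange_zero_right_nonneg (P := P) k l x A B ha.1
  have e3 := H.exchange_one_right_nonpos k l x (B := B) ha hA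
  have e4 := H.exchange_one_left_nonneg k l x (A := A) hb hB
  rw [abs_le] at h1 h2 h3 h4
  refine ⟨?_, ?_, ?_, ?_⟩ <;> linarith [h1.1, h1.2, h2.1, h2.2, h3.1, h3.2, h4.1, h4.2]

omit H in
lemma abs_posPart_mul_sub_negPart_mul_sub_le (X Y : ℝ) {a b : ℝ} (ha : 0 ≤ a) (hb : 0 ≤ b) :
    |(max X 0 * a - (-min X 0) * b) - (max Y 0 * a - (-min Y 0) * b)| ≤ |X - Y| * (a + b) := by
  have h1 : |max X 0 - max Y 0| ≤ |X - Y| := abs_max_sub_max_le_abs X Y 0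
  have h2 : |min X 0 - min Y 0| ≤ |X - Y| := by
    simpa using abs_min_sub_min_le_max X 0 Y 0
  calc
    _ = |(max X 0 - max Y 0) * a + (min X 0 - min Y 0) * b| := by ring_nf
    _ ≤ |max X 0 - max Y 0| * a + |min X 0 - min Y 0| * b := by
      refine (abs_add_le _ _).trans_eq ?_
      rw [abs_mul, abs_mul, abs_of_nonneg ha, abs_of_nonneg hb]
    _ ≤ |X - Y| * a + |X - Y| * b := by gcongr
    _ = _ := by ring

/-- Changing only the velocities leaves a factor `a + b`, so the resulting source errors are
summable over the grid and not merely bounded. -/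
lemma exchange_sub_le_of_velocity {k l : Fin N} (x y : ℝ) {a b A B A' B' δ : ℝ}
    (ha : a ∈ Icc (0 : ℝ) 1) (hb : b ∈ Icc (0 : ℝ) 1)
    (hk : |P.ν k x A - P.ν k y A'| ≤ δ) (hl : |P.ν l x B - P.ν l y B'| ≤ δ) :
    |P.exchange k l x a b A B - P.exchange k l y a b A' B'| ≤ 2 * Fm * δ * (a + b) := by
  refine (abs_posPart_mul_sub_negPart_mul_sub_le _ _ ha.1 hb.1).trans ?_
  refine mul_le_mul_of_nonneg_right ?_ (add_nonneg ha.1 hb.1)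
  have hδ : 0 ≤ δ := (abs_nonneg _).trans hk
  calc
    _ = |P.g l b * (P.ν l x B - P.ν l y B') - P.g k a * (P.ν k x A - P.ν k y A')| := by ring_nf
    _ ≤ P.g l b * |P.ν l x B - P.ν l y B'| + P.g k a * |P.ν k x A - P.ν k y A'| := by
      refine (abs_sub _ _).trans_eq ?_
      rw [abs_mul, abs_mul, abs_of_nonneg (H.g_nonneg l hb), abs_of_nonneg (H.g_nonneg k ha)]
    _ ≤ Fm * δ + Fm * δ := by
      gcongr
      exacts [H.Fm_nonneg, H.g_le l b hb, H.Fm_nonneg, H.g_le k a ha]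
    _ = _ := by ring

/-- The bounds for `S^k`, which vanishes on the last lane. -/
lemma S_bounds (k : Fin N) (x : ℝ) {U A : Fin N → ℝ} (hU : ∀ j, U j ∈ Icc (0 : ℝ) 1)
    (hA : ∀ j, A j ∈ Icc (0 : ℝ) 1) :
    P.S k x U A ≤ S * U k ∧ -(S * (1 - U k)) ≤ P.S k x U A ∧ |P.S k x U A| ≤ S * ∑ j, U j := by
  have hs : ∀ j, U j ≤ ∑ j, U j := fun j =>
    Finset.single_le_sum (fun i _ => (hU i).1) (Finset.mem_univ j)
  have hS := H.S_nonneg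
  unfold LaneModel.S
  split_ifs with hk
  · obtain ⟨h1, h2, h3, h4⟩ := H.exchange_bounds (k := k) (l := ⟨(k : ℕ) + 1, hk⟩) rfl x (hU k)
      (hU ⟨(k : ℕ) + 1, hk⟩) (hA k) (hA ⟨(k : ℕ) + 1, hk⟩)
    refine ⟨h1, h4, abs_le.2 ⟨?_, ?_⟩⟩
    · exact (neg_le_neg (mul_le_mul_of_nonneg_left (hs _) hS)).trans h2
    · exact h1.trans (mul_le_mul_of_nonneg_left (hs _) hS)
  · have h0 := (hU k).1
    have h1 := (hU k).2
    refine ⟨by positivity, ?_, ?_⟩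
    · exact neg_nonpos.2 (mul_nonneg hS (by linarith))
    · rw [abs_zero]; exact mul_nonneg hS (h0.trans (hs k))

lemma S_prev_bounds {k : Fin N} (hk : 0 < (k : ℕ)) (x : ℝ) {U A : Fin N → ℝ}
    (hU : ∀ j, U j ∈ Icc (0 : ℝ) 1) (hA : ∀ j, A j ∈ Icc (0 : ℝ) 1) :
    P.S ⟨(k : ℕ) - 1, lt_of_le_of_lt (Nat.sub_le _ _) k.isLt⟩ x U A ≤ S * (1 - U k) ∧
      -(S * U k) ≤ P.S ⟨(k : ℕ) - 1, lt_of_le_of_lt (Nat.sub_le _ _) k.isLt⟩ x U A := by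
  have hk' : (k : ℕ) - 1 + 1 = k := Nat.sub_add_cancel hk
  have hlt : (k : ℕ) - 1 + 1 < N := by rw [hk']; exact k.isLt
  have e : (⟨(k : ℕ) - 1 + 1, hlt⟩ : Fin N) = k := Fin.ext hk'
  unfold LaneModel.S
  rw [dif_pos hlt]
  obtain ⟨h1, h2, h3, h4⟩ := H.exchange_bounds
    (k := ⟨(k : ℕ) - 1, lt_of_le_of_lt (Nat.sub_le _ _) k.isLt⟩) (l := ⟨(k : ℕ) - 1 + 1, hlt⟩)
    rfl x (hU _) (hU _) (hA _) (hA _)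
  rw [e] at h1 h2 h3 h4 ⊢
  exact ⟨h3, h2⟩

/-- The loss degenerates at density zero and the gain at density one, which lets the CFL margin
`2ΔtS` preserve `[0,1]`. The last bound makes the source summable. -/
lemma R_bounds (k : Fin N) (x : ℝ) {U A : Fin N → ℝ} (hU : ∀ j, U j ∈ Icc (0 : ℝ) 1)
    (hA : ∀ j, A j ∈ Icc (0 : ℝ) 1) :
    -(2 * S * U k) ≤ P.R k x U A ∧ P.R k x U A ≤ 2 * S * (1 - U k) ∧
      |P.R k x U A| ≤ 2 * S * ∑ j, U j := by
  obtain ⟨h1, h2, h3⟩ := H.S_bounds k x hU hA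
  have hS := H.S_nonneg
  have h5 := mul_nonneg hS (hU k).1
  have h6 := mul_nonneg hS (sub_nonneg.2 (hU k).2)
  have h7 : 0 ≤ S * ∑ j, U j := mul_nonneg hS (Finset.sum_nonneg fun j _ => (hU j).1)
  rw [abs_le] at h3
  unfold LaneModel.R
  split_ifs with hk
  · obtain ⟨h4, h5⟩ := H.S_prev_bounds hk x hU hA
    obtain ⟨-, -, h8⟩ := H.S_bounds ⟨(k : ℕ) - 1, lt_of_le_of_lt (Nat.sub_le _ _) k.isLt⟩ x hU hA
    rw [abs_le] at h8
    refine ⟨by linarith, by linarith, abs_le.2 ⟨by linarith [h3.2, h8.1], by linarith [h3.1, h8.2]⟩⟩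
  · refine ⟨by linarith, by linarith, abs_le.2 ⟨by linarith [h3.2], by linarith [h3.1]⟩⟩

lemma S_sub_le (k : Fin N) (x : ℝ) {U A U' A' : Fin N → ℝ} (hU : ∀ j, U j ∈ Icc (0 : ℝ) 1)
    (hA : ∀ j, A j ∈ Icc (0 : ℝ) 1) (hU' : ∀ j, U' j ∈ Icc (0 : ℝ) 1)
    (hA' : ∀ j, A' j ∈ Icc (0 : ℝ) 1) :
    |P.S k x U A - P.S k x U' A'| ≤ 2 * S * ∑ j, (|U j - U' j| + |A j - A' j|) := by
  have hs : ∀ j, |U j - U' j| + |A j - A' j| ≤ ∑ j, (|U j - U' j| + |A j - A' j|) := fun j =>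
    Finset.single_le_sum (f := fun j => |U j - U' j| + |A j - A' j|)
      (fun i _ => by positivity) (Finset.mem_univ j)
  have hS := H.S_nonneg
  unfold LaneModel.S
  split_ifs with hk
  · refine (H.S_lip k ⟨(k : ℕ) + 1, hk⟩ rfl x _ (hU _) _ (hU _) _ (hA _) _ (hA _) _ (hU' _) _
      (hU' _) _ (hA' _) _ (hA' _)).trans ?_
    have := hs k
    have := hs ⟨(k : ℕ) + 1, hk⟩
    rw [mul_comm 2 S, mul_assoc]
    exact mul_le_mul_of_nonneg_left (by linarith) hS
  · rw [sub_self, abs_zero]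
    exact mul_nonneg (by positivity) (Finset.sum_nonneg fun j _ => by positivity)

lemma R_sub_le (k : Fin N) (x : ℝ) {U A U' A' : Fin N → ℝ} (hU : ∀ j, U j ∈ Icc (0 : ℝ) 1)
    (hA : ∀ j, A j ∈ Icc (0 : ℝ) 1) (hU' : ∀ j, U' j ∈ Icc (0 : ℝ) 1)
    (hA' : ∀ j, A' j ∈ Icc (0 : ℝ) 1) :
    |P.R k x U A - P.R k x U' A'| ≤ 4 * S * ∑ j, (|U j - U' j| + |A j - A' j|) := by
  have h1 := H.S_sub_le k x hU hA hU' hA'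
  have h0 : 0 ≤ 2 * S * ∑ j, (|U j - U' j| + |A j - A' j|) := (abs_nonneg _).trans h1
  rw [abs_le] at h1
  unfold LaneModel.R
  split_ifs with hk
  · have h2 := H.S_sub_le ⟨(k : ℕ) - 1, lt_of_le_of_lt (Nat.sub_le _ _) k.isLt⟩ x hU hA hU' hA'
    rw [abs_le] at h2 ⊢
    constructor <;> linarith [h1.1, h1.2, h2.1, h2.2]
  · rw [abs_le]
    constructor <;> linarith [h1.1, h1.2]

lemma S_sub_le_of_velocity (k : Fin N) (x y : ℝ) {U A A' : Fin N → ℝ} {δ : ℝ}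
    (hU : ∀ j, U j ∈ Icc (0 : ℝ) 1) (hδ : ∀ j, |P.ν j x (A j) - P.ν j y (A' j)| ≤ δ) :
    |P.S k x U A - P.S k y U A'| ≤ 4 * Fm * δ * ∑ j, U j := by
  have hs : ∀ j, U j ≤ ∑ j, U j := fun j =>
    Finset.single_le_sum (fun i _ => (hU i).1) (Finset.mem_univ j)
  have hδ0 : 0 ≤ δ := (abs_nonneg _).trans (hδ k)
  have hF := H.Fm_nonneg
  unfold LaneModel.S
  split_ifs with hk
  · refine (H.exchange_sub_le_of_velocity x y (hU _) (hU _) (hδ _) (hδ _)).trans ?_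
    have := hs k
    have := hs ⟨(k : ℕ) + 1, hk⟩
    calc _ ≤ 2 * Fm * δ * (2 * ∑ j, U j) := by gcongr; linarith
      _ = _ := by ring
  · rw [sub_self, abs_zero]
    exact mul_nonneg (by positivity) (Finset.sum_nonneg fun j _ => (hU j).1)

lemma R_sub_le_of_velocity (k : Fin N) (x y : ℝ) {U A A' : Fin N → ℝ} {δ : ℝ}
    (hU : ∀ j, U j ∈ Icc (0 : ℝ) 1) (hδ : ∀ j, |P.ν j x (A j) - P.ν j y (A' j)| ≤ δ) :
    |P.R k x U A - P.R k y U A'| ≤ 8 * Fm * δ * ∑ j, U j := by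
  have h1 := H.S_sub_le_of_velocity k x y hU hδ
  have h0 := (abs_nonneg _).trans h1
  rw [abs_le] at h1
  unfold LaneModel.R
  split_ifs with hk
  · have h2 := H.S_sub_le_of_velocity ⟨(k : ℕ) - 1, lt_of_le_of_lt (Nat.sub_le _ _) k.isLt⟩
      x y hU hδ
    rw [abs_le] at h2 ⊢
    constructor <;> linarith [h1.1, h1.2, h2.1, h2.2]
  · rw [abs_le]
    constructor <;> linarith [h1.1, h1.2]

end Exchange

end Regime

/-! ### Step functions and grid cells. -/

/-- The piecewise constant function with value `U i` on the `i`-th grid cell. -/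
def stepFun (Δx : ℝ) (U : ℤ → ℝ) (x : ℝ) : ℝ := U ⌊x / Δx + 1 / 2⌋

lemma measurable_stepFun (Δx : ℝ) (U : ℤ → ℝ) : Measurable (stepFun Δx U) :=
  (measurable_of_countable U).comp
    (Int.measurable_floor.comp ((measurable_id.div_const Δx).add_const (1 / 2)))

/-- The `i`-th grid cell. -/
def cell (Δx : ℝ) (i : ℤ) : Set ℝ := Ico (((i : ℝ) - 1 / 2) * Δx) (((i : ℝ) + 1 / 2) * Δx)

lemma mem_cell_iff {Δx : ℝ} (hΔ : 0 < Δx) {i : ℤ} {x : ℝ} :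
    x ∈ cell Δx i ↔ ⌊x / Δx + 1 / 2⌋ = i := by
  rw [Int.floor_eq_iff, cell, mem_Ico, ← le_div_iff₀ hΔ, ← div_lt_iff₀ hΔ]
  constructor <;> rintro ⟨h1, h2⟩ <;> constructor <;> linarith

lemma stepFun_of_mem_cell {Δx : ℝ} (hΔ : 0 < Δx) (U : ℤ → ℝ) {i : ℤ} {x : ℝ}
    (hx : x ∈ cell Δx i) : stepFun Δx U x = U i := by
  rw [stepFun, (mem_cell_iff hΔ).1 hx]

namespace Regime

variable {N : ℕ} {P : LaneModel N} {β lam Δx : ℝ} {Nη : ℕ} {F V : Fin N → ℝ}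
  {Fm D₁ D₂ D₁₁ D₂₁ D₂₂ κ S : ℝ}
  (H : Regime P β lam Δx Nη F V Fm D₁ D₂ D₁₁ D₂₁ D₂₂ κ S)
include H

/-! ### Regularity of the nonlocal average. -/

section Conv

/-- The kernel extended by zero. -/
lemma indicator_ker_nonneg (z : ℝ) : 0 ≤ indicator (Icc 0 P.η) P.ker z :=
  indicator_nonneg H.ker_nonneg z

lemma indicator_ker_le (z : ℝ) : indicator (Icc 0 P.η) P.ker z ≤ κ :=
  indicator_le' (fun y hy => H.ker_le y hy) (fun _ _ => H.κ_nonneg) z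

lemma integrable_indicator_ker : Integrable (indicator (Icc 0 P.η) P.ker) :=
  (integrable_indicator_iff measurableSet_Icc).2 (H.ker_cont.integrableOn_Icc)

lemma integral_indicator_ker : ∫ z, indicator (Icc 0 P.η) P.ker z = 1 := by
  rw [integral_indicator measurableSet_Icc, integral_Icc_eq_integral_Ioc,
    ← intervalIntegral.integral_of_le H.η_pos.le, H.ker_mass]

lemma conv_eq_integral (w : ℝ → ℝ) (x : ℝ) :
    P.conv w x = ∫ y, indicator (Icc 0 P.η) P.ker (y - x) * w y := by
  rw [LaneModel.conv, intervalIntegral.integral_of_le (by linarith [H.η_pos]),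
    ← integral_Icc_eq_integral_Ioc, ← integral_indicator measurableSet_Icc]
  congr 1 with y
  by_cases hy : y ∈ Icc x (x + P.η)
  · rw [indicator_of_mem hy, indicator_of_mem]
    exact ⟨by linarith [hy.1], by linarith [hy.2]⟩
  · rw [indicator_of_notMem hy, indicator_of_notMem, zero_mul]
    exact fun h => hy ⟨by linarith [h.1], by linarith [h.2]⟩

lemma integrable_ker_mul {w : ℝ → ℝ} (hw : Measurable w) (hw' : ∀ x, w x ∈ Icc (0 : ℝ) 1)
    (x : ℝ) : Integrable fun y => indicator (Icc 0 P.η) P.ker (y - x) * w y := by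
  refine (H.integrable_indicator_ker.comp_sub_right x).mul_bdd (c := 1)
    hw.aestronglyMeasurable (ae_of_all _ fun y => ?_)
  rw [Real.norm_eq_abs, abs_of_nonneg (hw' y).1]
  exact (hw' y).2

lemma conv_mem {w : ℝ → ℝ} (hw : Measurable w) (hw' : ∀ x, w x ∈ Icc (0 : ℝ) 1) (x : ℝ) :
    P.conv w x ∈ Icc (0 : ℝ) 1 := by
  rw [H.conv_eq_integral]
  refine ⟨integral_nonneg fun y => mul_nonneg (H.indicator_ker_nonneg _) (hw' y).1, ?_⟩
  calc
    _ ≤ ∫ y, indicator (Icc 0 P.η) P.ker (y - x) :=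
      integral_mono (H.integrable_ker_mul hw hw' x) (H.integrable_indicator_ker.comp_sub_right x)
        fun y => mul_le_of_le_one_right (H.indicator_ker_nonneg _) (hw' y).2
    _ = 1 := by
      rw [integral_sub_right_eq_self (fun y => indicator (Icc 0 P.η) P.ker y) x,
        H.integral_indicator_ker]

/-- Outside `[0,h]` monotonicity makes the shifted kernel the larger one, so the absolute value is a
difference of two terms with equal integrals. Only `[0,h]` needs the correction `2κ`. -/
lemma abs_ker_sub_shift_le {h : ℝ} (hh : 0 ≤ h) (z : ℝ) :
    |indicator (Icc 0 P.η) P.ker z - indicator (Icc 0 P.η) P.ker (z - h)| ≤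
      (indicator (Icc 0 P.η) P.ker (z - h) - indicator (Icc 0 P.η) P.ker z)
        + indicator (Icc 0 h) (fun _ => 2 * κ) z := by
  have h0 := H.indicator_ker_nonneg z
  have h1 := H.indicator_ker_nonneg (z - h)
  have h2 := H.indicator_ker_le z
  by_cases hz : z ∈ Icc 0 h
  · rw [indicator_of_mem hz, abs_le]
    constructor <;> linarith
  · rw [indicator_of_notMem hz, add_zero, abs_sub_comm, abs_of_nonneg]
    rw [sub_nonneg]
    by_cases hz' : z ∈ Icc 0 P.η
    · have hzh : h < z := by
        by_contra hc
        exact hz ⟨hz'.1, not_lt.1 hc⟩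
      have hm : z - h ∈ Icc 0 P.η := ⟨by linarith, by linarith [hz'.2]⟩
      rw [indicator_of_mem hz', indicator_of_mem hm]
      exact H.ker_antitone hm hz' (by linarith)
    · rw [indicator_of_notMem hz']
      exact h1

lemma integral_abs_ker_sub_shift_le {h : ℝ} (hh : 0 ≤ h) :
    ∫ z, |indicator (Icc 0 P.η) P.ker z - indicator (Icc 0 P.η) P.ker (z - h)| ≤ 2 * κ * h := by
  have i0 := H.integrable_indicator_ker
  have i1 := i0.comp_sub_right h
  have i2 : Integrable (indicator (Icc 0 h) (fun _ => 2 * κ)) :=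
    (integrable_indicator_iff measurableSet_Icc).2 continuousOn_const.integrableOn_Icc
  have i3 : Integrable fun z =>
      indicator (Icc 0 P.η) P.ker (z - h) - indicator (Icc 0 P.η) P.ker z := i1.sub i0
  calc
    _ ≤ ∫ z, ((indicator (Icc 0 P.η) P.ker (z - h) - indicator (Icc 0 P.η) P.ker z)
        + indicator (Icc 0 h) (fun _ => 2 * κ) z) :=
      integral_mono (i0.sub i1).abs (i3.add i2) fun z => H.abs_ker_sub_shift_le hh z
    _ = _ := by
      rw [integral_add i3 i2, integral_sub i1 i0,
        integral_sub_right_eq_self (fun y => indicator (Icc 0 P.η) P.ker y) h, sub_self, zero_add,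
        integral_indicator measurableSet_Icc, setIntegral_const]
      simp [hh]
      ring

/-- The state is only measurable, so the increment is transferred to the kernel, whose translates by
`h` differ by at most `2κh` in `L¹`. -/
lemma conv_lip {w : ℝ → ℝ} (hw : Measurable w) (hw' : ∀ x, w x ∈ Icc (0 : ℝ) 1) (x y : ℝ) :
    |P.conv w x - P.conv w y| ≤ 2 * κ * |x - y| := by
  wlog hxy : x ≤ y generalizing x y with hwlog
  · rw [abs_sub_comm, abs_sub_comm x y]
    exact hwlog y x (not_le.1 hxy).le
  rw [abs_sub_comm x y, abs_of_nonneg (sub_nonneg.2 hxy), H.conv_eq_integral,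
    H.conv_eq_integral, ← integral_sub (H.integrable_ker_mul hw hw' x)
      (H.integrable_ker_mul hw hw' y)]
  have i0 := H.integrable_indicator_ker
  have i1 := (i0.sub (i0.comp_sub_right (y - x))).abs
  calc
    _ ≤ ∫ z, |indicator (Icc 0 P.η) P.ker (z - x) -
          indicator (Icc 0 P.η) P.ker (z - x - (y - x))| := by
      rw [← Real.norm_eq_abs]
      refine norm_integral_le_of_norm_le (i1.comp_sub_right x) (ae_of_all _ fun z => ?_)
      rw [← sub_mul, norm_mul, Real.norm_eq_abs, Real.norm_eq_abs, abs_of_nonneg (hw' z).1,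
        show z - x - (y - x) = z - y by ring]
      exact mul_le_of_le_one_right (abs_nonneg _) (hw' z).2
    _ = ∫ z, |indicator (Icc 0 P.η) P.ker z - indicator (Icc 0 P.η) P.ker (z - (y - x))| :=
      integral_sub_right_eq_self (fun z => |indicator (Icc 0 P.η) P.ker z -
          indicator (Icc 0 P.η) P.ker (z - (y - x))|) x
    _ ≤ _ := H.integral_abs_ker_sub_shift_le (sub_nonneg.2 hxy)

lemma velocity_lip {w : ℝ → ℝ} (hw : Measurable w) (hw' : ∀ x, w x ∈ Icc (0 : ℝ) 1)
    (k : Fin N) (x y : ℝ) :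
    |P.ν k x (P.conv w x) - P.ν k y (P.conv w y)| ≤ (D₁ + 2 * κ * D₂) * |x - y| := by
  have h1 := H.ν_x k x y _ (H.conv_mem hw hw' x)
  have h2 := H.ν_A k y _ (H.conv_mem hw hw' x) _ (H.conv_mem hw hw' y)
  have h3 := mul_le_mul_of_nonneg_left (H.conv_lip hw hw' x y) H.D₂_nonneg
  have := abs_sub_le (P.ν k x (P.conv w x)) (P.ν k y (P.conv w x)) (P.ν k y (P.conv w y))
  linarith

end Conv

/-! ### Quadrature weights of the kernel. -/

section Grid

lemma grid_mem {p : ℕ} (hp : p ≤ Nη) : (p : ℝ) * Δx ∈ Icc 0 P.η := by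
  rw [H.η_eq]
  have := H.Δx_pos
  exact ⟨by positivity, by gcongr⟩

lemma ker_intervalIntegrable {a b : ℝ} (ha : a ∈ Icc 0 P.η) (hb : b ∈ Icc 0 P.η) :
    IntervalIntegrable P.ker volume a b :=
  (H.ker_cont.mono (by
    intro x hx
    rw [mem_uIcc] at hx
    rcases hx with hx | hx
    · exact ⟨ha.1.trans hx.1, hx.2.trans hb.2⟩
    · exact ⟨hb.1.trans hx.1, hx.2.trans ha.2⟩)).intervalIntegrable

lemma zeta_nonneg {p : ℕ} (hp : p < Nη) : 0 ≤ P.zeta Δx p := by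
  have h0 := H.grid_mem hp.le
  have h1 := H.grid_mem (p := p + 1) hp
  push_cast at h1
  have := H.Δx_pos
  refine intervalIntegral.integral_nonneg (by gcongr; linarith) fun y hy => H.ker_nonneg y ?_
  exact ⟨h0.1.trans hy.1, hy.2.trans h1.2⟩

lemma zeta_le {p : ℕ} (hp : p < Nη) : P.zeta Δx p ≤ κ * Δx := by
  have h0 := H.grid_mem hp.le
  have h1 := H.grid_mem (p := p + 1) hp
  push_cast at h1
  have := H.Δx_pos
  have hle : (p : ℝ) * Δx ≤ ((p : ℝ) + 1) * Δx := by gcongr; linarith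
  calc
    _ ≤ ∫ y in ((p : ℝ) * Δx)..(((p : ℝ) + 1) * Δx), κ :=
      intervalIntegral.integral_mono_on hle (H.ker_intervalIntegrable h0 h1)
        intervalIntegrable_const fun y hy => H.ker_le y ⟨h0.1.trans hy.1, hy.2.trans h1.2⟩
    _ = _ := by rw [intervalIntegral.integral_const, smul_eq_mul]; ring

lemma zeta_succ_le {p : ℕ} (hp : p + 1 < Nη) : P.zeta Δx (p + 1) ≤ P.zeta Δx p := by
  have h0 := H.grid_mem (p := p) (by omega)
  have h1 := H.grid_mem (p := p + 1) hp.le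
  have h2 := H.grid_mem (p := p + 1 + 1) hp
  have := H.Δx_pos
  unfold LaneModel.zeta
  have e : ∫ y in (((p + 1 : ℕ) : ℝ) * Δx)..((((p + 1 : ℕ) : ℝ) + 1) * Δx), P.ker y =
      ∫ y in ((p : ℝ) * Δx)..(((p : ℝ) + 1) * Δx), P.ker (y + Δx) := by
    rw [intervalIntegral.integral_comp_add_right]
    push_cast
    congr 1 <;> ring
  rw [e]
  push_cast at h1 h2
  have hle : (p : ℝ) * Δx ≤ ((p : ℝ) + 1) * Δx := by gcongr; linarith
  refine intervalIntegral.integral_mono_on hle ?_ (H.ker_intervalIntegrable h0 h1) fun y hy => ?_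
  · have := (H.ker_intervalIntegrable h1 h2).comp_add_right Δx
    convert! this using 1 <;> ring
  · have m0 : y ∈ Icc 0 P.η := ⟨h0.1.trans hy.1, hy.2.trans h1.2⟩
    refine H.ker_antitone m0 ⟨by linarith [m0.1], ?_⟩ (by linarith)
    linarith [h2.2, hy.2]

lemma sum_zeta : ∑ p ∈ Finset.range Nη, P.zeta Δx p = 1 := by
  have := intervalIntegral.sum_integral_adjacent_intervals (μ := volume) (f := P.ker)
    (a := fun p : ℕ => (p : ℝ) * Δx) (n := Nη) (fun p hp =>
      H.ker_intervalIntegrable (H.grid_mem hp.le) (H.grid_mem (p := p + 1) hp))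
  push_cast at this
  rw [zero_mul, ← H.η_eq, H.ker_mass] at this
  exact this

end Grid

end Regime

/-! ### Discrete convolution and interface velocities. -/

/-- The velocity at the interface `x_{i+1/2}`. -/
def interfaceVelocity {N : ℕ} (P : LaneModel N) (Δx : ℝ) (Nη : ℕ) (k : Fin N)
    (U : ℤ → ℝ) (i : ℤ) : ℝ :=
  P.ν k (((i : ℝ) + 1 / 2) * Δx) (P.cHalf Δx Nη U i)

namespace Regime

variable {N : ℕ} {P : LaneModel N} {β lam Δx : ℝ} {Nη : ℕ} {F V : Fin N → ℝ}
  {Fm D₁ D₂ D₁₁ D₂₁ D₂₂ κ S : ℝ}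
  (H : Regime P β lam Δx Nη F V Fm D₁ D₂ D₁₁ D₂₁ D₂₂ κ S)
include H

/-- Since `η` is a multiple of `Δx`, the window to the right of an interface consists of whole
cells. The discrete convolution has no quadrature error there, so bounds for the continuous one
transfer to the grid. -/
lemma conv_stepFun_half (U : ℤ → ℝ) (i : ℤ) :
    P.conv (stepFun Δx U) (((i : ℝ) + 1 / 2) * Δx) = P.cHalf Δx Nη U i := by
  have hΔ := H.Δx_pos
  set x := ((i : ℝ) + 1 / 2) * Δx
  have hcell : ∀ p : ℕ, ∀ z ∈ Ioo ((p : ℝ) * Δx) (((p : ℝ) + 1) * Δx),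
      stepFun Δx U (x + z) = U (i + p + 1) := fun p z hz => by
    refine stepFun_of_mem_cell hΔ U ⟨?_, ?_⟩ <;> push_cast <;> simp only [x]
    · linarith [hz.1]
    · linarith [hz.2]
  have hpiece : ∀ p : ℕ, ∫ z in ((p : ℝ) * Δx)..(((p : ℝ) + 1) * Δx),
      P.ker z * stepFun Δx U (x + z) = P.zeta Δx p * U (i + p + 1) := fun p => by
    have hle : (p : ℝ) * Δx ≤ ((p : ℝ) + 1) * Δx := by gcongr; linarith
    rw [LaneModel.zeta, ← intervalIntegral.integral_mul_const,
      intervalIntegral.integral_of_le hle, intervalIntegral.integral_of_le hle,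
      integral_Ioc_eq_integral_Ioo, integral_Ioc_eq_integral_Ioo]
    exact setIntegral_congr_fun measurableSet_Ioo fun z hz => by simp only [hcell p z hz]
  have hint : ∀ p < Nη, IntervalIntegrable (fun z => P.ker z * stepFun Δx U (x + z)) volume
      ((p : ℝ) * Δx) ((p + 1 : ℕ) * Δx) := fun p hp => by
    have h0 := (H.ker_intervalIntegrable (H.grid_mem hp.le)
      (H.grid_mem (p := p + 1) hp)).mul_const (U (i + p + 1))
    refine h0.congr_uIoo fun z hz => ?_
    rw [uIoo_of_le (by push_cast; gcongr; linarith)] at hz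
    push_cast at hz
    simp only [hcell p z hz]
  have hsum := intervalIntegral.sum_integral_adjacent_intervals hint
  push_cast at hsum
  rw [zero_mul, ← H.η_eq] at hsum
  simp only [hpiece] at hsum
  rw [LaneModel.cHalf, hsum, LaneModel.conv]
  have := intervalIntegral.integral_comp_add_left
    (fun y => P.ker (y - x) * stepFun Δx U y) x (a := 0) (b := P.η)
  simp only [add_sub_cancel_left, add_zero] at this
  rw [this]

lemma cHalf_mem {U : ℤ → ℝ} (hU : ∀ i, U i ∈ Icc (0 : ℝ) 1) (i : ℤ) :
    P.cHalf Δx Nη U i ∈ Icc (0 : ℝ) 1 := by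
  rw [← H.conv_stepFun_half]
  exact H.conv_mem (measurable_stepFun _ _) (fun x => hU _) _

lemma cFull_mem {U : ℤ → ℝ} (hU : ∀ i, U i ∈ Icc (0 : ℝ) 1) (i : ℤ) :
    P.cFull Δx Nη U i ∈ Icc (0 : ℝ) 1 := by
  have h1 := H.cHalf_mem hU i
  have h2 := H.cHalf_mem hU (i + 1)
  rw [LaneModel.cFull]
  constructor <;> linarith [h1.1, h1.2, h2.1, h2.2]

omit H in
lemma cHalf_sub (U U' : ℤ → ℝ) (i : ℤ) :
    P.cHalf Δx Nη U i - P.cHalf Δx Nη U' i = P.cHalf Δx Nη (fun i => U i - U' i) i := by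
  simp only [LaneModel.cHalf, mul_sub, Finset.sum_sub_distrib]

omit H in
lemma cFull_sub (U U' : ℤ → ℝ) (i : ℤ) :
    P.cFull Δx Nη U i - P.cFull Δx Nη U' i = P.cFull Δx Nη (fun i => U i - U' i) i := by
  simp only [LaneModel.cFull, ← cHalf_sub]
  ring

omit H in
lemma cHalf_succ (U : ℤ → ℝ) (i : ℤ) :
    P.cHalf Δx Nη U (i + 1) = P.cHalf Δx Nη (fun i => U (i + 1)) i := by
  simp only [LaneModel.cHalf]
  refine Finset.sum_congr rfl fun p _ => ?_
  congr 2; ring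

lemma sumAbsLe_cHalf {z : ℤ → ℝ} {C : ℝ} (hz : SumAbsLe z C) :
    SumAbsLe (P.cHalf Δx Nη z) C := by
  have := SumAbsLe.sum (t := Finset.range Nη) (a := fun p i => P.zeta Δx p * z (i + p + 1))
    (C := fun p => P.zeta Δx p * C) fun p hp =>
      ((hz.shift (p + 1)).const_mul (H.zeta_nonneg (Finset.mem_range.1 hp))).mono fun i => by
        rw [add_assoc]
  rw [← Finset.sum_mul, H.sum_zeta, one_mul] at this
  exact this

lemma sumAbsLe_cFull {z : ℤ → ℝ} {C : ℝ} (hz : SumAbsLe z C) :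
    SumAbsLe (P.cFull Δx Nη z) C := by
  have h := H.sumAbsLe_cHalf hz
  have := (h.add (h.shift 1)).const_mul (c := 1 / 2) (by norm_num)
  exact (this.of_le (D := C) (by linarith)).mono fun i => le_rfl

omit H in
/-- Summation by parts in the discrete convolution. -/
lemma sum_zeta_mul_sub (z : ℤ → ℝ) (i : ℤ) (m : ℕ) :
    ∑ p ∈ Finset.range (m + 1), P.zeta Δx p * (z (i + p + 1) - z (i + p)) =
      P.zeta Δx m * z (i + m + 1) + -(P.zeta Δx 0 * z i) +
        ∑ p ∈ Finset.range m, (P.zeta Δx p - P.zeta Δx (p + 1)) * z (i + p + 1) := by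
  induction m with
  | zero => simp; ring
  | succ m ih =>
    rw [Finset.sum_range_succ, ih, Finset.sum_range_succ]
    push_cast
    rw [show i + ((m : ℤ) + 1) = i + m + 1 by ring]
    ring

/-- Summation by parts moves the difference onto the weights. As `ζ` decreases, the weights `ζ_m`,
`ζ_0` and `ζ_p - ζ_{p+1}` add up to `2ζ_0 ≤ 2κΔx`. -/
lemma sumAbsLe_cHalf_sub {z : ℤ → ℝ} {C : ℝ} (hz : SumAbsLe z C) :
    SumAbsLe (fun i => P.cHalf Δx Nη z i - P.cHalf Δx Nη z (i - 1)) (2 * κ * Δx * C) := by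
  have hN : Nη ≠ 0 := by
    rintro rfl
    have h1 := H.η_pos
    have h2 := H.η_eq
    simp at h2
    linarith
  obtain ⟨m, rfl⟩ := Nat.exists_eq_succ_of_ne_zero hN
  have e : ∀ i, P.cHalf Δx (m + 1) z i - P.cHalf Δx (m + 1) z (i - 1) =
      P.zeta Δx m * z (i + m + 1) + -(P.zeta Δx 0 * z i) +
        ∑ p ∈ Finset.range m, (P.zeta Δx p - P.zeta Δx (p + 1)) * z (i + p + 1) := fun i => by
    rw [← sum_zeta_mul_sub, LaneModel.cHalf, LaneModel.cHalf, ← Finset.sum_sub_distrib]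
    refine Finset.sum_congr rfl fun p _ => ?_
    rw [← mul_sub, show i - 1 + (p : ℤ) + 1 = i + p by ring]
  have h0 : 0 ≤ P.zeta Δx 0 := H.zeta_nonneg (by omega)
  have hm : 0 ≤ P.zeta Δx m := H.zeta_nonneg (by omega)
  have b1 : SumAbsLe (fun i => P.zeta Δx m * z (i + m + 1)) (P.zeta Δx m * C) :=
    ((hz.shift (m + 1)).const_mul hm).mono fun i => by rw [add_assoc]
  have b2 : SumAbsLe (fun i => -(P.zeta Δx 0 * z i)) (P.zeta Δx 0 * C) :=
    (hz.const_mul h0).mono fun i => by rw [abs_neg]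
  have b3 : SumAbsLe (fun i => ∑ p ∈ Finset.range m,
      (P.zeta Δx p - P.zeta Δx (p + 1)) * z (i + p + 1))
      (∑ p ∈ Finset.range m, (P.zeta Δx p - P.zeta Δx (p + 1)) * C) :=
    SumAbsLe.sum fun p hp => ((hz.shift (p + 1)).const_mul (sub_nonneg.2 (H.zeta_succ_le (by
      have := Finset.mem_range.1 hp; omega)))).mono fun i => by rw [add_assoc]
  have hb := (b1.add b2).add b3
  rw [← Finset.sum_mul, Finset.sum_range_sub'] at hb
  refine (hb.of_le ?_).mono fun i => by rw [e]
  have := mul_le_mul_of_nonneg_right (H.zeta_le (p := 0) (by omega)) hz.nonneg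
  linarith

lemma abs_cHalf_sub_le {U : ℤ → ℝ} (hU : ∀ i, U i ∈ Icc (0 : ℝ) 1) (i : ℤ) :
    |P.cHalf Δx Nη U (i + 1) - P.cHalf Δx Nη U i| ≤ 2 * κ * Δx := by
  rw [← H.conv_stepFun_half, ← H.conv_stepFun_half]
  refine (H.conv_lip (measurable_stepFun _ _) (fun x => hU _) _ _).trans_eq ?_
  rw [← sub_mul, abs_mul, abs_of_pos H.Δx_pos]
  push_cast
  norm_num

lemma interfaceVelocity_nonneg (k : Fin N) {U : ℤ → ℝ} (hU : ∀ i, U i ∈ Icc (0 : ℝ) 1) (i : ℤ) :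
    0 ≤ interfaceVelocity P Δx Nη k U i := H.ν_nonneg _ _ _ (H.cHalf_mem hU i)

lemma interfaceVelocity_le (k : Fin N) {U : ℤ → ℝ} (hU : ∀ i, U i ∈ Icc (0 : ℝ) 1) (i : ℤ) :
    interfaceVelocity P Δx Nη k U i ≤ V k := H.ν_le _ _ _ (H.cHalf_mem hU i)

lemma abs_interfaceVelocity_sub_le (k : Fin N) {U : ℤ → ℝ} (hU : ∀ i, U i ∈ Icc (0 : ℝ) 1)
    (i : ℤ) : |interfaceVelocity P Δx Nη k U i - interfaceVelocity P Δx Nη k U (i - 1)| ≤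
      (D₁ + 2 * κ * D₂) * Δx := by
  rw [interfaceVelocity, interfaceVelocity, ← H.conv_stepFun_half, ← H.conv_stepFun_half]
  refine (H.velocity_lip (measurable_stepFun _ _) (fun x => hU _) k _ _).trans_eq ?_
  rw [← sub_mul, abs_mul, abs_of_pos H.Δx_pos]
  push_cast
  norm_num

/-- Position and averaged state are varied separately: a second difference in space, a mixed
difference over `2Δx`, and a second difference in the state. The last leaves `D₂` times a second
difference of the convolution, whose smallness is exploited only in `ℓ¹`. -/
lemma abs_interfaceVelocity_second_difference_le (k : Fin N) {U : ℤ → ℝ}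
    (hU : ∀ i, U i ∈ Icc (0 : ℝ) 1) (i : ℤ) :
    |interfaceVelocity P Δx Nη k U (i + 1) - 2 * interfaceVelocity P Δx Nη k U i
        + interfaceVelocity P Δx Nη k U (i - 1)| ≤
      (D₁₁ + 4 * κ * D₂₁ + 8 * κ ^ 2 * D₂₂) * Δx ^ 2 +
        D₂ * |(P.cHalf Δx Nη U (i + 1) - P.cHalf Δx Nη U i)
          - (P.cHalf Δx Nη U i - P.cHalf Δx Nη U (i - 1))| := by
  have hΔ := H.Δx_pos
  have hκ := H.κ_nonneg
  set x := ((i : ℝ) + 1 / 2) * Δx with hx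
  have ep : (((i + 1 : ℤ) : ℝ) + 1 / 2) * Δx = x + Δx := by push_cast; rw [hx]; ring
  have em : (((i - 1 : ℤ) : ℝ) + 1 / 2) * Δx = x - Δx := by push_cast; rw [hx]; ring
  have hp := H.abs_cHalf_sub_le hU i
  have hm := H.abs_cHalf_sub_le hU (i - 1)
  rw [sub_add_cancel] at hm
  have mp := H.cHalf_mem hU (i + 1)
  have m0 := H.cHalf_mem hU i
  have mm := H.cHalf_mem hU (i - 1)
  simp only [interfaceVelocity, ep, em, ← hx]
  set a := P.cHalf Δx Nη U (i + 1)
  set b := P.cHalf Δx Nη U i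
  set c := P.cHalf Δx Nη U (i - 1)
  have t1 := H.ν_xx k x Δx hΔ.le b m0
  have t2 := H.ν_xA k (x + Δx) (x - Δx) a mp b m0
  have t3 := H.ν_AA k (x - Δx) a mp b m0 b m0 c mm
  rw [show x + Δx - (x - Δx) = 2 * Δx by ring, abs_of_pos (by positivity : 0 < 2 * Δx)] at t2
  have t2' : D₂₁ * (2 * Δx) * |a - b| ≤ D₂₁ * (2 * Δx) * (2 * κ * Δx) :=
    mul_le_mul_of_nonneg_left hp (mul_nonneg H.D₂₁_nonneg (by positivity))
  have t3' : D₂₂ * |a - b| * (|a - b| + |b - c|) ≤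
      D₂₂ * (2 * κ * Δx) * (2 * κ * Δx + 2 * κ * Δx) := by
    have := H.D₂₂_nonneg
    gcongr
  have key : P.ν k (x + Δx) a - 2 * P.ν k x b + P.ν k (x - Δx) c =
      (P.ν k (x + Δx) b - 2 * P.ν k x b + P.ν k (x - Δx) b) +
      ((P.ν k (x + Δx) a - P.ν k (x + Δx) b) - (P.ν k (x - Δx) a - P.ν k (x - Δx) b)) +
      ((P.ν k (x - Δx) a - P.ν k (x - Δx) b) - (P.ν k (x - Δx) b - P.ν k (x - Δx) c)) := by
    ring
  rw [key]
  refine (abs_add_three _ _ _).trans ?_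
  linarith

/-- The mixed space-state difference of the interface velocities of two states. -/
lemma abs_interfaceVelocity_mixed_difference_le (k : Fin N) {U U' : ℤ → ℝ}
    (hU : ∀ i, U i ∈ Icc (0 : ℝ) 1) (hU' : ∀ i, U' i ∈ Icc (0 : ℝ) 1) (i : ℤ) :
    |(interfaceVelocity P Δx Nη k U i - interfaceVelocity P Δx Nη k U (i - 1))
        - (interfaceVelocity P Δx Nη k U' i - interfaceVelocity P Δx Nη k U' (i - 1))| ≤
      (D₂₁ + 4 * κ * D₂₂) * Δx * |P.cHalf Δx Nη (fun i => U i - U' i) i| +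
        D₂ * |P.cHalf Δx Nη (fun i => U i - U' i) i
          - P.cHalf Δx Nη (fun i => U i - U' i) (i - 1)| := by
  have hΔ := H.Δx_pos
  have hκ := H.κ_nonneg
  have h1 := H.abs_cHalf_sub_le hU (i - 1)
  have h2 := H.abs_cHalf_sub_le hU' (i - 1)
  rw [sub_add_cancel] at h1 h2
  simp only [interfaceVelocity, ← cHalf_sub]
  set x := ((i : ℝ) + 1 / 2) * Δx with hx
  have em : (((i - 1 : ℤ) : ℝ) + 1 / 2) * Δx = x - Δx := by push_cast; rw [hx]; ring
  rw [em]
  have ma := H.cHalf_mem hU i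
  have mb := H.cHalf_mem hU (i - 1)
  have ma' := H.cHalf_mem hU' i
  have mb' := H.cHalf_mem hU' (i - 1)
  set a := P.cHalf Δx Nη U i
  set b := P.cHalf Δx Nη U (i - 1)
  set a' := P.cHalf Δx Nη U' i
  set b' := P.cHalf Δx Nη U' (i - 1)
  have t1 := H.ν_xA k x (x - Δx) a ma a' ma'
  have t2 := H.ν_AA k (x - Δx) a ma a' ma' b mb b' mb'
  rw [sub_sub_cancel, abs_of_pos hΔ] at t1
  have t2' : D₂₂ * |a - a'| * (|a - b| + |a' - b'|) ≤
      D₂₂ * |a - a'| * (2 * κ * Δx + 2 * κ * Δx) := by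
    have := H.D₂₂_nonneg
    gcongr
  -- A mixed difference in position and state, plus the comparison of two increments in the state at
  -- the common position `x - Δx`.
  have key : (P.ν k x a - P.ν k (x - Δx) b) - (P.ν k x a' - P.ν k (x - Δx) b') =
      ((P.ν k x a - P.ν k x a') - (P.ν k (x - Δx) a - P.ν k (x - Δx) a')) +
      ((P.ν k (x - Δx) a - P.ν k (x - Δx) a') - (P.ν k (x - Δx) b - P.ν k (x - Δx) b')) := by
    ring
  rw [key]
  refine (abs_add_le _ _).trans ?_
  linarith

end Regime

/-! ### Monotonicity of the Lax–Friedrichs update. -/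

/-- The Lax–Friedrichs update of the middle value `b` with neighbours `a`, `c` and the interface
velocities `νl`, `νr`. -/
def laxFriedrichs (f : ℝ → ℝ) (β lam νl νr a b c : ℝ) : ℝ :=
  b - lam * (1 / 2 * νr * (f b + f c) - 1 / 2 * νl * (f a + f b)) + β / 2 * (c - 2 * b + a)

/-- The update is monotone, with a gain in the middle variable. -/
lemma laxFriedrichs_mono {f : ℝ → ℝ} {F β lam V νl νr δ a b c a' b' c' : ℝ}
    (hf : ∀ x ∈ Icc (0 : ℝ) 1, ∀ y ∈ Icc (0 : ℝ) 1, |f x - f y| ≤ F * |x - y|)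
    (hF : 0 ≤ F) (hlam : 0 ≤ lam) (hl : νl ∈ Icc 0 V) (hr : νr ∈ Icc 0 V)
    (hside : lam * F * V ≤ β) (hmid : β + lam * F * V + δ ≤ 1)
    (ha : a ∈ Icc (0 : ℝ) 1) (hb : b ∈ Icc (0 : ℝ) 1) (hc : c ∈ Icc (0 : ℝ) 1)
    (ha' : a' ∈ Icc (0 : ℝ) 1) (hb' : b' ∈ Icc (0 : ℝ) 1) (hc' : c' ∈ Icc (0 : ℝ) 1)
    (haa : a ≤ a') (hbb : b ≤ b') (hcc : c ≤ c') :
    δ * (b' - b) ≤ laxFriedrichs f β lam νl νr a' b' c' - laxFriedrichs f β lam νl νr a b c := by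
  have fa := hf a' ha' a ha
  have fb := hf b' hb' b hb
  have fc := hf c' hc' c hc
  rw [abs_of_nonneg (sub_nonneg.2 haa), abs_le] at fa
  rw [abs_of_nonneg (sub_nonneg.2 hbb)] at fb
  rw [abs_of_nonneg (sub_nonneg.2 hcc), abs_le] at fc
  have hV : 0 ≤ V := hl.1.trans hl.2
  have h1 : -(β * (a' - a)) ≤ lam * νl * (f a' - f a) := by
    have e1 : lam * νl * (-(F * (a' - a))) ≤ lam * νl * (f a' - f a) :=
      mul_le_mul_of_nonneg_left fa.1 (mul_nonneg hlam hl.1)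
    have e2 : lam * νl * F ≤ lam * V * F := by
      have := hl.2
      gcongr
    have e3 : lam * νl * F * (a' - a) ≤ β * (a' - a) :=
      mul_le_mul_of_nonneg_right (by linarith) (sub_nonneg.2 haa)
    linarith
  have h2 : lam * νr * (f c' - f c) ≤ β * (c' - c) := by
    have e1 : lam * νr * (f c' - f c) ≤ lam * νr * (F * (c' - c)) :=
      mul_le_mul_of_nonneg_left fc.2 (mul_nonneg hlam hr.1)
    have e2 : lam * νr * F ≤ lam * V * F := by
      have := hr.2
      gcongr
    have e3 : lam * νr * F * (c' - c) ≤ β * (c' - c) :=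
      mul_le_mul_of_nonneg_right (by linarith) (sub_nonneg.2 hcc)
    linarith
  -- The middle value enters both interface fluxes, so its flux increment carries only `νr - νl`,
  -- and this is at most `V` because both velocities lie in `[0,V]`.
  have h3 : lam * ((νr - νl) * (f b' - f b)) ≤ (1 - β - δ) * (b' - b) := by
    have e0 : |νr - νl| ≤ V := abs_le.2 ⟨by linarith [hl.2, hr.1], by linarith [hl.1, hr.2]⟩
    have e1 : (νr - νl) * (f b' - f b) ≤ V * (F * (b' - b)) := by
      refine (le_abs_self _).trans ?_
      rw [abs_mul]
      gcongr
    have e2 := mul_le_mul_of_nonneg_left e1 hlam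
    have e3 : lam * F * V * (b' - b) ≤ (1 - β - δ) * (b' - b) :=
      mul_le_mul_of_nonneg_right (by linarith) (sub_nonneg.2 hbb)
    linarith
  have h4 : 0 ≤ (1 - β - δ) * (b' - b) := by
    refine mul_nonneg ?_ (sub_nonneg.2 hbb)
    have : 0 ≤ lam * F * V := by positivity
    linarith
  unfold laxFriedrichs
  linarith

/-- The sum of the densities of all lanes. -/
def totalDensity {N : ℕ} (U : Fin N → ℤ → ℝ) (i : ℤ) : ℝ := ∑ k, U k i

/-- The sum over all lanes of the jumps between neighbouring cells. -/
def totalJump {N : ℕ} (U : Fin N → ℤ → ℝ) (i : ℤ) : ℝ := ∑ k, |U k (i + 1) - U k i|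

/-- One time step of the scheme. -/
def march {N : ℕ} (P : LaneModel N) (β lam Δx : ℝ) (Nη : ℕ) (U : Fin N → ℤ → ℝ) (k : Fin N)
    (i : ℤ) : ℝ :=
  laxFriedrichs (P.f k) β lam (interfaceVelocity P Δx Nη k (U k) (i - 1))
      (interfaceVelocity P Δx Nη k (U k) i) (U k (i - 1)) (U k i) (U k (i + 1))
    + lam * Δx * P.numSource Δx Nη U k i

lemma scheme_succ {N : ℕ} (P : LaneModel N) (β : ℝ) {lam Δx : ℝ} (hlam : lam ≠ 0) (hΔ : Δx ≠ 0)
    (Nη : ℕ) (u₀ : Fin N → ℝ → ℝ) (n : ℕ) :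
    P.scheme β Δx (lam * Δx) Nη u₀ (n + 1) =
      march P β lam Δx Nη (P.scheme β Δx (lam * Δx) Nη u₀ n) := by
  ext k i
  simp only [LaneModel.scheme, march, laxFriedrichs, LaneModel.numFlux, interfaceVelocity,
    mul_div_cancel_right₀ _ hΔ, sub_add_cancel]
  field_simp
  ring

namespace Regime

variable {N : ℕ} {P : LaneModel N} {β lam Δx : ℝ} {Nη : ℕ} {F V : Fin N → ℝ}
  {Fm D₁ D₂ D₁₁ D₂₁ D₂₂ κ S : ℝ}
  (H : Regime P β lam Δx Nη F V Fm D₁ D₂ D₁₁ D₂₁ D₂₂ κ S)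
include H

omit H in
lemma le_totalDensity {U : Fin N → ℤ → ℝ} (hU : ∀ k i, U k i ∈ Icc (0 : ℝ) 1) (k : Fin N)
    (i : ℤ) : U k i ≤ totalDensity U i :=
  Finset.single_le_sum (f := fun k => U k i) (fun j _ => (hU j i).1) (Finset.mem_univ k)

omit H in
lemma le_totalJump (U : Fin N → ℤ → ℝ) (k : Fin N) (i : ℤ) :
    |U k (i + 1) - U k i| ≤ totalJump U i :=
  Finset.single_le_sum (f := fun k => |U k (i + 1) - U k i|) (fun _ _ => abs_nonneg _)
    (Finset.mem_univ k)

omit H in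
lemma sumAbsLe_lane {U : Fin N → ℤ → ℝ} (hU : ∀ k i, U k i ∈ Icc (0 : ℝ) 1) {m : ℝ}
    (hm : SumAbsLe (totalDensity U) m) (k : Fin N) : SumAbsLe (U k) m :=
  hm.mono' fun i => by
    rw [abs_of_nonneg (hU k i).1]
    exact le_totalDensity hU k i

omit H in
lemma sumAbsLe_jump {U : Fin N → ℤ → ℝ} {y : ℝ} (hy : SumAbsLe (totalJump U) y) (k : Fin N) :
    SumAbsLe (fun i => U k (i + 1) - U k i) y :=
  hy.mono' fun i => le_totalJump U k i

/-! ### One time step: range, mass, variation, increments. -/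

section Step

variable {U : Fin N → ℤ → ℝ} (hU : ∀ k i, U k i ∈ Icc (0 : ℝ) 1)
include hU

lemma interfaceVelocity_mem (k : Fin N) (i : ℤ) :
    interfaceVelocity P Δx Nη k (U k) i ∈ Icc 0 (V k) :=
  ⟨H.interfaceVelocity_nonneg k (hU k) i, H.interfaceVelocity_le k (hU k) i⟩

lemma numSource_bounds (k : Fin N) (i : ℤ) :
    -(2 * S * U k i) ≤ P.numSource Δx Nη U k i ∧ P.numSource Δx Nη U k i ≤ 2 * S * (1 - U k i) ∧
      |P.numSource Δx Nη U k i| ≤ 2 * S * totalDensity U i :=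
  H.R_bounds k _ (fun j => hU j i) fun j => H.cFull_mem (hU j) i

/-- Comparison with the constant states 0 and 1, which the update fixes because the flux vanishes
there. The gain `2ΔtS` in the middle variable pays for the source. -/
lemma march_mem (k : Fin N) (i : ℤ) : march P β lam Δx Nη U k i ∈ Icc (0 : ℝ) 1 := by
  have z : (0 : ℝ) ∈ Icc (0 : ℝ) 1 := by simp
  have o : (1 : ℝ) ∈ Icc (0 : ℝ) 1 := by simp
  obtain ⟨h1, h2, -⟩ := H.numSource_bounds hU k i
  have ht : 0 ≤ lam * Δx := mul_nonneg H.lam_pos.le H.Δx_pos.le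
  have h1' := mul_le_mul_of_nonneg_left h1 ht
  have h2' := mul_le_mul_of_nonneg_left h2 ht
  have lo := laxFriedrichs_mono (H.f_lip k) (H.F_nonneg k) H.lam_pos.le
    (H.interfaceVelocity_mem hU k (i - 1)) (H.interfaceVelocity_mem hU k i) (H.cfl_side k) (H.cfl k)
    z z z (hU k (i - 1)) (hU k i) (hU k (i + 1)) (hU k (i - 1)).1 (hU k i).1 (hU k (i + 1)).1
  have hi := laxFriedrichs_mono (H.f_lip k) (H.F_nonneg k) H.lam_pos.le
    (H.interfaceVelocity_mem hU k (i - 1)) (H.interfaceVelocity_mem hU k i) (H.cfl_side k) (H.cfl k)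
    (hU k (i - 1)) (hU k i) (hU k (i + 1)) o o o (hU k (i - 1)).2 (hU k i).2 (hU k (i + 1)).2
  have e0 : ∀ νl νr, laxFriedrichs (P.f k) β lam νl νr 0 0 0 = 0 := fun νl νr => by
    simp [laxFriedrichs, f_zero]
  have e1 : ∀ νl νr, laxFriedrichs (P.f k) β lam νl νr 1 1 1 = 1 := fun νl νr => by
    simp only [laxFriedrichs, H.f_one]; ring
  rw [e0] at lo
  rw [e1] at hi
  unfold march
  constructor <;> linarith

/-- The flux part distributes the density of a cell over itself and its two neighbours in
nonnegative shares adding up to that density; only the sources enlarge the bound. -/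
lemma march_mass {m : ℝ} (hm : SumAbsLe (totalDensity U) m) :
    SumAbsLe (totalDensity (march P β lam Δx Nη U)) (m + lam * Δx * (N * (2 * S * m))) := by
  have ht : 0 ≤ lam * Δx := mul_nonneg H.lam_pos.le H.Δx_pos.le
  have hl := H.lam_pos.le
  set iv := fun k i => interfaceVelocity P Δx Nη k (U k) i
  have hiv : ∀ k i, iv k i ∈ Icc 0 (V k) := fun k i => H.interfaceVelocity_mem hU k i
  have hmul : ∀ k i j, lam * iv k i * P.f k (U k j) ≤ β * U k j := fun k i j => calc
    lam * iv k i * P.f k (U k j) ≤ lam * V k * (F k * U k j) := by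
      have := (hiv k i).2
      have := H.f_le k (hU k j)
      have := H.f_nonneg k (hU k j)
      have := H.V_nonneg k
      gcongr
    _ = (lam * F k * V k) * U k j := by ring
    _ ≤ β * U k j := mul_le_mul_of_nonneg_right (H.cfl_side k) (hU k j).1
  have hpos : ∀ k i j, 0 ≤ lam * iv k i * P.f k (U k j) := fun k i j =>
    mul_nonneg (mul_nonneg hl (hiv k i).1) (H.f_nonneg k (hU k j))
  have hβ := H.β_pos
  refine SumAbsLe.of_three_point (m := totalDensity U)
    (A := fun j => ∑ k, (β / 2 * U k j - lam / 2 * iv k (j - 1) * P.f k (U k j)))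
    (B := fun j => ∑ k, ((1 - β) * U k j - lam / 2 * (iv k j - iv k (j - 1)) * P.f k (U k j)))
    (E := fun j => ∑ k, (β / 2 * U k j + lam / 2 * iv k j * P.f k (U k j)))
    (r := fun i => lam * Δx * ∑ k : Fin N, 2 * S * totalDensity U i)
    (fun i => ?_) (fun i => Finset.sum_nonneg fun k _ => ?_)
    (fun i => Finset.sum_nonneg fun k _ => ?_) (fun i => Finset.sum_nonneg fun k _ => ?_)
    (fun i => ?_) hm ?_
  · have hpos : 0 ≤ totalDensity (march P β lam Δx Nη U) i :=
      Finset.sum_nonneg fun k _ => (H.march_mem hU k i).1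
    rw [abs_of_nonneg hpos, Finset.mul_sum, ← Finset.sum_add_distrib, ← Finset.sum_add_distrib,
      ← Finset.sum_add_distrib]
    refine Finset.sum_le_sum fun k _ => ?_
    have h3 := mul_le_mul_of_nonneg_left
      ((le_abs_self _).trans (H.numSource_bounds hU k i).2.2) ht
    simp only [march, laxFriedrichs, add_sub_cancel_right, iv]
    linarith
  · linarith [hmul k (i - 1) i]
  · have h1 := hmul k i i
    have h2 := hpos k (i - 1) i
    have h3 : (β + lam * F k * V k) * U k i ≤ 1 * U k i := by
      refine mul_le_mul_of_nonneg_right ?_ (hU k i).1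
      have := mul_nonneg (mul_nonneg zero_le_two ht) H.S_nonneg
      linarith [H.cfl k]
    have h4 : lam * iv k i * P.f k (U k i) ≤ (lam * F k * V k) * U k i := calc
      _ ≤ lam * V k * (F k * U k i) := by
        have := (hiv k i).2
        have := H.f_le k (hU k i)
        have := H.f_nonneg k (hU k i)
        have := H.V_nonneg k
        gcongr
      _ = _ := by ring
    have h5 := mul_nonneg (mul_nonneg (mul_nonneg hl (H.F_nonneg k)) (H.V_nonneg k)) (hU k i).1
    linarith
  · have := hpos k i i
    have := mul_nonneg hβ.le (hU k i).1
    linarith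
  · rw [← Finset.sum_add_distrib, ← Finset.sum_add_distrib, totalDensity]
    refine (Finset.sum_congr rfl fun k _ => ?_).le
    ring
  · simp only [Finset.sum_const, Finset.card_univ, Fintype.card_fin, nsmul_eq_mul]
    have hS := H.S_nonneg
    exact (((hm.const_mul (c := 2 * S) (by positivity)).const_mul (c := N)
      (by positivity)).const_mul ht)

omit hU in
lemma abs_numSource_sub_le {U' : Fin N → ℤ → ℝ} (hU : ∀ k i, U k i ∈ Icc (0 : ℝ) 1)
    (hU' : ∀ k i, U' k i ∈ Icc (0 : ℝ) 1) (k : Fin N) (i : ℤ) :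
    |P.numSource Δx Nη U k i - P.numSource Δx Nη U' k i| ≤
      4 * S * ∑ j, (|U j i - U' j i| + |P.cFull Δx Nη (fun i => U j i - U' j i) i|) := by
  refine (H.R_sub_le k _ (fun j => hU j i) (fun j => H.cFull_mem (hU j) i)
    (fun j => hU' j i) fun j => H.cFull_mem (hU' j) i).trans_eq ?_
  simp only [cFull_sub]

lemma abs_cFull_sub_le (k : Fin N) (i : ℤ) :
    |P.cFull Δx Nη (U k) (i + 1) - P.cFull Δx Nη (U k) i| ≤ 2 * κ * Δx := by
  have h1 := H.abs_cHalf_sub_le (hU k) i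
  have h2 := H.abs_cHalf_sub_le (hU k) (i + 1)
  rw [abs_le] at h1 h2 ⊢
  unfold LaneModel.cFull
  constructor <;> linarith [h1.1, h1.2, h2.1, h2.2]

/-- First the densities change, at fixed position and averages, at the cost of `S`. Then position
and averages change together through the velocities, since `S` gives no control in `x`. -/
lemma abs_numSource_succ_sub_le (k : Fin N) (i : ℤ) :
    |P.numSource Δx Nη U k (i + 1) - P.numSource Δx Nη U k i| ≤
      4 * S * totalJump U i + 8 * Fm * ((D₁ + 2 * κ * D₂) * Δx) * totalDensity U i := by
  have h1 := H.R_sub_le k (((i + 1 : ℤ) : ℝ) * Δx) (fun j => hU j (i + 1))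
    (fun j => H.cFull_mem (hU j) (i + 1)) (fun j => hU j i) fun j => H.cFull_mem (hU j) (i + 1)
  have h2 := H.R_sub_le_of_velocity k (((i + 1 : ℤ) : ℝ) * Δx) ((i : ℝ) * Δx)
    (A := fun j => P.cFull Δx Nη (U j) (i + 1)) (A' := fun j => P.cFull Δx Nη (U j) i)
    (δ := (D₁ + 2 * κ * D₂) * Δx) (fun j => hU j i) fun j => by
      have m1 := H.cFull_mem (hU j) (i + 1)
      have m2 := H.cFull_mem (hU j) i
      have t1 := H.ν_x j (((i + 1 : ℤ) : ℝ) * Δx) ((i : ℝ) * Δx) _ m1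
      have t2 := H.ν_A j ((i : ℝ) * Δx) _ m1 _ m2
      have t3 := mul_le_mul_of_nonneg_left (H.abs_cFull_sub_le hU j i) H.D₂_nonneg
      rw [show ((i + 1 : ℤ) : ℝ) * Δx - (i : ℝ) * Δx = Δx by push_cast; ring,
        abs_of_pos H.Δx_pos] at t1
      refine (abs_sub_le _ _ _).trans (add_le_add t1 t2 |>.trans ?_)
      linarith
  simp only [sub_self, abs_zero, add_zero] at h1
  exact (abs_sub_le _ _ _).trans (add_le_add h1 h2)

omit H hU in
-- The left side is twice the larger of `|x|` and `|y|`. Applied with `x = β/2 D` and `y = λ/2 ν δ`,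
-- it bounds the shares of a jump passed to both neighbours by `β|D|`.
lemma abs_sub_add_abs_add_le {x y z : ℝ} (hx : |x| ≤ z) (hy : |y| ≤ z) :
    |x - y| + |x + y| ≤ 2 * z := by
  rw [abs_le] at hx hy
  rcases abs_cases (x - y) with h | h <;> rcases abs_cases (x + y) with h' | h' <;> linarith

/-- Jumps are redistributed over three interfaces with nonnegative shares of total `1 + O(Δt)`. What
remains is a second difference of velocities times a flux average, and a difference of sources. Both
are `O(Δt)` times `Δx m` and the variation, as Gronwall requires. -/
lemma march_jump {m y : ℝ} (hm : SumAbsLe (totalDensity U) m) (hy : SumAbsLe (totalJump U) y) :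
    SumAbsLe (totalJump (march P β lam Δx Nη U))
      ((1 + lam * Δx * (Fm * (D₁ + 2 * κ * D₂))) * y +
        N * (lam * (Fm * ((D₁₁ + 4 * κ * D₂₁ + 8 * κ ^ 2 * D₂₂) * Δx ^ 2) * m)
          + lam * (Fm * D₂ * (2 * κ * Δx * y))
          + lam * Δx * (4 * S * y + 8 * Fm * ((D₁ + 2 * κ * D₂) * Δx) * m))) := by
  have hl := H.lam_pos.le
  have hΔ := H.Δx_pos.le
  have ht : 0 ≤ lam * Δx := mul_nonneg hl hΔ
  have hFm := H.Fm_nonneg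
  have hS := H.S_nonneg
  have hκ := H.κ_nonneg
  have hD₁ := H.D₁_nonneg
  have hD₂ := H.D₂_nonneg
  have hD₁₁ := H.D₁₁_nonneg
  have hD₂₁ := H.D₂₁_nonneg
  have hD₂₂ := H.D₂₂_nonneg
  set LV := D₁ + 2 * κ * D₂ with hLV
  set K := D₁₁ + 4 * κ * D₂₁ + 8 * κ ^ 2 * D₂₂ with hK
  have hLV0 : 0 ≤ LV := by positivity
  have hK0 : 0 ≤ K := by positivity
  set iv := fun k i => interfaceVelocity P Δx Nη k (U k) i with hiv_def
  have hiv : ∀ k i, iv k i ∈ Icc 0 (V k) := fun k i => H.interfaceVelocity_mem hU k i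
  set D := fun k i => U k (i + 1) - U k i with hD
  set δ := fun k i => P.f k (U k (i + 1)) - P.f k (U k i) with hδ
  have hδF : ∀ k i, |δ k i| ≤ F k * |D k i| := fun k i => H.f_lip k _ (hU k _) _ (hU k _)
  set e := fun k i => 1 / 2 * (P.f k (U k i) + P.f k (U k (i + 1))) with he
  have he0 : ∀ k i, 0 ≤ e k i := fun k i => by
    have := H.f_nonneg k (hU k i)
    have := H.f_nonneg k (hU k (i + 1))
    simp only [he]; positivity
  have hfFm : ∀ k i, P.f k (U k i) ≤ Fm * U k i := fun k i =>
    (H.f_le k (hU k i)).trans (mul_le_mul_of_nonneg_right (H.F_le k) (hU k i).1)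
  have heu : ∀ k i, e k i ≤ Fm * (1 / 2 * (U k i + U k (i + 1))) := fun k i => by
    have := hfFm k i
    have := hfFm k (i + 1)
    simp only [he]; linarith
  have heF : ∀ k i, e k i ≤ Fm := fun k i => by
    refine (heu k i).trans (mul_le_of_le_one_right hFm ?_)
    linarith [(hU k i).2, (hU k (i + 1)).2]
  set c2 := fun k i => P.cHalf Δx Nη (D k) i - P.cHalf Δx Nη (D k) (i - 1) with hc2
  have hsec : ∀ k i, |iv k (i + 1) - 2 * iv k i + iv k (i - 1)| ≤ K * Δx ^ 2 + D₂ * |c2 k i| := by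
    intro k i
    have := H.abs_interfaceVelocity_second_difference_le k (hU k) i
    have e1 : P.cHalf Δx Nη (U k) (i + 1) - P.cHalf Δx Nη (U k) i = P.cHalf Δx Nη (D k) i := by
      rw [cHalf_succ, cHalf_sub]
    have e2 : P.cHalf Δx Nη (U k) i - P.cHalf Δx Nη (U k) (i - 1) =
        P.cHalf Δx Nη (D k) (i - 1) := by
      have := cHalf_succ (P := P) (Δx := Δx) (Nη := Nη) (U k) (i - 1)
      rw [sub_add_cancel] at this
      rw [this, cHalf_sub]
    rw [e1, e2] at this
    exact this
  set r := fun k i => lam * (Fm * (K * Δx ^ 2) * (1 / 2 * (U k i + U k (i + 1))))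
    + lam * (Fm * D₂ * |c2 k i|)
    + lam * Δx * (4 * S * totalJump U i + 8 * Fm * (LV * Δx) * totalDensity U i) with hr
  have hlane : ∀ k, SumAbsLe (r k) (lam * (Fm * (K * Δx ^ 2) * m)
      + lam * (Fm * D₂ * (2 * κ * Δx * y))
      + lam * Δx * (4 * S * y + 8 * Fm * (LV * Δx) * m)) := fun k => by
    have u := sumAbsLe_lane hU hm k
    have u' := (u.add (u.shift 1)).const_mul (c := 1 / 2) (by norm_num)
    have u'' : SumAbsLe (fun i => 1 / 2 * (U k i + U k (i + 1))) m := u'.of_le (by linarith)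
    have c' : SumAbsLe (fun i => |c2 k i|) (2 * κ * Δx * y) :=
      (H.sumAbsLe_cHalf_sub (sumAbsLe_jump hy k)).mono fun i => by rw [abs_abs]
    exact (((u''.const_mul (c := Fm * (K * Δx ^ 2)) (by positivity)).const_mul hl).add
      ((c'.const_mul (c := Fm * D₂) (by positivity)).const_mul hl)).add
      (((hy.const_mul (c := 4 * S) (by positivity)).add
        (hm.const_mul (c := 8 * Fm * (LV * Δx)) (by positivity))).const_mul ht)
  have hrsum := SumAbsLe.sum (t := Finset.univ) fun k _ => hlane k
  simp only [Finset.sum_const, Finset.card_univ, Fintype.card_fin, nsmul_eq_mul] at hrsum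
  have hlν : ∀ k i, |lam * iv k i * δ k i| ≤ β * |D k i| := fun k i => by
    rw [abs_mul, abs_mul, abs_of_nonneg hl, abs_of_nonneg (hiv k i).1]
    calc
      lam * iv k i * |δ k i| ≤ lam * V k * (F k * |D k i|) := by
        have := (hiv k i).2
        have := hδF k i
        have := H.V_nonneg k
        gcongr
      _ = (lam * F k * V k) * |D k i| := by ring
      _ ≤ β * |D k i| := mul_le_mul_of_nonneg_right (H.cfl_side k) (abs_nonneg _)
  have hβ := H.β_pos
  -- The CFL condition of any lane forces `β ≤ 1`; without lanes nothing is to be shown.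
  have hβ1 : β ≤ 1 ∨ IsEmpty (Fin N) := by
    rcases isEmpty_or_nonempty (Fin N) with h | ⟨⟨k⟩⟩
    · exact Or.inr h
    · left
      have := H.cfl k
      have := mul_nonneg (mul_nonneg hl (H.F_nonneg k)) (H.V_nonneg k)
      have := mul_nonneg (mul_nonneg zero_le_two ht) hS
      linarith
  have hβ1' : ∀ k : Fin N, 0 ≤ 1 - β := fun k => by
    rcases hβ1 with h | h
    · linarith
    · exact h.elim k
  refine SumAbsLe.of_three_point
    (m := fun i => (1 + lam * Δx * (Fm * LV)) * totalJump U i)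
    (A := fun j => ∑ k, |β / 2 * D k j - lam / 2 * iv k j * δ k j|)
    (B := fun j => ∑ k, ((1 - β) * |D k j| + lam * Δx * (Fm * LV) * |D k j|))
    (E := fun j => ∑ k, |β / 2 * D k j + lam / 2 * iv k j * δ k j|)
    (r := fun i => ∑ k, r k i)
    (fun i => ?_) (fun i => by positivity) (fun i => Finset.sum_nonneg fun k _ => ?_)
    (fun i => by positivity) (fun i => ?_) (hy.const_mul (by positivity)) hrsum
  · rw [abs_of_nonneg (Finset.sum_nonneg fun k _ => abs_nonneg _), totalJump,
      ← Finset.sum_add_distrib, ← Finset.sum_add_distrib, ← Finset.sum_add_distrib]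
    refine Finset.sum_le_sum fun k _ => ?_
    -- The outer velocities go with the outer jumps and their difference with the middle jump; the
    -- average `e` then multiplies exactly the second difference of the velocities.
    have split : march P β lam Δx Nη U k (i + 1) - march P β lam Δx Nη U k i =
        (β / 2 * D k (i + 1) - lam / 2 * iv k (i + 1) * δ k (i + 1))
        + ((1 - β) * D k i + -(lam / 2 * ((iv k (i + 1) - iv k (i - 1)) * δ k i)))
        + (β / 2 * D k (i - 1) + lam / 2 * iv k (i - 1) * δ k (i - 1))
        + (-(lam * (e k i * (iv k (i + 1) - 2 * iv k i + iv k (i - 1))))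
          + lam * Δx * (P.numSource Δx Nη U k (i + 1) - P.numSource Δx Nη U k i)) := by
      simp only [march, laxFriedrichs, hD, hδ, he, hiv_def, add_sub_cancel_right, sub_add_cancel]
      ring
    rw [split]
    have b1 : |lam / 2 * ((iv k (i + 1) - iv k (i - 1)) * δ k i)| ≤
        lam * Δx * (Fm * LV) * |D k i| := by
      have s1 := H.abs_interfaceVelocity_sub_le k (hU k) i
      have s2 := H.abs_interfaceVelocity_sub_le k (hU k) (i + 1)
      rw [add_sub_cancel_right] at s2
      have s3 : |iv k (i + 1) - iv k (i - 1)| ≤ 2 * (LV * Δx) :=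
        (abs_sub_le _ (iv k i) _).trans (by linarith)
      rw [abs_mul, abs_mul, abs_of_nonneg (by positivity : 0 ≤ lam / 2)]
      calc
        _ ≤ lam / 2 * (2 * (LV * Δx) * (Fm * |D k i|)) := by
          have := (hδF k i).trans (mul_le_mul_of_nonneg_right (H.F_le k) (abs_nonneg _))
          gcongr
        _ = _ := by ring
    have b2 : |lam * (e k i * (iv k (i + 1) - 2 * iv k i + iv k (i - 1)))| ≤
        lam * (Fm * (K * Δx ^ 2) * (1 / 2 * (U k i + U k (i + 1))))
          + lam * (Fm * D₂ * |c2 k i|) := by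
      rw [abs_mul, abs_mul, abs_of_nonneg hl, abs_of_nonneg (he0 k i)]
      have g1 : e k i * (K * Δx ^ 2) ≤ Fm * (1 / 2 * (U k i + U k (i + 1))) * (K * Δx ^ 2) :=
        mul_le_mul_of_nonneg_right (heu k i) (by positivity)
      have g2 : e k i * (D₂ * |c2 k i|) ≤ Fm * (D₂ * |c2 k i|) :=
        mul_le_mul_of_nonneg_right (heF k i) (by positivity)
      have g3 := mul_le_mul_of_nonneg_left (hsec k i) (he0 k i)
      calc
        _ ≤ lam * (Fm * (1 / 2 * (U k i + U k (i + 1))) * (K * Δx ^ 2)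
            + Fm * (D₂ * |c2 k i|)) := by
          gcongr
          linarith
        _ = _ := by ring
    have b3 : |lam * Δx * (P.numSource Δx Nη U k (i + 1) - P.numSource Δx Nη U k i)| ≤
        lam * Δx * (4 * S * totalJump U i + 8 * Fm * (LV * Δx) * totalDensity U i) := by
      rw [abs_mul, abs_of_nonneg ht]
      exact mul_le_mul_of_nonneg_left (H.abs_numSource_succ_sub_le hU k i) ht
    have b4 : |(1 - β) * D k i + -(lam / 2 * ((iv k (i + 1) - iv k (i - 1)) * δ k i))| ≤
        (1 - β) * |D k i| + lam * Δx * (Fm * LV) * |D k i| := by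
      refine (abs_add_le _ _).trans (add_le_add ?_ ?_)
      · rw [abs_mul, abs_of_nonneg (hβ1' k)]
      · rw [abs_neg]; exact b1
    have b5 : |-(lam * (e k i * (iv k (i + 1) - 2 * iv k i + iv k (i - 1))))
          + lam * Δx * (P.numSource Δx Nη U k (i + 1) - P.numSource Δx Nη U k i)| ≤ r k i := by
      refine (abs_add_le _ _).trans ?_
      rw [abs_neg]
      exact add_le_add b2 b3
    refine (abs_add_le _ _).trans (add_le_add ((abs_add_three _ _ _).trans ?_) b5)
    gcongr
  · have := hβ1' k
    positivity
  · rw [totalJump, Finset.mul_sum, ← Finset.sum_add_distrib, ← Finset.sum_add_distrib]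
    refine Finset.sum_le_sum fun k _ => ?_
    have g := abs_sub_add_abs_add_le (x := β / 2 * D k i) (y := lam / 2 * iv k i * δ k i)
      (z := β / 2 * |D k i|) (by rw [abs_mul, abs_of_pos (by positivity : 0 < β / 2)]) (by
        rw [show lam / 2 * iv k i * δ k i = (1 / 2) * (lam * iv k i * δ k i) by ring, abs_mul]
        rw [abs_of_pos (by norm_num : (0 : ℝ) < 1 / 2)]
        linarith [hlν k i])
    simp only [hD] at g ⊢
    linarith

/-- With the velocity frozen at the right interface, CFL bounds flux jumps by density jumps. The
change of velocity and the source contribute `Δt` times densities. The result is `O(1)` in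
unweighted `ℓ¹`, that is `O(Δx)` in `L¹`. -/
lemma march_sub {m y : ℝ} (hm : SumAbsLe (totalDensity U) m) (hy : SumAbsLe (totalJump U) y) :
    SumAbsLe (fun i => ∑ k, |march P β lam Δx Nη U k i - U k i|)
      (N * (2 * β * y + lam * Δx * (Fm * (D₁ + 2 * κ * D₂) + 2 * S) * m)) := by
  have hl := H.lam_pos.le
  have hΔ := H.Δx_pos.le
  have ht : 0 ≤ lam * Δx := mul_nonneg hl hΔ
  have hFm := H.Fm_nonneg
  have hS := H.S_nonneg
  have hβ := H.β_pos
  have hLV0 : 0 ≤ D₁ + 2 * κ * D₂ :=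
    add_nonneg H.D₁_nonneg (mul_nonneg (mul_nonneg zero_le_two H.κ_nonneg) H.D₂_nonneg)
  set LV := D₁ + 2 * κ * D₂
  set iv := fun k i => interfaceVelocity P Δx Nη k (U k) i with hiv_def
  have hiv : ∀ k i, iv k i ∈ Icc 0 (V k) := fun k i => H.interfaceVelocity_mem hU k i
  have hlane : ∀ k ∈ (Finset.univ : Finset (Fin N)),
      SumAbsLe (fun i => |march P β lam Δx Nη U k i - U k i|)
      (2 * β * y + lam * Δx * (Fm * LV + 2 * S) * m) := fun k _ => by
    have u := sumAbsLe_lane hU hm k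
    have d : SumAbsLe (fun i => |U k (i + 1) - U k i|) y :=
      (sumAbsLe_jump hy k).mono fun i => by rw [abs_abs]
    have b1 := (d.add (d.shift (-1))).const_mul hβ.le
    have b2 := ((u.shift (-1)).add u).const_mul (c := lam * Δx * (Fm * LV) * (1 / 2))
      (by positivity)
    have b3 := hm.const_mul (c := lam * Δx * (2 * S)) (by positivity)
    refine (((b1.add b2).add b3).of_le (by linarith)).mono' fun i => ?_
    rw [abs_abs]
    have sb : (i : ℤ) + -1 = i - 1 := rfl
    simp only [sb, sub_add_cancel]
    have s1 := H.abs_interfaceVelocity_sub_le k (hU k) i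
    have split : march P β lam Δx Nη U k i - U k i =
        -(lam / 2 * iv k i * (P.f k (U k (i + 1)) - P.f k (U k i)))
        + -(lam / 2 * iv k i * (P.f k (U k i) - P.f k (U k (i - 1))))
        + β / 2 * (U k (i + 1) - U k i) + -(β / 2 * (U k i - U k (i - 1)))
        + -(lam / 2 * (iv k i - iv k (i - 1)) * (P.f k (U k (i - 1)) + P.f k (U k i)))
        + lam * Δx * P.numSource Δx Nη U k i := by
      simp only [march, laxFriedrichs, hiv_def]
      ring
    have hf : ∀ a ∈ Icc (0 : ℝ) 1, ∀ b ∈ Icc (0 : ℝ) 1,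
        |-(lam / 2 * iv k i * (P.f k a - P.f k b))| ≤ β / 2 * |a - b| := fun a ha b hb => by
      rw [abs_neg, abs_mul, abs_of_nonneg (mul_nonneg (by positivity) (hiv k i).1)]
      calc
        _ ≤ lam / 2 * V k * (F k * |a - b|) := by
          have := (hiv k i).2
          have := H.f_lip k a ha b hb
          have := H.V_nonneg k
          gcongr
        _ = (lam * F k * V k) / 2 * |a - b| := by ring
        _ ≤ β / 2 * |a - b| := by
          have := H.cfl_side k
          gcongr
    have c1 := hf _ (hU k (i + 1)) _ (hU k i)
    have c2 := hf _ (hU k i) _ (hU k (i - 1))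
    have c3 : |β / 2 * (U k (i + 1) - U k i)| ≤ β / 2 * |U k (i + 1) - U k i| := by
      rw [abs_mul, abs_of_pos (by positivity : 0 < β / 2)]
    have c4 : |-(β / 2 * (U k i - U k (i - 1)))| ≤ β / 2 * |U k i - U k (i - 1)| := by
      rw [abs_neg, abs_mul, abs_of_pos (by positivity : 0 < β / 2)]
    have c5 : |-(lam / 2 * (iv k i - iv k (i - 1)) * (P.f k (U k (i - 1)) + P.f k (U k i)))| ≤
        lam * Δx * (Fm * LV) * (1 / 2) * (U k (i - 1) + U k i) := by
      have p1 := H.f_nonneg k (hU k (i - 1))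
      have p2 := H.f_nonneg k (hU k i)
      have q1 := (H.f_le k (hU k (i - 1))).trans
        (mul_le_mul_of_nonneg_right (H.F_le k) (hU k (i - 1)).1)
      have q2 := (H.f_le k (hU k i)).trans (mul_le_mul_of_nonneg_right (H.F_le k) (hU k i).1)
      rw [abs_neg, abs_mul, abs_mul, abs_of_nonneg (by positivity : 0 ≤ lam / 2),
        abs_of_nonneg (add_nonneg p1 p2)]
      calc
        _ ≤ lam / 2 * (LV * Δx) * (Fm * U k (i - 1) + Fm * U k i) := by gcongr
        _ = _ := by ring
    have c6 : |lam * Δx * P.numSource Δx Nη U k i| ≤ lam * Δx * (2 * S) * totalDensity U i := by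
      rw [abs_mul, abs_of_nonneg ht, mul_assoc (lam * Δx)]
      exact mul_le_mul_of_nonneg_left (H.numSource_bounds hU k i).2.2 ht
    rw [split]
    refine (abs_add_le _ _).trans (add_le_add ((abs_add_le _ _).trans (add_le_add ?_ c5)) c6)
    refine (abs_add_le _ _).trans ((add_le_add (abs_add_three _ _ _) le_rfl).trans ?_)
    linarith
  have := SumAbsLe.sum hlane
  simpa only [Finset.sum_const, Finset.card_univ, Fintype.card_fin, nsmul_eq_mul] using this

end Step

end Regime

/-! ### Cell averages of the initial data. -/

section InitialData

lemma measurableSet_cell (Δx : ℝ) (i : ℤ) : MeasurableSet (cell Δx i) := measurableSet_Ico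

lemma pairwise_disjoint_cell {Δx : ℝ} (hΔ : 0 < Δx) :
    Pairwise (Function.onFun Disjoint (cell Δx)) := fun i j hij => by
  refine Set.disjoint_left.2 fun x hi hj => hij ?_
  rw [← (mem_cell_iff hΔ).1 hi, (mem_cell_iff hΔ).1 hj]

lemma iUnion_cell {Δx : ℝ} (hΔ : 0 < Δx) : ⋃ i, cell Δx i = univ :=
  eq_univ_of_forall fun _ => mem_iUnion.2 ⟨_, (mem_cell_iff hΔ).2 rfl⟩

lemma cell_le (Δx : ℝ) (hΔ : 0 < Δx) (i : ℤ) :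
    ((i : ℝ) - 1 / 2) * Δx ≤ ((i : ℝ) + 1 / 2) * Δx := by gcongr; linarith

lemma volume_real_cell {Δx : ℝ} (hΔ : 0 < Δx) (i : ℤ) : volume.real (cell Δx i) = Δx := by
  rw [cell, Real.volume_real_Ico_of_le (cell_le Δx hΔ i)]
  ring

lemma setIntegral_cell {Δx : ℝ} (hΔ : 0 < Δx) (w : ℝ → ℝ) (i : ℤ) :
    ∫ x in cell Δx i, w x = ∫ x in (((i : ℝ) - 1 / 2) * Δx)..(((i : ℝ) + 1 / 2) * Δx), w x := by
  rw [cell, integral_Ico_eq_integral_Ioc, intervalIntegral.integral_of_le (cell_le Δx hΔ i)]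

lemma cellAverage_mem {Δx : ℝ} (hΔ : 0 < Δx) {w : ℝ → ℝ} (hw : Integrable w)
    (hw' : ∀ᵐ x, w x ∈ Icc (0 : ℝ) 1) (i : ℤ) :
    LaneModel.cellAverage Δx w i ∈ Icc (0 : ℝ) 1 := by
  have h0 : 0 ≤ ∫ x in cell Δx i, w x :=
    setIntegral_nonneg_of_ae (hw'.mono fun x hx => hx.1)
  have h1 : ∫ x in cell Δx i, w x ≤ Δx := by
    calc
      _ ≤ ∫ x in cell Δx i, (1 : ℝ) := by
        refine setIntegral_mono_ae hw.integrableOn ?_ (hw'.mono fun x hx => hx.2)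
        exact integrableOn_const (by simp [cell])
      _ = Δx := by rw [setIntegral_const, volume_real_cell hΔ, smul_eq_mul, mul_one]
  change 1 / Δx * ∫ x in cell Δx i, w x ∈ _
  refine ⟨by positivity, ?_⟩
  rw [one_div, inv_mul_le_iff₀ hΔ]
  linarith

lemma sumAbsLe_cellAverage {Δx : ℝ} (hΔ : 0 < Δx) {w : ℝ → ℝ} (hw : Integrable w) :
    SumAbsLe (LaneModel.cellAverage Δx w) ((∫ x, |w x|) / Δx) := fun s => by
  have h1 : ∀ i, |LaneModel.cellAverage Δx w i| ≤ 1 / Δx * ∫ x in cell Δx i, |w x| := fun i => by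
    change |1 / Δx * ∫ x in cell Δx i, w x| ≤ _
    rw [abs_mul, abs_of_pos (by positivity : 0 < 1 / Δx)]
    gcongr
    exact abs_integral_le_integral_abs
  refine (Finset.sum_le_sum fun i _ => h1 i).trans ?_
  rw [← Finset.mul_sum, ← integral_biUnion_finset s (fun i _ => measurableSet_cell Δx i)
    (fun i _ j _ hij => pairwise_disjoint_cell hΔ hij) (fun i _ => hw.abs.integrableOn),
    one_div, div_eq_inv_mul]
  refine mul_le_mul_of_nonneg_left ?_ (by positivity)
  exact setIntegral_le_integral hw.abs (ae_of_all _ fun x => abs_nonneg _)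

lemma cellAverage_congr {Δx : ℝ} {w v : ℝ → ℝ} (h : w =ᵐ[volume] v) :
    LaneModel.cellAverage Δx w = LaneModel.cellAverage Δx v := by
  ext i
  rw [LaneModel.cellAverage, LaneModel.cellAverage, integral_congr_ae (ae_restrict_of_ae h)]

/-- Sums of differences along an increasing sequence of points are bounded by the variation. -/
lemma sum_abs_sub_le_of_variation {w : ℝ → ℝ} {C : ℝ}
    (hC : eVariationOn w univ ≤ ENNReal.ofReal C) (hC0 : 0 ≤ C) {u : ℤ → ℝ} (hu : Monotone u) :
    SumAbsLe (fun i => w (u (i + 1)) - w (u i)) C := fun s => by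
  obtain ⟨m, hm⟩ : ∃ m : ℕ, s ⊆ (Finset.range (2 * m)).image fun j : ℕ => (j : ℤ) - m := by
    refine ⟨s.sup Int.natAbs + 1, fun i hi => ?_⟩
    have hle := Finset.le_sup (f := Int.natAbs) hi
    simp only [Finset.mem_image, Finset.mem_range]
    exact ⟨(i + (s.sup Int.natAbs + 1 : ℕ)).toNat, by omega, by omega⟩
  have hinj : Set.InjOn (fun j : ℕ => (j : ℤ) - m) (Finset.range (2 * m)) := fun a _ b _ hab => by
    simp only at hab; omega
  calc
    _ ≤ ∑ i ∈ (Finset.range (2 * m)).image fun j : ℕ => (j : ℤ) - m,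
        |w (u (i + 1)) - w (u i)| :=
      Finset.sum_le_sum_of_subset_of_nonneg hm fun _ _ _ => abs_nonneg _
    _ = ∑ j ∈ Finset.range (2 * m), |w (u ((j : ℤ) - m + 1)) - w (u ((j : ℤ) - m))| :=
      Finset.sum_image hinj
    _ ≤ C := by
      rw [← ENNReal.ofReal_le_ofReal_iff hC0,
        ENNReal.ofReal_sum_of_nonneg fun _ _ => abs_nonneg _]
      refine le_trans (le_of_eq (Finset.sum_congr rfl fun j _ => ?_))
        ((eVariationOn.sum_le (f := w) (s := univ) (u := fun j : ℕ => u ((j : ℤ) - m))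
          (n := 2 * m) (fun a b hab => hu (by simpa using hab)) fun _ => mem_univ _).trans hC)
      rw [edist_dist, Real.dist_eq]
      push_cast
      rw [show (j : ℤ) + 1 - m = j - m + 1 by ring]

lemma cellAverage_eq_shift {Δx : ℝ} (hΔ : 0 < Δx) (w : ℝ → ℝ) (i : ℤ) :
    LaneModel.cellAverage Δx w i = 1 / Δx * ∫ x in cell Δx 0, w (x + i * Δx) := by
  change 1 / Δx * ∫ x in cell Δx i, w x = _
  rw [setIntegral_cell hΔ, setIntegral_cell hΔ, intervalIntegral.integral_comp_add_right]
  congr 2 <;> push_cast <;> ring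

/-- All cells are translated to the cell at the origin. For each base point the sampled differences
are bounded by the variation, and this bound is averaged over the cell. -/
lemma sumAbsLe_cellAverage_sub_of_variation {Δx : ℝ} (hΔ : 0 < Δx) {w : ℝ → ℝ}
    (hw : Integrable w) {C : ℝ} (hC : eVariationOn w univ ≤ ENNReal.ofReal C) (hC0 : 0 ≤ C) :
    SumAbsLe (fun i => LaneModel.cellAverage Δx w (i + 1) - LaneModel.cellAverage Δx w i) C :=
  fun s => by
  have hi : ∀ i : ℤ, Integrable fun x => w (x + i * Δx) := fun i => hw.comp_add_right _
  have hd : ∀ i : ℤ, Integrable fun x => |w (x + (i + 1 : ℤ) * Δx) - w (x + i * Δx)| := fun i =>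
    ((hi (i + 1)).sub (hi i)).abs
  have h1 : ∀ i, |LaneModel.cellAverage Δx w (i + 1) - LaneModel.cellAverage Δx w i| ≤
      1 / Δx * ∫ x in cell Δx 0, |w (x + (i + 1 : ℤ) * Δx) - w (x + i * Δx)| := fun i => by
    rw [cellAverage_eq_shift hΔ, cellAverage_eq_shift hΔ, ← mul_sub,
      ← integral_sub (hi _).integrableOn (hi _).integrableOn, abs_mul,
      abs_of_pos (by positivity : 0 < 1 / Δx)]
    gcongr
    exact abs_integral_le_integral_abs
  refine (Finset.sum_le_sum fun i _ => h1 i).trans ?_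
  rw [← Finset.mul_sum, ← integral_finsetSum _ fun i _ => (hd i).integrableOn]
  calc
    _ ≤ 1 / Δx * ∫ x in cell Δx 0, C := by
      gcongr 1 / Δx * ?_
      refine setIntegral_mono (integrable_finsetSum _ fun i _ => (hd i)).integrableOn
        (integrableOn_const (by simp [cell])) fun x => ?_
      refine sum_abs_sub_le_of_variation hC hC0 (u := fun i : ℤ => x + i * Δx) (fun a b hab => ?_) s
      simp only
      gcongr
    _ = C := by
      rw [setIntegral_const, volume_real_cell hΔ, smul_eq_mul]
      field_simp

/-- The seminorm is an infimum over representatives, so one of variation below `C + 1` is selected;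
cell averages do not see the change. -/
lemma sumAbsLe_cellAverage_sub {Δx : ℝ} (hΔ : 0 < Δx) {w : ℝ → ℝ} (hw : Integrable w) {C : ℝ}
    (hC : essVariation w ≤ ENNReal.ofReal C) (hC0 : 0 ≤ C) :
    SumAbsLe (fun i => LaneModel.cellAverage Δx w (i + 1) - LaneModel.cellAverage Δx w i)
      (C + 1) := by
  have hlt : essVariation w < ENNReal.ofReal (C + 1) :=
    hC.trans_lt ((ENNReal.ofReal_lt_ofReal_iff (by linarith)).2 (by linarith))
  rw [essVariation] at hlt
  simp only [iInf_lt_iff] at hlt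
  obtain ⟨v, hv, hvC⟩ := hlt
  rw [← cellAverage_congr hv]
  exact sumAbsLe_cellAverage_sub_of_variation hΔ (hw.congr hv.symm) hvC.le (by linarith)

end InitialData

/-! ### Uniform bounds up to time `T`. -/

namespace Regime

variable {N : ℕ} {P : LaneModel N} {β lam Δx : ℝ} {Nη : ℕ} {F V : Fin N → ℝ}
  {Fm D₁ D₂ D₁₁ D₂₁ D₂₂ κ S : ℝ}
  (H : Regime P β lam Δx Nη F V Fm D₁ D₂ D₁₁ D₂₁ D₂₂ κ S)
include H

omit H in
lemma one_add_mul_pow_le {c t T : ℝ} {n : ℕ} (hc : 0 ≤ c) (ht : 0 ≤ t) (hn : n * t ≤ T) :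
    (1 + t * c) ^ n ≤ Real.exp (c * T) := by
  calc
    (1 + t * c) ^ n ≤ Real.exp (t * c) ^ n := by
      gcongr
      linarith [Real.add_one_le_exp (t * c)]
    _ = Real.exp (c * (n * t)) := by rw [← Real.exp_nat_mul]; ring_nf
    _ ≤ _ := by gcongr

variable {u₀ : Fin N → ℝ → ℝ}
  (h₀ : ∀ k, Integrable (u₀ k) ∧ ∀ᵐ x, u₀ k x ∈ Set.Icc (0 : ℝ) 1)
include h₀

lemma scheme_mem (n : ℕ) (k : Fin N) (i : ℤ) :
    P.scheme β Δx (lam * Δx) Nη u₀ n k i ∈ Icc (0 : ℝ) 1 := by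
  induction n generalizing k i with
  | zero => exact cellAverage_mem H.Δx_pos (h₀ k).1 (h₀ k).2 i
  | succ n ih =>
    rw [scheme_succ P β H.lam_pos.ne' H.Δx_pos.ne']
    exact H.march_mem ih k i

lemma scheme_mass {T m : ℝ} (hm : ∑ k, ∫ x, |u₀ k x| ≤ m) (hm0 : 0 ≤ m) {n : ℕ}
    (hn : n * (lam * Δx) ≤ T) :
    SumAbsLe (totalDensity (P.scheme β Δx (lam * Δx) Nη u₀ n))
      (Real.exp (2 * N * S * T) * m / Δx) := by
  have hΔ := H.Δx_pos
  have ht : 0 ≤ lam * Δx := mul_nonneg H.lam_pos.le hΔ.le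
  have hS := H.S_nonneg
  have main : ∀ n : ℕ, SumAbsLe (totalDensity (P.scheme β Δx (lam * Δx) Nη u₀ n))
      ((1 + lam * Δx * (2 * N * S)) ^ n * (m / Δx)) := fun n => by
    induction n with
    | zero =>
      have := SumAbsLe.sum (t := Finset.univ) fun k _ =>
        sumAbsLe_cellAverage (w := u₀ k) hΔ (h₀ k).1
      rw [← Finset.sum_div] at this
      rw [pow_zero, one_mul]
      exact this.of_le (by gcongr)
    | succ n ih =>
      rw [scheme_succ P β H.lam_pos.ne' H.Δx_pos.ne']
      refine (H.march_mass (H.scheme_mem h₀ n) ih).of_le (le_of_eq ?_)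
      ring
  refine (main n).of_le ?_
  rw [mul_div_assoc]
  gcongr
  exact one_add_mul_pow_le (by positivity) ht hn

/-- Per unit of time, `a` collects the coefficients of the variation and `b` those of the mass. The
mass bound `μ / Δx` absorbs one power of `Δx`, so `march_jump` becomes `Y ↦ (1 + Δt a) Y + Δt b`. -/
lemma scheme_jump {T μ y a b : ℝ}
    (ha : a = Fm * (D₁ + 2 * κ * D₂) + N * (2 * κ * Fm * D₂ + 4 * S))
    (hb : b = N * Fm * ((D₁₁ + 4 * κ * D₂₁ + 8 * κ ^ 2 * D₂₂) + 8 * (D₁ + 2 * κ * D₂)) * μ)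
    (hμ0 : 0 ≤ μ)
    (hμ : ∀ n : ℕ, n * (lam * Δx) ≤ T →
      SumAbsLe (totalDensity (P.scheme β Δx (lam * Δx) Nη u₀ n)) (μ / Δx))
    (hy : ∀ k, essVariation (u₀ k) ≤ ENNReal.ofReal y) (hy0 : 0 ≤ y) {n : ℕ}
    (hn : n * (lam * Δx) ≤ T) :
    SumAbsLe (totalJump (P.scheme β Δx (lam * Δx) Nη u₀ n))
      (Real.exp (a * T) * (N * (y + 1) + b * T)) := by
  have hΔ := H.Δx_pos
  have ht : 0 ≤ lam * Δx := mul_nonneg H.lam_pos.le hΔ.le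
  have hS := H.S_nonneg
  have hFm := H.Fm_nonneg
  have hκ := H.κ_nonneg
  have hD₁ := H.D₁_nonneg
  have hD₂ := H.D₂_nonneg
  have hD₁₁ := H.D₁₁_nonneg
  have hD₂₁ := H.D₂₁_nonneg
  have hD₂₂ := H.D₂₂_nonneg
  have ha0 : 0 ≤ a := by rw [ha]; positivity
  have hb0 : 0 ≤ b := by rw [hb]; positivity
  have main : ∀ n : ℕ, n * (lam * Δx) ≤ T →
      SumAbsLe (totalJump (P.scheme β Δx (lam * Δx) Nη u₀ n))
      ((1 + lam * Δx * a) ^ n * (N * (y + 1) + b * (n * (lam * Δx)))) := fun n => by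
    induction n with
    | zero =>
      intro _
      have : ∀ k ∈ (Finset.univ : Finset (Fin N)), SumAbsLe (fun i =>
          |LaneModel.cellAverage Δx (u₀ k) (i + 1) - LaneModel.cellAverage Δx (u₀ k) i|)
          (y + 1) := fun k _ =>
        (sumAbsLe_cellAverage_sub hΔ (h₀ k).1 (hy k) hy0).mono fun i => by rw [abs_abs]
      have := SumAbsLe.sum this
      simp only [Finset.sum_const, Finset.card_univ, Fintype.card_fin, nsmul_eq_mul] at this
      exact this.of_le (by simp)
    | succ n ih =>
      intro hn
      push_cast at hn
      have hn' : n * (lam * Δx) ≤ T := by linarith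
      rw [scheme_succ P β H.lam_pos.ne' H.Δx_pos.ne']
      refine (H.march_jump (H.scheme_mem h₀ n) (hμ n hn') (ih hn')).of_le ?_
      set Y := (1 + lam * Δx * a) ^ n * (N * (y + 1) + b * (n * (lam * Δx))) with hY
      have e : (1 + lam * Δx * (Fm * (D₁ + 2 * κ * D₂))) * Y +
        N * (lam * (Fm * ((D₁₁ + 4 * κ * D₂₁ + 8 * κ ^ 2 * D₂₂) * Δx ^ 2) * (μ / Δx))
          + lam * (Fm * D₂ * (2 * κ * Δx * Y))
          + lam * Δx * (4 * S * Y + 8 * Fm * ((D₁ + 2 * κ * D₂) * Δx) * (μ / Δx))) =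
        (1 + lam * Δx * a) * Y + b * (lam * Δx) := by
        rw [ha, hb]
        field_simp
        ring
      rw [e]
      -- Enlarging the forcing by this power keeps the induction hypothesis in closed form.
      have h1 : 1 ≤ (1 + lam * Δx * a) ^ (n + 1) :=
        one_le_pow₀ (by linarith [mul_nonneg ht ha0])
      have h2 : b * (lam * Δx) ≤ (1 + lam * Δx * a) ^ (n + 1) * (b * (lam * Δx)) :=
        le_mul_of_one_le_left (by positivity) h1
      calc
        _ ≤ (1 + lam * Δx * a) * Y + (1 + lam * Δx * a) ^ (n + 1) * (b * (lam * Δx)) := by gcongr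
        _ = _ := by rw [hY]; push_cast; ring
  refine (main n hn).of_le ?_
  gcongr
  exact one_add_mul_pow_le ha0 ht hn

lemma scheme_time {T μ y : ℝ}
    (hμ : ∀ n : ℕ, n * (lam * Δx) ≤ T →
      SumAbsLe (totalDensity (P.scheme β Δx (lam * Δx) Nη u₀ n)) (μ / Δx))
    (hy : ∀ n : ℕ, n * (lam * Δx) ≤ T →
      SumAbsLe (totalJump (P.scheme β Δx (lam * Δx) Nη u₀ n)) y)
    {n : ℕ} (hn : n * (lam * Δx) ≤ T) :
    SumAbsLe (fun i => ∑ k, |P.scheme β Δx (lam * Δx) Nη u₀ (n + 1) k i -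
        P.scheme β Δx (lam * Δx) Nη u₀ n k i|)
      (N * (2 * β * y + lam * (Fm * (D₁ + 2 * κ * D₂) + 2 * S) * μ)) := by
  have hΔ := H.Δx_pos
  rw [scheme_succ P β H.lam_pos.ne' H.Δx_pos.ne']
  refine (H.march_sub (H.scheme_mem h₀ n) (hμ n hn) (hy n hn)).of_le (le_of_eq ?_)
  field_simp

end Regime

/-! ### Kruzhkov entropies and the cell entropy inequality. -/

section Kruzhkov

/-- The Kruzhkov entropy flux, normalized to vanish at zero density. -/
def entropyFlux (f : ℝ → ℝ) (α a : ℝ) : ℝ := Real.sign (a - α) * (f a - f α) - f α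

/-- The weight of the velocity gradient, normalized to vanish at zero density. -/
def entropyWeight (f : ℝ → ℝ) (α a : ℝ) : ℝ := f α * (Real.sign (a - α) + 1)

lemma sign_mul_self' (x : ℝ) : Real.sign x * x = |x| := by
  rcases lt_trichotomy x 0 with h | h | h
  · rw [Real.sign_of_neg h, abs_of_neg h]; ring
  · simp [h]
  · rw [Real.sign_of_pos h, abs_of_pos h]; ring

lemma sign_mul_le_abs (x y : ℝ) : Real.sign x * y ≤ |y| := by
  have := le_abs_self y
  have := neg_abs_le y
  rcases Real.sign_apply_eq x with h | h | h <;> rw [h] <;> linarith [abs_nonneg y]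

lemma abs_sign_le (x : ℝ) : |Real.sign x| ≤ 1 := by
  rcases Real.sign_apply_eq x with h | h | h <;> rw [h] <;> norm_num

/-- With `max` and `min` the Kruzhkov flux is a difference of fluxes of ordered states, the form in
which monotonicity applies. -/
lemma entropyFlux_eq (f : ℝ → ℝ) (α a : ℝ) :
    entropyFlux f α a + f α = f (max a α) - f (min a α) := by
  rcases lt_trichotomy a α with h | h | h
  · rw [entropyFlux, Real.sign_of_neg (sub_neg.2 h), max_eq_right h.le, min_eq_left h.le]; ring
  · simp [entropyFlux, h]
  · rw [entropyFlux, Real.sign_of_pos (sub_pos.2 h), max_eq_left h.le, min_eq_right h.le]; ring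

variable {f : ℝ → ℝ} {F α : ℝ}
  (hf : ∀ x ∈ Icc (0 : ℝ) 1, ∀ y ∈ Icc (0 : ℝ) 1, |f x - f y| ≤ F * |x - y|)
  (hf0 : f 0 = 0) (hα : α ∈ Icc (0 : ℝ) 1)
include hf hα

/-- On either side of `α` the flux is `±f` up to a constant. If `a ≤ α ≤ b`, the increments over the
two pieces add, and so do the lengths. -/
lemma abs_entropyFlux_sub_le {a b : ℝ} (ha : a ∈ Icc (0 : ℝ) 1) (hb : b ∈ Icc (0 : ℝ) 1) :
    |entropyFlux f α a - entropyFlux f α b| ≤ F * |a - b| := by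
  wlog hab : a ≤ b generalizing a b with hw
  · rw [abs_sub_comm, abs_sub_comm a]
    exact hw hb ha (not_le.1 hab).le
  have e : entropyFlux f α a - entropyFlux f α b =
      (f (max a α) - f (min a α)) - (f (max b α) - f (min b α)) := by
    rw [← entropyFlux_eq, ← entropyFlux_eq]; ring
  rw [e]
  rcases le_total b α with h | h
  · rw [max_eq_right h, min_eq_left h, max_eq_right (hab.trans h), min_eq_left (hab.trans h)]
    have := hf b hb a ha
    rw [abs_sub_comm a b]
    convert this using 2
    ring
  · rcases le_total a α with h' | h'
    · rw [max_eq_left h, min_eq_right h, max_eq_right h', min_eq_left h']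
      have h1 := hf α hα a ha
      have h2 := hf α hα b hb
      rw [abs_of_nonneg (sub_nonneg.2 h')] at h1
      rw [abs_sub_comm α b, abs_of_nonneg (sub_nonneg.2 h)] at h2
      rw [abs_sub_comm a b, abs_of_nonneg (sub_nonneg.2 hab)]
      calc _ = |(f α - f a) + (f α - f b)| := by ring_nf
        _ ≤ |f α - f a| + |f α - f b| := abs_add_le _ _
        _ ≤ _ := by linarith
    · rw [max_eq_left h, min_eq_right h, max_eq_left h', min_eq_right h']
      have := hf a ha b hb
      convert this using 2
      ring

include hf0

lemma abs_entropyFlux_le {a : ℝ} (ha : a ∈ Icc (0 : ℝ) 1) : |entropyFlux f α a| ≤ F * a := by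
  have z : (0 : ℝ) ∈ Icc (0 : ℝ) 1 := by simp
  have e : entropyFlux f α 0 = 0 := by
    have := entropyFlux_eq f α 0
    rw [max_eq_right hα.1, min_eq_left hα.1, hf0] at this
    linarith
  have := abs_entropyFlux_sub_le hf hα ha z
  rwa [e, sub_zero, sub_zero, abs_of_nonneg ha.1] at this

lemma entropyWeight_mem (hF : 0 ≤ F) (hpos : ∀ x ∈ Icc (0 : ℝ) 1, 0 ≤ f x) {a : ℝ}
    (ha : a ∈ Icc (0 : ℝ) 1) : entropyWeight f α a ∈ Icc 0 (2 * F * a) := by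
  have h0 := hpos α hα
  have h1 : f α ≤ F * α := by
    have := hf α hα 0 (by simp)
    rw [hf0, sub_zero, sub_zero, abs_of_nonneg hα.1] at this
    exact (le_abs_self _).trans this
  rw [entropyWeight]
  rcases lt_trichotomy a α with h | h | h
  · rw [Real.sign_of_neg (sub_neg.2 h)]
    have := mul_nonneg hF ha.1
    constructor <;> linarith
  · rw [h, sub_self, Real.sign_zero]
    have := mul_nonneg hF hα.1
    constructor <;> linarith
  · rw [Real.sign_of_pos (sub_pos.2 h)]
    have := mul_le_mul_of_nonneg_left h.le hF
    constructor <;> linarith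

omit hf0

/-- The cell entropy inequality of the scheme. -/
lemma cell_entropy {β lam V νl νr t R a b c b' : ℝ} (hF : 0 ≤ F) (hlam : 0 < lam)
    (hl : νl ∈ Icc 0 V) (hr : νr ∈ Icc 0 V) (hside : lam * F * V ≤ β)
    (hmid : β + lam * F * V ≤ 1) (ha : a ∈ Icc (0 : ℝ) 1) (hb : b ∈ Icc (0 : ℝ) 1)
    (hc : c ∈ Icc (0 : ℝ) 1) (hb' : b' = laxFriedrichs f β lam νl νr a b c + t * R) :
    |b' - α| - |b - α| ≤
      -(lam * ((1 / 2 * νr * (entropyFlux f α b + entropyFlux f α c)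
            - β / (2 * lam) * (|c - α| - |b - α|))
          - (1 / 2 * νl * (entropyFlux f α a + entropyFlux f α b)
            - β / (2 * lam) * (|b - α| - |a - α|))))
        - lam * entropyWeight f α b' * (νr - νl) + t * (Real.sign (b' - α) * R) := by
  have hM : ∀ {x : ℝ}, x ∈ Icc (0 : ℝ) 1 → max x α ∈ Icc (0 : ℝ) 1 := fun hx =>
    ⟨hx.1.trans (le_max_left _ _), max_le hx.2 hα.2⟩
  have hm : ∀ {x : ℝ}, x ∈ Icc (0 : ℝ) 1 → min x α ∈ Icc (0 : ℝ) 1 := fun hx =>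
    ⟨le_min hx.1 hα.1, (min_le_left _ _).trans hx.2⟩
  have mono : ∀ {x y z x' y' z' : ℝ}, x ∈ Icc (0 : ℝ) 1 → y ∈ Icc (0 : ℝ) 1 → z ∈ Icc (0 : ℝ) 1 →
      x' ∈ Icc (0 : ℝ) 1 → y' ∈ Icc (0 : ℝ) 1 → z' ∈ Icc (0 : ℝ) 1 → x ≤ x' → y ≤ y' → z ≤ z' →
      laxFriedrichs f β lam νl νr x y z ≤ laxFriedrichs f β lam νl νr x' y' z' := by
    intro x y z x' y' z' hx hy hz hx' hy' hz' h1 h2 h3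
    have := laxFriedrichs_mono (δ := 0) hf hF hlam.le hl hr hside (by linarith)
      hx hy hz hx' hy' hz' h1 h2 h3
    linarith
  set h := laxFriedrichs f β lam νl νr a b c
  set hh := laxFriedrichs f β lam νl νr α α α with hhh
  set top := laxFriedrichs f β lam νl νr (max a α) (max b α) (max c α) with htop
  set bot := laxFriedrichs f β lam νl νr (min a α) (min b α) (min c α) with hbot
  -- Crandall–Majda comparison: the update and the update of the constant `α` both lie between those
  -- of the minima and of the maxima.
  have k1 : h ≤ top := mono ha hb hc (hM ha) (hM hb) (hM hc) (le_max_left _ _) (le_max_left _ _)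
    (le_max_left _ _)
  have k2 : hh ≤ top := mono hα hα hα (hM ha) (hM hb) (hM hc) (le_max_right _ _)
    (le_max_right _ _) (le_max_right _ _)
  have k3 : bot ≤ h := mono (hm ha) (hm hb) (hm hc) ha hb hc (min_le_left _ _) (min_le_left _ _)
    (min_le_left _ _)
  have k4 : bot ≤ hh := mono (hm ha) (hm hb) (hm hc) hα hα hα (min_le_right _ _)
    (min_le_right _ _) (min_le_right _ _)
  have k5 : |h - hh| ≤ top - bot := abs_le.2 ⟨by linarith, by linarith⟩
  -- The constant `α` is not stationary, since the velocity depends on position; this produces the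
  -- velocity-gradient term.
  have k6 : hh = α - lam * (f α * (νr - νl)) := by
    simp only [hhh, laxFriedrichs]; ring
  have ab : ∀ x : ℝ, |x - α| = max x α - min x α := fun x => (max_sub_min_eq_abs' x α).symm
  have k7 : top - bot = |b - α| - lam * ((1 / 2 * νr *
        ((entropyFlux f α b + f α) + (entropyFlux f α c + f α))
            - β / (2 * lam) * (|c - α| - |b - α|))
          - (1 / 2 * νl * ((entropyFlux f α a + f α) + (entropyFlux f α b + f α))
            - β / (2 * lam) * (|b - α| - |a - α|))) := by
    simp only [entropyFlux_eq, ab, htop, hbot, laxFriedrichs]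
    field_simp
    ring
  -- Using the sign of the new value makes this an identity, and fixes the new level as the one
  -- where `entropyWeight` and the sign of the source are taken.
  have k8 : |b' - α| = Real.sign (b' - α) * (h - hh)
      + Real.sign (b' - α) * (-(lam * (f α * (νr - νl))) + t * R) := by
    have e : b' - α = (h - hh) + (-(lam * (f α * (νr - νl))) + t * R) := by rw [hb', k6]; ring
    rw [← sign_mul_self', ← mul_add, ← e]
  have k9 := sign_mul_le_abs (b' - α) (h - hh)
  rw [k8, entropyWeight]
  linarith

end Kruzhkov

/-! ### Summation by parts on one cell and in time. -/

section CellAlgebra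

/-- Summation by parts in space on one cell: up to two telescoping terms the contribution of a
cell is controlled by the oscillation of the test function and of its time weight. -/
lemma cell_flux_le {lam Δx β F V LV q' qd Q pl pr pm pd νl νr γl γ γr ηl η ηr η' u dl dr σs I W : ℝ}
    (hlam : 0 < lam) (hΔ : 0 < Δx) (hβ : 0 ≤ β)
    (hq' : 0 ≤ q') (hpm : 0 ≤ pm) (hpr : 0 ≤ pr)
    (hQ : |lam * Δx * q' - Q| ≤ lam * Δx * qd)
    (hdr : |pr - pm| ≤ pd) (hdl : |pl - pm| ≤ pd)
    (hνl : νl ∈ Icc 0 V) (hνr : νr ∈ Icc 0 V)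
    (hγr : |γr - γ| ≤ F * dr) (hγl : |γ - γl| ≤ F * dl) (hγ : |γ| ≤ F * u)
    (hηr : |ηr - η| ≤ dr) (hηl : |η - ηl| ≤ dl)
    (hI : |I - pm * (νr - νl)| ≤ LV * Δx * pd) (hI' : |I| ≤ LV * (Δx * pm))
    (hent : η' - η ≤ -(lam * ((1 / 2 * νr * (γ + γr) - β / (2 * lam) * (ηr - η))
          - (1 / 2 * νl * (γl + γ) - β / (2 * lam) * (η - ηl)))) + lam * σs) :
    q' * ((η' - η) * (Δx * pm)) - Q * (γ * (νr * pr - νl * pl) - γ * I) + Q * W ≤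
      (lam * Δx * q' * ((-(1 / 2 * (νr * pr) * (γr + γ)) + β / (2 * lam) * pr * (ηr - η))
          - (-(1 / 2 * (νl * pl) * (γ + γl)) + β / (2 * lam) * pl * (η - ηl)))
        + (lam * Δx * q' - Q) * (γr * (νr * pr) - γ * (νl * pl)))
      + (lam * Δx * (q' * pd * (1 / 2 * (V * F + β / lam) * (dr + dl) + LV * Δx * F * u))
        + lam * Δx * (qd * pr * (V * F * dr)) + lam * Δx * (qd * (Δx * pm) * (LV * F * u)))
      + (Q * W + lam * Δx * q' * (pm * σs)) := by
  have ht : 0 < lam * Δx := mul_pos hlam hΔ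
  have hV : 0 ≤ V := hνl.1.trans hνl.2
  have hpd : 0 ≤ pd := (abs_nonneg _).trans hdr
  have hbl : 0 ≤ β / lam := div_nonneg hβ hlam.le
  have hqd : 0 ≤ lam * Δx * qd := (abs_nonneg _).trans hQ
  have e1 : |1 / 2 * (pr - pm) * (νr * (γr - γ) - β / lam * (ηr - η))| ≤
      1 / 2 * pd * ((V * F + β / lam) * dr) := by
    rw [abs_mul, abs_mul, abs_of_pos (by norm_num : (0 : ℝ) < 1 / 2)]
    have : |νr * (γr - γ) - β / lam * (ηr - η)| ≤ (V * F + β / lam) * dr := by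
      refine (abs_sub _ _).trans ?_
      rw [abs_mul, abs_mul, abs_of_nonneg hνr.1, abs_of_nonneg hbl]
      calc _ ≤ V * (F * dr) + β / lam * dr := by
            have := hνr.2
            gcongr
        _ = _ := by ring
    gcongr
  have e2 : |1 / 2 * (pl - pm) * (νl * (γ - γl) + β / lam * (η - ηl))| ≤
      1 / 2 * pd * ((V * F + β / lam) * dl) := by
    rw [abs_mul, abs_mul, abs_of_pos (by norm_num : (0 : ℝ) < 1 / 2)]
    have : |νl * (γ - γl) + β / lam * (η - ηl)| ≤ (V * F + β / lam) * dl := by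
      refine (abs_add_le _ _).trans ?_
      rw [abs_mul, abs_mul, abs_of_nonneg hνl.1, abs_of_nonneg hbl]
      calc _ ≤ V * (F * dl) + β / lam * dl := by
            have := hνl.2
            gcongr
        _ = _ := by ring
    gcongr
  have e3 : |γ * (I - pm * (νr - νl))| ≤ F * u * (LV * Δx * pd) := by
    rw [abs_mul]
    have := (abs_nonneg _).trans hγ
    gcongr
  have e4 : |(lam * Δx * q' - Q) * (-((γr - γ) * (νr * pr)) - γ * I)| ≤
      lam * Δx * qd * (V * F * dr * pr + F * u * (LV * (Δx * pm))) := by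
    rw [abs_mul]
    have : |-((γr - γ) * (νr * pr)) - γ * I| ≤ V * F * dr * pr + F * u * (LV * (Δx * pm)) := by
      refine (abs_sub _ _).trans ?_
      rw [abs_neg, abs_mul, abs_mul, abs_mul, abs_of_nonneg hνr.1, abs_of_nonneg hpr]
      have h1 := (abs_nonneg _).trans hγ
      have h2 := (abs_nonneg _).trans hγr
      have h3 := hνr.2
      have h4 := hνr.1
      calc _ ≤ F * dr * (V * pr) + F * u * (LV * (Δx * pm)) := by gcongr
        _ = _ := by ring
    gcongr
  have e5 := mul_le_mul_of_nonneg_left hent (mul_nonneg hq' (mul_nonneg hΔ.le hpm))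
  have e6 := mul_le_mul_of_nonneg_left ((le_abs_self _).trans e1) (mul_nonneg ht.le hq')
  have e7 := mul_le_mul_of_nonneg_left ((le_abs_self _).trans e2) (mul_nonneg ht.le hq')
  have e8 := mul_le_mul_of_nonneg_left ((le_abs_self _).trans e3) (mul_nonneg ht.le hq')
  have e9 := (le_abs_self _).trans e4
  -- Apart from the telescoping difference and the source, every product contains one of the small
  -- factors `pr - pm`, `pl - pm`, `I - pm (νr - νl)` and `λΔx q' - Q`.
  have id : q' * (Δx * pm) * (-(lam * ((1 / 2 * νr * (γ + γr) - β / (2 * lam) * (ηr - η))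
          - (1 / 2 * νl * (γl + γ) - β / (2 * lam) * (η - ηl)))) + lam * σs)
      - Q * (γ * (νr * pr - νl * pl) - γ * I) =
      (lam * Δx * q' * ((-(1 / 2 * (νr * pr) * (γr + γ)) + β / (2 * lam) * pr * (ηr - η))
          - (-(1 / 2 * (νl * pl) * (γ + γl)) + β / (2 * lam) * pl * (η - ηl)))
        + (lam * Δx * q' - Q) * (γr * (νr * pr) - γ * (νl * pl)))
      + (lam * Δx * q') * (1 / 2 * (pr - pm) * (νr * (γr - γ) - β / lam * (ηr - η)))
      + (lam * Δx * q') * (1 / 2 * (pl - pm) * (νl * (γ - γl) + β / lam * (η - ηl)))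
      + (lam * Δx * q') * (γ * (I - pm * (νr - νl)))
      + (lam * Δx * q' - Q) * (-((γr - γ) * (νr * pr)) - γ * I)
      + lam * Δx * q' * (pm * σs) := by
    field_simp
    ring
  linarith

/-- Summation by parts in time. -/
lemma time_shift_le {t : ℝ} (ht : 0 ≤ t) {q qd Q Y Z : ℕ → ℝ} (M : ℕ) (hq : ∀ n, 0 ≤ q n)
    (hQ : ∀ n < M, |t * q (n + 1) - Q n| ≤ t * qd n) (hqd : ∀ n < M, |q (n + 1) - q n| ≤ qd n) :
    ∑ n ∈ Finset.range M, (Q n * Y n - t * q (n + 1) * Z (n + 1)) ≤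
      ∑ n ∈ Finset.range M, (2 * t * qd n * |Y n| + t * q (n + 1) * |Y (n + 1) - Z (n + 1)|)
        + t * (q 0 * |Y 0| + q M * |Y M|) := by
  -- Insert `t q_{n+1} Y_n`, `t q_n Y_n` and `t q_{n+1} Y_{n+1}`: two of the differences cost `t qd
  -- |Y|` each, one compares `Y` with `Z`, and one telescopes.
  have step : ∀ n ∈ Finset.range M, Q n * Y n - t * q (n + 1) * Z (n + 1) ≤
      (2 * t * qd n * |Y n| + t * q (n + 1) * |Y (n + 1) - Z (n + 1)|)
        + (t * (q n * Y n) - t * (q (n + 1) * Y (n + 1))) := fun n hn => by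
    rw [Finset.mem_range] at hn
    have h1 : (Q n - t * q (n + 1)) * Y n ≤ t * qd n * |Y n| := by
      refine (le_abs_self _).trans ?_
      rw [abs_mul, abs_sub_comm]
      exact mul_le_mul_of_nonneg_right (hQ n hn) (abs_nonneg _)
    have h2 : t * ((q (n + 1) - q n) * Y n) ≤ t * (qd n * |Y n|) := by
      refine mul_le_mul_of_nonneg_left ((le_abs_self _).trans ?_) ht
      rw [abs_mul]
      exact mul_le_mul_of_nonneg_right (hqd n hn) (abs_nonneg _)
    have h3 := mul_le_mul_of_nonneg_left (le_abs_self (Y (n + 1) - Z (n + 1)))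
      (mul_nonneg ht (hq (n + 1)))
    linarith
  refine (Finset.sum_le_sum step).trans ?_
  rw [Finset.sum_add_distrib, Finset.sum_range_sub' (fun n => t * (q n * Y n))]
  have h1 := mul_le_mul_of_nonneg_left (le_abs_self (Y 0)) (hq 0)
  have h2 := mul_le_mul_of_nonneg_left (neg_abs_le (Y M)) (hq M)
  have h3 := mul_le_mul_of_nonneg_left (add_le_add h1 (neg_le_neg h2)) ht
  linarith

end CellAlgebra

/-! ### Oscillation bounds, time slabs and integration by parts. -/

section Calculus

lemma abs_sub_le_integral_abs_deriv {p : ℝ → ℝ} (hp : ContDiff ℝ 1 p) {a b x y : ℝ}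
    (hx : x ∈ Icc a b) (hy : y ∈ Icc a b) : |p x - p y| ≤ ∫ z in a..b, |deriv p z| := by
  have hc : Continuous (deriv p) := hp.continuous_deriv le_rfl
  wlog hxy : y ≤ x generalizing x y with hw
  · rw [abs_sub_comm]
    exact hw hy hx (not_le.1 hxy).le
  rw [← intervalIntegral.integral_deriv_eq_sub (fun z _ => hp.differentiable one_ne_zero z)
    (hc.intervalIntegrable _ _)]
  refine (intervalIntegral.abs_integral_le_integral_abs hxy).trans ?_
  exact intervalIntegral.integral_mono_interval hy.1 hxy hx.2 (ae_of_all _ fun _ => abs_nonneg _)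
    (hc.abs.intervalIntegrable _ _)

lemma abs_length_mul_sub_integral_le {p : ℝ → ℝ} (hp : ContDiff ℝ 1 p) {a b x : ℝ}
    (hx : x ∈ Icc a b) :
    |(b - a) * p x - ∫ z in a..b, p z| ≤ (b - a) * ∫ z in a..b, |deriv p z| := by
  have hab : a ≤ b := hx.1.trans hx.2
  have hc := hp.continuous
  have e : (b - a) * p x - ∫ z in a..b, p z = ∫ z in a..b, (p x - p z) := by
    rw [intervalIntegral.integral_sub (intervalIntegrable_const) (hc.intervalIntegrable _ _),
      intervalIntegral.integral_const, smul_eq_mul]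
  rw [e, ← Real.norm_eq_abs]
  refine (intervalIntegral.norm_integral_le_of_norm_le_const (C := ∫ z in a..b, |deriv p z|)
    fun z hz => ?_).trans_eq ?_
  · rw [uIoc_of_le hab] at hz
    exact abs_sub_le_integral_abs_deriv hp hx (Ioc_subset_Icc_self hz)
  · rw [abs_of_nonneg (sub_nonneg.2 hab), mul_comm]

/-- A function on the line that is separated on finitely many time slabs. -/
lemma integral_slabs {f : ℝ × ℝ → ℝ} {a : ℕ → ℝ → ℝ} {b : ℝ → ℝ} {t : ℝ} (ht : 0 ≤ t) (M : ℕ)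
    (ha : ∀ n, Integrable (a n)) (hb : Continuous b)
    (hf : ∀ n : ℕ, ∀ s ∈ Ico (n * t) ((n + 1) * t), ∀ x, f (s, x) = b s * a n x) :
    IntegrableOn f (Ico 0 (M * t) ×ˢ univ) ∧ ∫ z in Ico 0 (M * t) ×ˢ univ, f z =
      ∑ n ∈ Finset.range M, (∫ s in (n * t)..((n + 1) * t), b s) * ∫ x, a n x := by
  induction M with
  | zero => simp
  | succ M ih =>
    have hle : (M : ℝ) * t ≤ (M + 1) * t := by gcongr; linarith
    have hM : 0 ≤ (M : ℝ) * t := by positivity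
    have hunion : Ico 0 ((M + 1 : ℕ) * t) ×ˢ (univ : Set ℝ) =
        Ico 0 (M * t) ×ˢ univ ∪ Ico (M * t) ((M + 1) * t) ×ˢ univ := by
      rw [← union_prod, Ico_union_Ico_eq_Ico hM hle]
      push_cast
      rfl
    have hdisj : Disjoint (Ico 0 (M * t) ×ˢ (univ : Set ℝ))
        (Ico (M * t) ((M + 1) * t) ×ˢ univ) := by
      rw [Set.disjoint_left]
      rintro ⟨s, x⟩ h1 h2
      exact absurd h1.1.2 (not_lt.2 h2.1.1)
    have hmeas : MeasurableSet (Ico (M * t) ((M + 1) * t) ×ˢ (univ : Set ℝ)) :=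
      measurableSet_Ico.prod MeasurableSet.univ
    have hb' : IntegrableOn b (Ico (M * t) ((M + 1) * t)) :=
      hb.continuousOn.integrableOn_Icc.mono_set Ico_subset_Icc_self
    have hprod : Integrable (fun z : ℝ × ℝ => b z.1 * a M z.2)
        (volume.restrict (Ico (M * t) ((M + 1) * t) ×ˢ univ)) := by
      rw [Measure.volume_eq_prod, ← Measure.prod_restrict, Measure.restrict_univ]
      exact hb'.mul_prod (ha M)
    have heq : EqOn f (fun z => b z.1 * a M z.2) (Ico (M * t) ((M + 1) * t) ×ˢ univ) :=
      fun z hz => hf M z.1 hz.1 z.2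
    have hint : IntegrableOn f (Ico (M * t) ((M + 1) * t) ×ˢ univ) :=
      IntegrableOn.congr_fun hprod heq.symm hmeas
    have hval : ∫ z in Ico (M * t) ((M + 1) * t) ×ˢ univ, f z =
        (∫ s in (M * t)..((M + 1) * t), b s) * ∫ x, a M x := by
      rw [setIntegral_congr_fun hmeas heq, Measure.volume_eq_prod, setIntegral_prod_mul,
        Measure.restrict_univ, integral_Ico_eq_integral_Ioc, intervalIntegral.integral_of_le hle]
    rw [hunion]
    refine ⟨ih.1.union hint, ?_⟩
    rw [setIntegral_union hdisj hmeas ih.1 hint, ih.2, hval, Finset.sum_range_succ]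

lemma QT_ae_eq (T : ℝ) : QT T =ᵐ[volume] Ico 0 T ×ˢ (univ : Set ℝ) := by
  rw [QT, Measure.volume_eq_prod]
  exact Measure.set_prod_ae_eq Ioo_ae_eq_Ico Filter.EventuallyEq.rfl

lemma hasSum_setIntegral_cell {Δx : ℝ} (hΔ : 0 < Δx) {a : ℝ → ℝ} (ha : Integrable a) :
    HasSum (fun i => ∫ x in cell Δx i, a x) (∫ x, a x) := by
  have := hasSum_integral_iUnion (f := a) (fun i => measurableSet_cell Δx i)
    (pairwise_disjoint_cell hΔ) (by rw [iUnion_cell hΔ]; exact ha.integrableOn)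
  rwa [iUnion_cell hΔ, setIntegral_univ] at this

lemma absolutelyContinuousOnInterval_of_contDiff {p : ℝ → ℝ} (hp : ContDiff ℝ 1 p) (a b : ℝ) :
    AbsolutelyContinuousOnInterval p a b := by
  obtain ⟨K, hK⟩ := hp.contDiffOn.exists_lipschitzOnWith (s := uIcc a b) one_ne_zero
    (convex_uIcc a b) isCompact_uIcc
  exact hK.absolutelyContinuousOnInterval

/-- Integration by parts on the line for a Lipschitz function and a test function. -/
lemma integral_mul_deriv_add_deriv_mul_eq_zero {v p : ℝ → ℝ} {K : ℝ≥0} (hv : LipschitzWith K v)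
    (hp : ContDiff ℝ 1 p) (hs : HasCompactSupport p) :
    (∫ x, v x * deriv p x) + ∫ x, deriv v x * p x = 0 := by
  obtain ⟨R, hR⟩ := hs.isCompact.isBounded.subset_closedBall 0
  -- The extra 1 puts both end points outside the support.
  set a := |R| + 1
  have hout : ∀ x, x ∉ Ioc (-a) a → x ∉ tsupport p := fun x hx h => hx (by
    have := hR h
    rw [Metric.mem_closedBall, dist_zero_right, Real.norm_eq_abs, abs_le] at this
    have := le_abs_self R
    exact ⟨by simp only [a]; linarith, by simp only [a]; linarith⟩)
  have hpa : ∀ x, x ∉ Ioc (-a) a → p x = 0 := fun x hx => image_eq_zero_of_notMem_tsupport (hout x hx)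
  have hda : ∀ x, x ∉ Ioc (-a) a → deriv p x = 0 := fun x hx =>
    image_eq_zero_of_notMem_tsupport fun h => hout x hx (tsupport_deriv_subset h)
  have hle : -a ≤ a := by simp only [a]; linarith [abs_nonneg R]
  have e1 : ∫ x, v x * deriv p x = ∫ x in (-a)..a, v x * deriv p x := by
    rw [intervalIntegral.integral_of_le hle]
    exact (setIntegral_eq_integral_of_forall_compl_eq_zero fun x hx => by rw [hda x hx, mul_zero]).symm
  have e2 : ∫ x, deriv v x * p x = ∫ x in (-a)..a, deriv v x * p x := by
    rw [intervalIntegral.integral_of_le hle]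
    exact (setIntegral_eq_integral_of_forall_compl_eq_zero fun x hx => by rw [hpa x hx, mul_zero]).symm
  rw [e1, e2, AbsolutelyContinuousOnInterval.integral_mul_deriv_eq_deriv_mul
    (hv.lipschitzOnWith.absolutelyContinuousOnInterval)
    (absolutelyContinuousOnInterval_of_contDiff hp _ _)]
  have pa : p a = 0 := by
    refine image_eq_zero_of_notMem_tsupport fun h => ?_
    have := hR h
    rw [Metric.mem_closedBall, dist_zero_right, Real.norm_eq_abs, abs_le] at this
    have := le_abs_self R
    simp only [a] at *
    linarith
  rw [pa, hpa (-a) (by simp)]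
  ring

lemma setIntegral_cell_mul_deriv {v p : ℝ → ℝ} {K : ℝ≥0} (hv : LipschitzWith K v)
    (hp : ContDiff ℝ 1 p) {Δx : ℝ} (hΔ : 0 < Δx) (i : ℤ) :
    ∫ x in cell Δx i, v x * deriv p x =
      v (((i : ℝ) + 1 / 2) * Δx) * p (((i : ℝ) + 1 / 2) * Δx)
        - v (((i : ℝ) - 1 / 2) * Δx) * p (((i : ℝ) - 1 / 2) * Δx)
        - ∫ x in cell Δx i, deriv v x * p x := by
  rw [setIntegral_cell hΔ, setIntegral_cell hΔ,
    AbsolutelyContinuousOnInterval.integral_mul_deriv_eq_deriv_mul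
    (hv.lipschitzOnWith.absolutelyContinuousOnInterval)
    (absolutelyContinuousOnInterval_of_contDiff hp _ _)]

lemma setIntegral_cell_deriv {v : ℝ → ℝ} {K : ℝ≥0} (hv : LipschitzWith K v) {Δx : ℝ}
    (hΔ : 0 < Δx) (i : ℤ) :
    ∫ x in cell Δx i, deriv v x =
      v (((i : ℝ) + 1 / 2) * Δx) - v (((i : ℝ) - 1 / 2) * Δx) := by
  rw [setIntegral_cell hΔ, AbsolutelyContinuousOnInterval.integral_deriv_eq_sub
    (hv.lipschitzOnWith.absolutelyContinuousOnInterval)]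

end Calculus

/-! ### Velocity and source of a step state. -/

/-- The velocity of lane `k` for the piecewise constant state `U`. -/
def stepVelocity {N : ℕ} (P : LaneModel N) (Δx : ℝ) (U : Fin N → ℤ → ℝ) (k : Fin N) (x : ℝ) : ℝ :=
  P.ν k x (P.conv (stepFun Δx (U k)) x)

/-- The source of lane `k` for the piecewise constant state `U`. -/
def stepSource {N : ℕ} (P : LaneModel N) (Δx : ℝ) (U : Fin N → ℤ → ℝ) (k : Fin N) (x : ℝ) : ℝ :=
  P.R k x (fun j => stepFun Δx (U j) x) fun j => P.conv (stepFun Δx (U j)) x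

namespace Regime

variable {N : ℕ} {P : LaneModel N} {β lam Δx : ℝ} {Nη : ℕ} {F V : Fin N → ℝ}
  {Fm D₁ D₂ D₁₁ D₂₁ D₂₂ κ S : ℝ}
  (H : Regime P β lam Δx Nη F V Fm D₁ D₂ D₁₁ D₂₁ D₂₂ κ S)
  {U : Fin N → ℤ → ℝ} (hU : ∀ k i, U k i ∈ Icc (0 : ℝ) 1)
include H

lemma speed_lip_nonneg : 0 ≤ D₁ + 2 * κ * D₂ :=
  add_nonneg H.D₁_nonneg (mul_nonneg (mul_nonneg zero_le_two H.κ_nonneg) H.D₂_nonneg)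

include hU

lemma conv_stepFun_mem (k : Fin N) (x : ℝ) : P.conv (stepFun Δx (U k)) x ∈ Icc (0 : ℝ) 1 :=
  H.conv_mem (measurable_stepFun _ _) (fun _ => hU _ _) x

lemma stepVelocity_lipschitz (k : Fin N) :
    LipschitzWith (D₁ + 2 * κ * D₂).toNNReal (stepVelocity P Δx U k) :=
  LipschitzWith.of_dist_le_mul fun x y => by
    rw [Real.coe_toNNReal _ H.speed_lip_nonneg]
    exact H.velocity_lip (measurable_stepFun _ _) (fun _ => hU _ _) k x y

lemma abs_deriv_stepVelocity_le (k : Fin N) (x : ℝ) :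
    |deriv (stepVelocity P Δx U k) x| ≤ D₁ + 2 * κ * D₂ := by
  have := norm_deriv_le_of_lipschitz (x₀ := x) (H.stepVelocity_lipschitz hU k)
  rwa [Real.coe_toNNReal _ H.speed_lip_nonneg] at this

lemma stepVelocity_mem (k : Fin N) (x : ℝ) : stepVelocity P Δx U k x ∈ Icc 0 (V k) :=
  ⟨H.ν_nonneg _ _ _ (H.conv_stepFun_mem hU k x), H.ν_le _ _ _ (H.conv_stepFun_mem hU k x)⟩

omit hU in
lemma stepVelocity_right (k : Fin N) (i : ℤ) :
    stepVelocity P Δx U k (((i : ℝ) + 1 / 2) * Δx) = interfaceVelocity P Δx Nη k (U k) i := by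
  rw [stepVelocity, H.conv_stepFun_half, interfaceVelocity]

omit hU in
lemma stepVelocity_left (k : Fin N) (i : ℤ) :
    stepVelocity P Δx U k (((i : ℝ) - 1 / 2) * Δx) =
      interfaceVelocity P Δx Nη k (U k) (i - 1) := by
  rw [← H.stepVelocity_right]
  congr 2
  push_cast
  ring

lemma stepSource_bound (k : Fin N) {i : ℤ} {x : ℝ} (hx : x ∈ cell Δx i) :
    |stepSource P Δx U k x| ≤ 2 * S * totalDensity U i := by
  have := (H.R_bounds k x (U := fun j => stepFun Δx (U j) x)
    (A := fun j => P.conv (stepFun Δx (U j)) x) (fun j => hU j _)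
    fun j => H.conv_stepFun_mem hU j x).2.2
  simpa only [stepSource, totalDensity, stepFun_of_mem_cell H.Δx_pos _ hx] using this

lemma abs_stepSource_le (k : Fin N) (x : ℝ) : |stepSource P Δx U k x| ≤ 2 * S * N := by
  refine (H.R_bounds k x (U := fun j => stepFun Δx (U j) x)
    (A := fun j => P.conv (stepFun Δx (U j)) x) (fun j => hU j _)
    fun j => H.conv_stepFun_mem hU j x).2.2.trans ?_
  have hS := H.S_nonneg
  gcongr
  calc _ ≤ ∑ j : Fin N, (1 : ℝ) := Finset.sum_le_sum fun j _ => (hU j _).2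
    _ = N := by simp

/-- On the cell the densities equal the grid values, so only the velocities differ. Both interfaces
entering `cFull` lie within `2Δx` of every point of the cell. -/
lemma abs_stepSource_sub_numSource_le (k : Fin N) {i : ℤ} {x : ℝ} (hx : x ∈ cell Δx i) :
    |stepSource P Δx U k x - P.numSource Δx Nη U k i| ≤
      8 * Fm * (2 * (D₁ + 2 * κ * D₂) * Δx) * totalDensity U i := by
  have hΔ := H.Δx_pos
  have e : stepSource P Δx U k x =
      P.R k x (fun j => U j i) fun j => P.conv (stepFun Δx (U j)) x := by
    simp only [stepSource, stepFun_of_mem_cell hΔ _ hx]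
  rw [e]
  refine H.R_sub_le_of_velocity k x ((i : ℝ) * Δx) (fun j => hU j i) fun j => ?_
  have hD₁ := H.D₁_nonneg
  have hκ := H.κ_nonneg
  have m1 := H.conv_stepFun_mem hU j x
  have m2 := H.cFull_mem (hU j) i
  have t1 := H.ν_x j x ((i : ℝ) * Δx) _ m1
  have t2 := H.ν_A j ((i : ℝ) * Δx) _ m1 _ m2
  have x1 : |x - (i : ℝ) * Δx| ≤ 2 * Δx := abs_le.2 ⟨by linarith [hx.1], by linarith [hx.2]⟩
  have hconv : ∀ y, |x - y| ≤ 2 * Δx → |P.conv (stepFun Δx (U j)) x -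
      P.conv (stepFun Δx (U j)) y| ≤ 2 * κ * (2 * Δx) := fun y hy =>
    (H.conv_lip (measurable_stepFun _ _) (fun _ => hU _ _) x y).trans (by gcongr)
  have c1 := hconv (((i : ℝ) + 1 / 2) * Δx) (abs_le.2 ⟨by linarith [hx.1], by linarith [hx.2]⟩)
  have c2 := hconv ((((i + 1 : ℤ) : ℝ) + 1 / 2) * Δx)
    (abs_le.2 ⟨by push_cast; linarith [hx.1], by push_cast; linarith [hx.2]⟩)
  rw [H.conv_stepFun_half] at c1 c2
  have c3 : |P.conv (stepFun Δx (U j)) x - P.cFull Δx Nη (U j) i| ≤ 2 * κ * (2 * Δx) := by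
    rw [abs_le] at c1 c2 ⊢
    unfold LaneModel.cFull
    constructor <;> linarith [c1.1, c1.2, c2.1, c2.2]
  have t3 := mul_le_mul_of_nonneg_left c3 H.D₂_nonneg
  have t4 := mul_le_mul_of_nonneg_left x1 hD₁
  refine (abs_sub_le _ _ _).trans ((add_le_add t1 t2).trans ?_)
  linarith

lemma measurable_stepVelocity (k : Fin N) : Measurable (stepVelocity P Δx U k) :=
  (H.stepVelocity_lipschitz hU k).continuous.measurable

lemma measurable_stepSource (k : Fin N) : Measurable (stepSource P Δx U k) := by
  have hS : ∀ k : Fin N, Measurable fun x => P.S k x (fun j => stepFun Δx (U j) x)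
      fun j => P.conv (stepFun Δx (U j)) x := fun k => by
    unfold LaneModel.S
    split_ifs with hk
    · have hv : ∀ j, Measurable fun x => P.ν j x (P.conv (stepFun Δx (U j)) x) := fun j =>
        H.measurable_stepVelocity hU j
      have hg : ∀ j, Measurable fun x => P.g j (stepFun Δx (U j) x) := fun j =>
        (H.g_cont j).measurable.comp (measurable_stepFun _ _)
      have hs : ∀ j, Measurable (stepFun Δx (U j)) := fun j => measurable_stepFun _ _
      unfold LaneModel.exchange
      have hX := ((hg ⟨(k : ℕ) + 1, hk⟩).mul (hv ⟨(k : ℕ) + 1, hk⟩)).sub ((hg k).mul (hv k))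
      exact ((hX.max measurable_const).mul (hs k)).sub
        ((hX.min measurable_const).neg.mul (hs _))
    · exact measurable_const
  unfold stepSource LaneModel.R
  split_ifs with hk
  · exact (hS _).sub (hS _)
  · exact measurable_const.sub (hS _)

end Regime

/-! ### Exact evaluation of the entropy functional on grid functions. -/

/-- The space-time function that equals the piecewise constant state `U n` on the `n`-th slab. -/
def gridFun {N : ℕ} (Δx Δt : ℝ) (U : ℕ → Fin N → ℤ → ℝ) (k : Fin N) (t x : ℝ) : ℝ :=
  stepFun Δx (U ⌊t / Δt⌋₊ k) x

lemma floor_of_mem_slab {Δt : ℝ} (ht : 0 < Δt) {n : ℕ} {s : ℝ}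
    (hs : s ∈ Ico (n * Δt) ((n + 1) * Δt)) : ⌊s / Δt⌋₊ = n := by
  have h0 : 0 ≤ s := le_trans (by positivity) hs.1
  rw [Nat.floor_eq_iff (by positivity), le_div_iff₀ ht, div_lt_iff₀ ht]
  exact hs

lemma integrable_bdd_mul_test {a p : ℝ → ℝ} {C : ℝ} (ha : Measurable a) (hC : ∀ x, |a x| ≤ C)
    (hp : Continuous p) (hs : HasCompactSupport p) : Integrable fun x => a x * p x :=
  (hp.integrable_of_hasCompactSupport hs).bdd_mul (c := C) ha.aestronglyMeasurable
    (ae_of_all _ hC)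

lemma sum_time_abel (q E : ℕ → ℝ) (M : ℕ) :
    ∑ n ∈ Finset.range M, (q (n + 1) - q n) * E n - E M * q M + E 0 * q 0 =
      -∑ n ∈ Finset.range M, q (n + 1) * (E (n + 1) - E n) := by
  induction M with
  | zero => simp
  | succ M ih =>
    rw [Finset.sum_range_succ, Finset.sum_range_succ]
    linarith

/-- The density of the velocity-gradient and lane-change terms in the entropy balance of a state that
is constant on cells. -/
def sourceDensity {N : ℕ} (P : LaneModel N) (Δx α : ℝ) (U : Fin N → ℤ → ℝ)
    (k : Fin N) (x : ℝ) : ℝ :=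
  entropyWeight (P.f k) α (stepFun Δx (U k) x) * deriv (stepVelocity P Δx U k) x
    - Real.sign (stepFun Δx (U k) x - α) * stepSource P Δx U k x

namespace Regime

variable {N : ℕ} {P : LaneModel N} {β lam Δx : ℝ} {Nη : ℕ} {F V : Fin N → ℝ}
  {Fm D₁ D₂ D₁₁ D₂₁ D₂₂ κ S : ℝ}
  (H : Regime P β lam Δx Nη F V Fm D₁ D₂ D₁₁ D₂₁ D₂₂ κ S)
include H

section SpaceIntegrals

variable {U : Fin N → ℤ → ℝ} (hU : ∀ k i, U k i ∈ Icc (0 : ℝ) 1) (k : Fin N) {α : ℝ}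
  (hα : α ∈ Icc (0 : ℝ) 1) {p : ℝ → ℝ} (hp : ContDiff ℝ 1 p) (hs : HasCompactSupport p)
include hU hα hp hs

omit H in
lemma integrable_entropy : Integrable fun x => |stepFun Δx (U k) x - α| * p x := by
  refine integrable_bdd_mul_test (C := 1) (measurable_stepFun Δx fun i => |U k i - α|)
    (fun x => ?_) hp.continuous hs
  have : stepFun Δx (U k) x ∈ Icc (0 : ℝ) 1 := hU k _
  rw [abs_abs, abs_le]
  constructor <;> linarith [this.1, this.2, hα.1, hα.2]

lemma integrable_flux : Integrable fun x =>
    entropyFlux (P.f k) α (stepFun Δx (U k) x) * (stepVelocity P Δx U k x * deriv p x) := by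
  simp_rw [← mul_assoc]
  refine integrable_bdd_mul_test (C := F k * V k)
    ((measurable_stepFun Δx fun i => entropyFlux (P.f k) α (U k i)).mul
      (H.measurable_stepVelocity hU k)) (fun x => ?_) (hp.continuous_deriv le_rfl) hs.deriv
  have h1 := abs_entropyFlux_le (H.f_lip k) (f_zero k) hα (hU k ⌊x / Δx + 1 / 2⌋)
  have h2 := H.stepVelocity_mem hU k x
  have h3 := mul_le_of_le_one_right (H.F_nonneg k) (hU k ⌊x / Δx + 1 / 2⌋).2
  have h4 := H.F_nonneg k
  change |entropyFlux (P.f k) α (U k ⌊x / Δx + 1 / 2⌋) * stepVelocity P Δx U k x| ≤ _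
  rw [abs_mul, abs_of_nonneg h2.1]
  exact mul_le_mul (h1.trans h3) h2.2 h2.1 h4

omit hα in
lemma integrable_velocity_mul_deriv : Integrable fun x => stepVelocity P Δx U k x * deriv p x :=
  integrable_bdd_mul_test (C := V k) (H.measurable_stepVelocity hU k)
    (fun x => by rw [abs_of_nonneg (H.stepVelocity_mem hU k x).1]
                 exact (H.stepVelocity_mem hU k x).2) (hp.continuous_deriv le_rfl) hs.deriv

omit hα in
lemma integrable_deriv_velocity_mul :
    Integrable fun x => deriv (stepVelocity P Δx U k) x * p x :=
  integrable_bdd_mul_test (C := D₁ + 2 * κ * D₂) (measurable_deriv _)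
    (H.abs_deriv_stepVelocity_le hU k) hp.continuous hs

lemma integrable_weight_deriv : Integrable fun x => entropyWeight (P.f k) α (stepFun Δx (U k) x)
    * (deriv (stepVelocity P Δx U k) x * p x) := by
  simp_rw [← mul_assoc]
  refine integrable_bdd_mul_test (C := 2 * F k * (D₁ + 2 * κ * D₂))
    ((measurable_stepFun Δx fun i => entropyWeight (P.f k) α (U k i)).mul
      (measurable_deriv _)) (fun x => ?_) hp.continuous hs
  have h1 := entropyWeight_mem (H.f_lip k) (f_zero k) hα (H.F_nonneg k)
    (fun _ => H.f_nonneg k) (hU k ⌊x / Δx + 1 / 2⌋)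
  have h2 := H.abs_deriv_stepVelocity_le hU k x
  have h3 := mul_le_of_le_one_right (H.F_nonneg k) (hU k ⌊x / Δx + 1 / 2⌋).2
  have h4 := H.F_nonneg k
  change |entropyWeight (P.f k) α (U k ⌊x / Δx + 1 / 2⌋) * _| ≤ _
  rw [abs_mul, abs_of_nonneg h1.1]
  exact mul_le_mul (by linarith [h1.2]) h2 (abs_nonneg _) (by positivity)

omit hα in
lemma integrable_source : Integrable fun x =>
    Real.sign (stepFun Δx (U k) x - α) * stepSource P Δx U k x * p x := by
  refine integrable_bdd_mul_test (C := 2 * S * N)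
    ((measurable_stepFun Δx fun i => Real.sign (U k i - α)).mul
      (H.measurable_stepSource hU k)) (fun x => ?_) hp.continuous hs
  rw [abs_mul]
  exact (mul_le_of_le_one_left (abs_nonneg _) (abs_sign_le _)).trans
    (H.abs_stepSource_le hU k x)

end SpaceIntegrals

/-- On a slab the state does not depend on time, so `q'` integrates to an increment of `q`, and Abel
summation absorbs the initial and terminal terms. The normalizing multiples of `f(α)` cancel because
`V p' + V_x p` has integral zero. -/
lemma neg_lambdaT_eq {U : ℕ → Fin N → ℤ → ℝ} (hU : ∀ n k i, U n k i ∈ Icc (0 : ℝ) 1) (k : Fin N)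
    {α : ℝ} (hα : α ∈ Icc (0 : ℝ) 1) {p q : ℝ → ℝ} (hp : ContDiff ℝ 1 p)
    (hs : HasCompactSupport p) (hq : ContDiff ℝ 1 q) {Δt : ℝ} (ht : 0 < Δt) (M : ℕ) :
    -P.LambdaT (M * Δt) k (gridFun Δx Δt U) (fun t x => p x * q t) α =
      ∑ n ∈ Finset.range M,
        (q ((n + 1 : ℕ) * Δt) * ((∫ x, |stepFun Δx (U (n + 1) k) x - α| * p x)
            - ∫ x, |stepFun Δx (U n k) x - α| * p x)
          - (∫ s in (n * Δt)..((n + 1) * Δt), q s) *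
            (∫ x, entropyFlux (P.f k) α (stepFun Δx (U n k) x) *
              (stepVelocity P Δx (U n) k x * deriv p x))
          + (∫ s in (n * Δt)..((n + 1) * Δt), q s) *
            ∫ x, sourceDensity P Δx α (U n) k x * p x) := by
  set w := fun n => stepFun Δx (U n k)
  set Vn := fun n => stepVelocity P Δx (U n) k
  set Q := fun n : ℕ => ∫ s in (n * Δt)..((n + 1) * Δt), q s
  have hfl : ∀ n : ℕ, ∀ s ∈ Ico (n * Δt) ((n + 1) * Δt), ⌊s / Δt⌋₊ = n := fun n s hs =>
    floor_of_mem_slab ht hs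
  -- At `t = MΔt` the floor selects level `M`, the state of the terminal term.
  have hgrid : ∀ n : ℕ, gridFun Δx Δt U k (n * Δt) = w n := fun n => by
    ext x
    rw [gridFun, mul_div_cancel_right₀ _ ht.ne', Nat.floor_natCast]
  have hq' : Continuous (deriv q) := hq.continuous_deriv le_rfl
  have i1 := fun n => integrable_entropy (Δx := Δx) (hU n) k hα hp hs
  have i2 := fun n => H.integrable_flux (hU n) k hα hp hs
  have i2' := fun n => H.integrable_velocity_mul_deriv (hU n) k hp hs
  have i3 := fun n => H.integrable_weight_deriv (hU n) k hα hp hs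
  have i3' := fun n => H.integrable_deriv_velocity_mul (hU n) k hp hs
  have i4 := fun n => H.integrable_source (α := α) (hU n) k hp hs
  have eG : ∀ n x, P.G k (w n x) α * Vn n x * deriv p x =
      entropyFlux (P.f k) α (w n x) * (Vn n x * deriv p x) + P.f k α * (Vn n x * deriv p x) :=
    fun n x => by simp only [LaneModel.G, entropyFlux]; ring
  have eV : ∀ n x, Real.sign (w n x - α) * P.f k α * deriv (Vn n) x * p x =
      entropyWeight (P.f k) α (w n x) * (deriv (Vn n) x * p x)
        - P.f k α * (deriv (Vn n) x * p x) :=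
    fun n x => by simp only [entropyWeight]; ring
  have j2 : ∀ n, Integrable fun x => P.G k (w n x) α * Vn n x * deriv p x := fun n => by
    simp only [eG]
    exact (i2 n).add ((i2' n).const_mul _)
  have j3 : ∀ n, Integrable fun x => Real.sign (w n x - α) * P.f k α * deriv (Vn n) x * p x :=
    fun n => by
      simp only [eV]
      exact (i3 n).sub ((i3' n).const_mul _)
  have s1 := integral_slabs (f := fun z => |gridFun Δx Δt U k z.1 z.2 - α|
      * deriv (fun t => p z.2 * q t) z.1) (a := fun n x => |w n x - α| * p x) (b := deriv q)
    ht.le M i1 hq' fun n s hs x => by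
      simp only [deriv_const_mul_field, gridFun, hfl n s hs, w]; ring
  have s2 := integral_slabs (f := fun z => P.G k (gridFun Δx Δt U k z.1 z.2) α
      * P.velocity (gridFun Δx Δt U) k z.1 z.2 * deriv (fun x => p x * q z.1) z.2)
    (a := fun n x => P.G k (w n x) α * Vn n x * deriv p x) (b := q)
    ht.le M j2 hq.continuous fun n s hs x => by
      have : gridFun Δx Δt U k s = w n := by ext y; simp only [gridFun, hfl n s hs, w]
      simp only [deriv_mul_const_field, LaneModel.velocity, this, Vn, stepVelocity, w]; ring
  have s3 := integral_slabs (f := fun z => Real.sign (gridFun Δx Δt U k z.1 z.2 - α) * P.f k α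
      * deriv (P.velocity (gridFun Δx Δt U) k z.1) z.2 * (p z.2 * q z.1))
    (a := fun n x => Real.sign (w n x - α) * P.f k α * deriv (Vn n) x * p x) (b := q)
    ht.le M j3 hq.continuous fun n s hs x => by
      have e1 : gridFun Δx Δt U k s = w n := by ext y; simp only [gridFun, hfl n s hs, w]
      have e2 : P.velocity (gridFun Δx Δt U) k s = Vn n := by
        ext y; simp only [LaneModel.velocity, e1, Vn, stepVelocity, w]
      simp only [e1, e2]; ring
  have s4 := integral_slabs (f := fun z => Real.sign (gridFun Δx Δt U k z.1 z.2 - α)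
      * P.sourceTerm (gridFun Δx Δt U) k z.1 z.2 * (p z.2 * q z.1))
    (a := fun n x => Real.sign (w n x - α) * stepSource P Δx (U n) k x * p x) (b := q)
    ht.le M i4 hq.continuous fun n s hs x => by
      have e1 : ∀ j, gridFun Δx Δt U j s = stepFun Δx (U n j) := fun j => by
        ext y; simp only [gridFun, hfl n s hs]
      simp only [LaneModel.sourceTerm, e1, stepSource, w]; ring
  have eI : ∀ n, (∫ x, P.G k (w n x) α * Vn n x * deriv p x)
      - (∫ x, Real.sign (w n x - α) * P.f k α * deriv (Vn n) x * p x)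
      + (∫ x, Real.sign (w n x - α) * stepSource P Δx (U n) k x * p x) =
      (∫ x, entropyFlux (P.f k) α (w n x) * (Vn n x * deriv p x))
        - ∫ x, sourceDensity P Δx α (U n) k x * p x := fun n => by
    have h0 := integral_mul_deriv_add_deriv_mul_eq_zero (H.stepVelocity_lipschitz (hU n) k) hp hs
    have hd : ∀ x, sourceDensity P Δx α (U n) k x * p x =
        entropyWeight (P.f k) α (w n x) * (deriv (Vn n) x * p x)
          - Real.sign (w n x - α) * stepSource P Δx (U n) k x * p x := fun x => by
      simp only [sourceDensity, w, Vn]; ring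
    simp only [eG, eV, hd]
    rw [integral_add (i2 n) ((i2' n).const_mul _), integral_sub (i3 n) ((i3' n).const_mul _),
      integral_sub (i3 n) (i4 n), integral_const_mul, integral_const_mul]
    linear_combination (P.f k α) * h0
  have eq' : ∀ n : ℕ, ∫ s in (n * Δt)..((n + 1) * Δt), deriv q s =
      q ((n + 1 : ℕ) * Δt) - q (n * Δt) := fun n => by
    rw [intervalIntegral.integral_deriv_eq_sub (fun z _ => hq.differentiable one_ne_zero z)
      (hq'.intervalIntegrable _ _)]
    push_cast
    rfl
  have hab := sum_time_abel (fun n : ℕ => q (n * Δt)) (fun n => ∫ x, |w n x - α| * p x) M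
  have b1 : ∫ x, |gridFun Δx Δt U k (M * Δt) x - α| * (p x * q (M * Δt)) =
      (∫ x, |w M x - α| * p x) * q (M * Δt) := by
    rw [hgrid, ← integral_mul_const]
    simp only [mul_assoc]
  have b0 : ∫ x, |gridFun Δx Δt U k 0 x - α| * (p x * q 0) =
      (∫ x, |w 0 x - α| * p x) * q 0 := by
    have := hgrid 0
    rw [Nat.cast_zero, zero_mul] at this
    rw [this, ← integral_mul_const]
    simp only [mul_assoc]
  rw [LaneModel.LambdaT, setIntegral_congr_set (QT_ae_eq _), setIntegral_congr_set (QT_ae_eq _),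
    setIntegral_congr_set (QT_ae_eq _), integral_add s1.1 s2.1, s1.2, s2.2, s3.2, s4.2, b1, b0]
  simp only [eq']
  rw [Nat.cast_zero, zero_mul] at hab
  have hsum : ∑ n ∈ Finset.range M, Q n * (∫ x, P.G k (w n x) α * Vn n x * deriv p x)
      - ∑ n ∈ Finset.range M, Q n * (∫ x, Real.sign (w n x - α) * P.f k α * deriv (Vn n) x * p x)
      + ∑ n ∈ Finset.range M, Q n *
        (∫ x, Real.sign (w n x - α) * stepSource P Δx (U n) k x * p x) =
      ∑ n ∈ Finset.range M, (Q n * (∫ x, entropyFlux (P.f k) α (w n x) * (Vn n x * deriv p x))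
        - Q n * ∫ x, sourceDensity P Δx α (U n) k x * p x) := by
    rw [← Finset.sum_sub_distrib, ← Finset.sum_add_distrib]
    refine Finset.sum_congr rfl fun n _ => ?_
    rw [← mul_sub, ← mul_sub, ← mul_add, eI]
  rw [Finset.sum_add_distrib, Finset.sum_sub_distrib]
  rw [Finset.sum_sub_distrib] at hsum
  linarith

end Regime

/-! ### Series over the cells. -/

section Summation

/-- The comparison is made on finite sums before passing to the limit, so the majorant need not be
summable. -/
lemma ofReal_le_tsum_of_hasSum {d b : ℤ → ℝ} {a : ℝ} (h : HasSum d a) (hd : ∀ i, d i ≤ b i) :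
    ENNReal.ofReal a ≤ ∑' i, ENNReal.ofReal (b i) := by
  have hfin : ∀ s : Finset ℤ, ENNReal.ofReal (∑ i ∈ s, d i) ≤ ∑' i, ENNReal.ofReal (b i) :=
    fun s => calc
      ENNReal.ofReal (∑ i ∈ s, d i) ≤ ∑ i ∈ s, ENNReal.ofReal (d i) :=
        Finset.le_sum_of_subadditive ENNReal.ofReal ENNReal.ofReal_zero.le
          (fun _ _ => ENNReal.ofReal_add_le) s d
      _ ≤ ∑ i ∈ s, ENNReal.ofReal (b i) :=
        Finset.sum_le_sum fun i _ => ENNReal.ofReal_le_ofReal (hd i)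
      _ ≤ _ := ENNReal.sum_le_tsum s
  exact le_of_tendsto (ENNReal.tendsto_ofReal h) (Filter.Eventually.of_forall hfin)

lemma hasSum_telescope {τ : ℤ → ℝ} (h : τ.support.Finite) :
    HasSum (fun i => τ (i + 1) - τ i) 0 := by
  have h1 : HasSum τ (∑' i, τ i) := (summable_of_hasFiniteSupport h).hasSum
  have h2 := (Equiv.addRight (1 : ℤ)).hasSum_iff.2 h1
  simpa using h2.sub h1

lemma finite_grid_support {p : ℝ → ℝ} (hs : HasCompactSupport p) {Δx : ℝ} (hΔ : 0 < Δx) :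
    {i : ℤ | p (((i : ℝ) - 1 / 2) * Δx) ≠ 0}.Finite := by
  obtain ⟨R, hR⟩ := hs.isCompact.isBounded.subset_closedBall 0
  refine (Set.finite_Icc (⌊-R / Δx⌋ - 1) (⌈R / Δx⌉ + 1)).subset fun i hi => ?_
  have := hR (subset_tsupport p hi)
  rw [Metric.mem_closedBall, dist_zero_right, Real.norm_eq_abs, abs_le] at this
  have h1 : (i : ℝ) - 1 / 2 ≤ R / Δx := (le_div_iff₀ hΔ).2 this.2
  have h2 : -R / Δx ≤ (i : ℝ) - 1 / 2 := (div_le_iff₀ hΔ).2 this.1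
  have h3 := Int.le_ceil (R / Δx)
  have h4 := Int.floor_le (-R / Δx)
  constructor
  · have : ((⌊-R / Δx⌋ - 1 : ℤ) : ℝ) ≤ i := by push_cast; linarith
    exact_mod_cast this
  · have : (i : ℝ) ≤ ((⌈R / Δx⌉ + 1 : ℤ) : ℝ) := by push_cast; linarith
    exact_mod_cast this

end Summation

namespace Regime

variable {N : ℕ} {P : LaneModel N} {β lam Δx : ℝ} {Nη : ℕ} {F V : Fin N → ℝ}
  {Fm D₁ D₂ D₁₁ D₂₁ D₂₂ κ S : ℝ}
  (H : Regime P β lam Δx Nη F V Fm D₁ D₂ D₁₁ D₂₁ D₂₂ κ S)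
include H

/-! ### Error estimates on one cell. -/

section CellEstimates

variable {U : Fin N → ℤ → ℝ} (hU : ∀ k i, U k i ∈ Icc (0 : ℝ) 1) (k : Fin N) {α : ℝ}
  (hα : α ∈ Icc (0 : ℝ) 1) {p : ℝ → ℝ} (hp : ContDiff ℝ 1 p) (hs : HasCompactSupport p)
  (hp0 : ∀ x, 0 ≤ p x)
include hU hα hp hs hp0

omit hU hα hs hp0 in
lemma abs_endpoint_sub_mean_le (i : ℤ) {x : ℝ}
    (hx : x ∈ Icc (((i : ℝ) - 1 / 2) * Δx) (((i : ℝ) + 1 / 2) * Δx)) :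
    |p x - (∫ x in cell Δx i, p x) / Δx| ≤
      ∫ x in (((i : ℝ) - 1 / 2) * Δx)..(((i : ℝ) + 1 / 2) * Δx), |deriv p x| := by
  have hΔ := H.Δx_pos
  have h := abs_length_mul_sub_integral_le hp hx
  rw [← setIntegral_cell hΔ p,
    show ((i : ℝ) + 1 / 2) * Δx - ((i : ℝ) - 1 / 2) * Δx = Δx by ring] at h
  have e : p x - (∫ x in cell Δx i, p x) / Δx = (Δx * p x - ∫ x in cell Δx i, p x) / Δx := by
    field_simp
  rw [e, abs_div, abs_of_pos hΔ, div_le_iff₀ hΔ]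
  linarith

omit hα in
lemma abs_integral_deriv_velocity_le (i : ℤ) :
    |∫ x in cell Δx i, deriv (stepVelocity P Δx U k) x * p x| ≤
      (D₁ + 2 * κ * D₂) * ∫ x in cell Δx i, p x := by
  rw [← integral_const_mul, ← Real.norm_eq_abs]
  refine norm_integral_le_of_norm_le
    ((hp.continuous.integrable_of_hasCompactSupport hs).integrableOn.const_mul _)
    (ae_of_all _ fun x => ?_)
  rw [norm_mul, Real.norm_of_nonneg (hp0 x)]
  exact mul_le_mul_of_nonneg_right (H.abs_deriv_stepVelocity_le hU k x) (hp0 x)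

omit hα hp0 in
-- The velocity jump across the cell is the integral of the derivative, so replacing `p` by its mean
-- costs only the oscillation of `p`.
lemma abs_integral_deriv_velocity_sub_le (i : ℤ) :
    |(∫ x in cell Δx i, deriv (stepVelocity P Δx U k) x * p x) - (∫ x in cell Δx i, p x) / Δx *
        (interfaceVelocity P Δx Nη k (U k) i - interfaceVelocity P Δx Nη k (U k) (i - 1))| ≤
      (D₁ + 2 * κ * D₂) * Δx *
        ∫ x in (((i : ℝ) - 1 / 2) * Δx)..(((i : ℝ) + 1 / 2) * Δx), |deriv p x| := by
  have hΔ := H.Δx_pos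
  have hlip := H.stepVelocity_lipschitz hU k
  set pm := (∫ x in cell Δx i, p x) / Δx
  set pd := ∫ x in (((i : ℝ) - 1 / 2) * Δx)..(((i : ℝ) + 1 / 2) * Δx), |deriv p x|
  have hd : IntegrableOn (deriv (stepVelocity P Δx U k)) (cell Δx i) := by
    refine Measure.integrableOn_of_bounded (M := D₁ + 2 * κ * D₂) (by simp [cell])
      (measurable_deriv _).aestronglyMeasurable
      (ae_of_all _ fun x => H.abs_deriv_stepVelocity_le hU k x)
  rw [← H.stepVelocity_right, ← H.stepVelocity_left, ← setIntegral_cell_deriv hlip hΔ,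
    ← integral_const_mul, ← integral_sub (H.integrable_deriv_velocity_mul hU k hp hs).integrableOn
      (hd.const_mul _), ← Real.norm_eq_abs]
  refine (norm_setIntegral_le_of_norm_le_const (C := (D₁ + 2 * κ * D₂) * pd) (by simp [cell])
    fun x hx => ?_).trans_eq ?_
  · rw [show deriv (stepVelocity P Δx U k) x * p x - pm * deriv (stepVelocity P Δx U k) x =
      deriv (stepVelocity P Δx U k) x * (p x - pm) by ring, norm_mul]
    exact mul_le_mul (H.abs_deriv_stepVelocity_le hU k x)
      (H.abs_endpoint_sub_mean_le hp i (Ico_subset_Icc_self hx)) (abs_nonneg _) H.speed_lip_nonneg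
  · rw [volume_real_cell hΔ]; ring

lemma abs_integral_sourceDensity_le (i : ℤ) :
    |∫ x in cell Δx i, sourceDensity P Δx α U k x * p x| ≤
      (2 * F k * (D₁ + 2 * κ * D₂) * U k i + 2 * S * totalDensity U i) *
        ∫ x in cell Δx i, p x := by
  rw [← integral_const_mul, ← Real.norm_eq_abs]
  refine norm_integral_le_of_norm_le
    ((hp.continuous.integrable_of_hasCompactSupport hs).integrableOn.const_mul _)
    ((ae_restrict_iff' (measurableSet_cell _ _)).2 (ae_of_all _ fun x hx => ?_))
  rw [norm_mul, Real.norm_of_nonneg (hp0 x)]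
  refine mul_le_mul_of_nonneg_right ?_ (hp0 x)
  rw [sourceDensity, stepFun_of_mem_cell H.Δx_pos _ hx]
  have h1 := entropyWeight_mem (H.f_lip k) (f_zero k) hα (H.F_nonneg k)
    (fun _ => H.f_nonneg k) (hU k i)
  refine (norm_sub_le _ _).trans (add_le_add ?_ ?_)
  · rw [norm_mul, Real.norm_of_nonneg h1.1]
    calc _ ≤ 2 * F k * U k i * (D₁ + 2 * κ * D₂) :=
          mul_le_mul h1.2 (H.abs_deriv_stepVelocity_le hU k x) (abs_nonneg _) (h1.1.trans h1.2)
      _ = _ := by ring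
  · rw [norm_mul]
    exact (mul_le_of_le_one_left (norm_nonneg _) (abs_sign_le _)).trans
      (H.stepSource_bound hU k hx)

/-- Compares the exact source of `U` with the one left by the entropy inequality, where sign and
weight come from `U` but velocities and numerical source from the preceding state `U'`. The gap
consists of the oscillation of `p`, the spatial discretization of the source, and differences
between the two states. -/
lemma abs_integral_sourceDensity_sub_le {U' : Fin N → ℤ → ℝ} (i : ℤ) :
    |(∫ x in cell Δx i, sourceDensity P Δx α U k x * p x)
      - (-((∫ x in cell Δx i, p x) / Δx * (-(entropyWeight (P.f k) α (U k i) *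
          (interfaceVelocity P Δx Nη k (U' k) i - interfaceVelocity P Δx Nη k (U' k) (i - 1)))
        + Δx * (Real.sign (U k i - α) * P.numSource Δx Nη U' k i))))| ≤
      2 * F k * U k i * ((D₁ + 2 * κ * D₂) * Δx *
        ∫ x in (((i : ℝ) - 1 / 2) * Δx)..(((i : ℝ) + 1 / 2) * Δx), |deriv p x|)
      + (2 * F k * (|(interfaceVelocity P Δx Nη k (U k) i
            - interfaceVelocity P Δx Nη k (U k) (i - 1)) - (interfaceVelocity P Δx Nη k (U' k) i
            - interfaceVelocity P Δx Nη k (U' k) (i - 1))| / Δx)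
          + 8 * Fm * (2 * (D₁ + 2 * κ * D₂) * Δx) * totalDensity U i
          + |P.numSource Δx Nη U k i - P.numSource Δx Nη U' k i|) * ∫ x in cell Δx i, p x := by
  have hΔ := H.Δx_pos
  have h1 := entropyWeight_mem (H.f_lip k) (f_zero k) hα (H.F_nonneg k)
    (fun _ => H.f_nonneg k) (hU k i)
  have hpi : IntegrableOn p (cell Δx i) :=
    (hp.continuous.integrable_of_hasCompactSupport hs).integrableOn
  have hP0 : 0 ≤ ∫ x in cell Δx i, p x := integral_nonneg hp0
  have hsplit : ∫ x in cell Δx i, sourceDensity P Δx α U k x * p x =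
      entropyWeight (P.f k) α (U k i) * (∫ x in cell Δx i, deriv (stepVelocity P Δx U k) x * p x)
      - Real.sign (U k i - α) * ((∫ x in cell Δx i, (stepSource P Δx U k x
          - P.numSource Δx Nη U k i) * p x)
        + P.numSource Δx Nη U k i * ∫ x in cell Δx i, p x) := by
    have hR : IntegrableOn (fun x => (stepSource P Δx U k x - P.numSource Δx Nη U k i) * p x)
        (cell Δx i) := by
      refine (integrable_bdd_mul_test (C := 2 * S * N + |P.numSource Δx Nη U k i|)
        ((H.measurable_stepSource hU k).sub_const _) (fun x => ?_) hp.continuous hs).integrableOn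
      exact (abs_sub _ _).trans (add_le_add (H.abs_stepSource_le hU k x) le_rfl)
    have hR' : IntegrableOn (fun x => (stepSource P Δx U k x - P.numSource Δx Nη U k i) * p x
        + P.numSource Δx Nη U k i * p x) (cell Δx i) := hR.add (hpi.const_mul _)
    rw [← integral_const_mul, ← integral_const_mul, ← integral_add hR (hpi.const_mul _),
      ← integral_const_mul, ← integral_sub
        ((H.integrable_deriv_velocity_mul hU k hp hs).integrableOn.const_mul _)
        (hR'.const_mul _)]
    refine setIntegral_congr_fun (measurableSet_cell _ _) fun x hx => ?_
    simp only [sourceDensity, stepFun_of_mem_cell hΔ _ hx]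
    ring
  have hRsub : |∫ x in cell Δx i, (stepSource P Δx U k x - P.numSource Δx Nη U k i) * p x| ≤
      8 * Fm * (2 * (D₁ + 2 * κ * D₂) * Δx) * totalDensity U i * ∫ x in cell Δx i, p x := by
    rw [← integral_const_mul, ← Real.norm_eq_abs]
    refine norm_integral_le_of_norm_le (hpi.const_mul _)
      ((ae_restrict_iff' (measurableSet_cell _ _)).2 (ae_of_all _ fun x hx => ?_))
    rw [norm_mul, Real.norm_of_nonneg (hp0 x)]
    exact mul_le_mul_of_nonneg_right (H.abs_stepSource_sub_numSource_le hU k hx) (hp0 x)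
  have hI := H.abs_integral_deriv_velocity_sub_le hU k hp hs i
  rw [hsplit]
  set I := ∫ x in cell Δx i, deriv (stepVelocity P Δx U k) x * p x
  set J := ∫ x in cell Δx i, (stepSource P Δx U k x - P.numSource Δx Nη U k i) * p x
  set Pc := ∫ x in cell Δx i, p x
  set pd := ∫ x in (((i : ℝ) - 1 / 2) * Δx)..(((i : ℝ) + 1 / 2) * Δx), |deriv p x|
  set σ := entropyWeight (P.f k) α (U k i)
  set s := Real.sign (U k i - α)
  set dν := interfaceVelocity P Δx Nη k (U k) i - interfaceVelocity P Δx Nη k (U k) (i - 1)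
  set dν' := interfaceVelocity P Δx Nη k (U' k) i - interfaceVelocity P Δx Nη k (U' k) (i - 1)
  set r := P.numSource Δx Nη U k i
  set r' := P.numSource Δx Nη U' k i
  have hσ2 : σ ≤ 2 * F k := h1.2.trans
    (mul_le_of_le_one_right (mul_nonneg zero_le_two (H.F_nonneg k)) (hU k i).2)
  have hs1 : |s| ≤ 1 := abs_sign_le _
  have e : σ * I - s * (J + r * Pc) - (-(Pc / Δx * (-(σ * dν') + Δx * (s * r')))) =
      σ * (I - Pc / Δx * dν) + σ * ((dν - dν') / Δx) * Pc + (-(s * J) + -(s * (r - r') * Pc)) := by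
    field_simp
    ring
  rw [e]
  have b1 : |σ * (I - Pc / Δx * dν)| ≤ 2 * F k * U k i * ((D₁ + 2 * κ * D₂) * Δx * pd) := by
    rw [abs_mul, abs_of_nonneg h1.1]
    exact mul_le_mul h1.2 hI (abs_nonneg _) (h1.1.trans h1.2)
  have b2 : |σ * ((dν - dν') / Δx) * Pc| ≤ 2 * F k * (|dν - dν'| / Δx) * Pc := by
    rw [abs_mul, abs_mul, abs_of_nonneg h1.1, abs_of_nonneg hP0, abs_div, abs_of_pos hΔ]
    gcongr
  have b3 : |-(s * J)| ≤ 8 * Fm * (2 * (D₁ + 2 * κ * D₂) * Δx) * totalDensity U i * Pc := by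
    rw [abs_neg, abs_mul]
    exact (mul_le_of_le_one_left (abs_nonneg _) hs1).trans hRsub
  have b4 : |-(s * (r - r') * Pc)| ≤ |r - r'| * Pc := by
    rw [abs_neg, abs_mul, abs_mul, abs_of_nonneg hP0]
    exact mul_le_mul_of_nonneg_right (mul_le_of_le_one_left (abs_nonneg _) hs1) hP0
  refine (abs_add_three _ _ _).trans ?_
  have b5 := abs_add_le (-(s * J)) (-(s * (r - r') * Pc))
  linarith

end CellEstimates

/-! ### The cell-by-cell bound of the entropy functional. -/

/-- The relative entropy of a trajectory of the scheme against a separated test function is bounded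
by a sum over all cells of error weights times local moduli of the test function. -/
lemma ofReal_neg_lambdaT_le {U : ℕ → Fin N → ℤ → ℝ} (hU : ∀ n k i, U n k i ∈ Icc (0 : ℝ) 1)
    (hmarch : ∀ n, U (n + 1) = march P β lam Δx Nη (U n)) (k : Fin N)
    {α : ℝ} (hα : α ∈ Icc (0 : ℝ) 1) {p q : ℝ → ℝ} (hp : ContDiff ℝ 1 p)
    (hs : HasCompactSupport p) (hp0 : ∀ x, 0 ≤ p x) (hq : ContDiff ℝ 1 q) (hq0 : ∀ t, 0 ≤ q t)
    (M : ℕ) {a b c z w : ℕ → ℤ → ℝ}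
    (ha : ∀ n i, 1 / 2 * (V k * F k + β / lam) *
        (|U n k (i + 1) - U n k i| + |U n k i - U n k (i - 1)|)
      + (D₁ + 2 * κ * D₂) * Δx * F k * U n k i
      + 2 * F k * U (n + 1) k i * ((D₁ + 2 * κ * D₂) * Δx) ≤ a n i)
    (hb : ∀ n i, V k * F k * |U n k (i + 1) - U n k i| ≤ b n i)
    (hw : ∀ n i, 2 * F k * (D₁ + 2 * κ * D₂) * U n k i + 2 * S * totalDensity (U n) i ≤ w n i)
    (hc : ∀ n i, (D₁ + 2 * κ * D₂) * F k * U n k i + 2 * w n i ≤ c n i)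
    (hz : ∀ n i, 2 * F k * (|(interfaceVelocity P Δx Nη k (U (n + 1) k) i
            - interfaceVelocity P Δx Nη k (U (n + 1) k) (i - 1))
            - (interfaceVelocity P Δx Nη k (U n k) i
            - interfaceVelocity P Δx Nη k (U n k) (i - 1))| / Δx)
          + 8 * Fm * (2 * (D₁ + 2 * κ * D₂) * Δx) * totalDensity (U (n + 1)) i
          + |P.numSource Δx Nη (U (n + 1)) k i - P.numSource Δx Nη (U n) k i| ≤ z n i) :
    ENNReal.ofReal (-P.LambdaT (M * (lam * Δx)) k (gridFun Δx (lam * Δx) U)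
        (fun t x => p x * q t) α) ≤
      ∑' i : ℤ, ENNReal.ofReal (∑ n ∈ Finset.range M, lam * Δx *
        (q ((n + 1 : ℕ) * (lam * Δx)) *
            (∫ x in (((i : ℝ) - 1 / 2) * Δx)..(((i : ℝ) + 1 / 2) * Δx), |deriv p x|) * a n i
          + (∫ s in (n * (lam * Δx))..((n + 1) * (lam * Δx)), |deriv q s|) *
              p (((i : ℝ) + 1 / 2) * Δx) * b n i
          + (∫ s in (n * (lam * Δx))..((n + 1) * (lam * Δx)), |deriv q s|) *
              (∫ x in cell Δx i, p x) * c n i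
          + q ((n + 1 : ℕ) * (lam * Δx)) * (∫ x in cell Δx i, p x) * z n i)
        + lam * Δx * (q 0 * (∫ x in cell Δx i, p x) * w 0 i
          + q (M * (lam * Δx)) * (∫ x in cell Δx i, p x) * w M i)) := by
  have hΔ := H.Δx_pos
  have hlam := H.lam_pos
  have hβ := H.β_pos
  set t := lam * Δx with ht_def
  have ht : 0 < t := mul_pos hlam hΔ
  set qn : ℕ → ℝ := fun n => q (n * t) with hqn
  set qd : ℕ → ℝ := fun n => ∫ s in (n * t)..((n + 1) * t), |deriv q s| with hqd
  set Q : ℕ → ℝ := fun n => ∫ s in (n * t)..((n + 1) * t), q s with hQ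
  set pl : ℤ → ℝ := fun i => p (((i : ℝ) - 1 / 2) * Δx) with hpl
  set Pc : ℤ → ℝ := fun i => ∫ x in cell Δx i, p x with hPc
  set pd : ℤ → ℝ := fun i => ∫ x in (((i : ℝ) - 1 / 2) * Δx)..(((i : ℝ) + 1 / 2) * Δx),
    |deriv p x| with hpd
  have hpl_succ : ∀ i, pl (i + 1) = p (((i : ℝ) + 1 / 2) * Δx) := fun i => by
    simp only [hpl]; congr 1; push_cast; ring
  set iv : ℕ → ℤ → ℝ := fun n i => interfaceVelocity P Δx Nη k (U n k) i with hiv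
  set γ : ℕ → ℤ → ℝ := fun n i => entropyFlux (P.f k) α (U n k i) with hγ
  set e : ℕ → ℤ → ℝ := fun n i => |U n k i - α| with he
  set W : ℤ → ℕ → ℝ := fun i n => ∫ x in cell Δx i, sourceDensity P Δx α (U n) k x * p x with hW
  set I : ℕ → ℤ → ℝ := fun n i => ∫ x in cell Δx i, deriv (stepVelocity P Δx (U n) k) x * p x
    with hI
  set σs : ℕ → ℤ → ℝ := fun n i =>
    -(entropyWeight (P.f k) α (U (n + 1) k i) * (iv n i - iv n (i - 1)))
      + Δx * (Real.sign (U (n + 1) k i - α) * P.numSource Δx Nη (U n) k i) with hσs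
  -- The combined flux through the left interface: its forward difference in `i` is the telescoping
  -- part of `cell_flux_le`, and it vanishes where `p` does.
  set tele : ℕ → ℤ → ℝ := fun n i => t * qn (n + 1) *
      (-(1 / 2 * (iv n (i - 1) * pl i) * (γ n i + γ n (i - 1)))
        + β / (2 * lam) * pl i * (e n i - e n (i - 1)))
    + (t * qn (n + 1) - Q n) * (γ n i * (iv n (i - 1) * pl i)) with htele
  have hP0 : ∀ i, 0 ≤ Pc i := fun i => integral_nonneg hp0
  have hpd0 : ∀ i, 0 ≤ pd i := fun i =>
    intervalIntegral.integral_nonneg (cell_le Δx hΔ i) fun _ _ => abs_nonneg _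
  have hslab : ∀ n : ℕ, (n : ℝ) * t ≤ (n + 1) * t := fun n => by gcongr; linarith
  have hqd0 : ∀ n, 0 ≤ qd n := fun n =>
    intervalIntegral.integral_nonneg (hslab n) fun _ _ => abs_nonneg _
  have hqn0 : ∀ n, 0 ≤ qn n := fun n => hq0 _
  have hQqd : ∀ n, |t * qn (n + 1) - Q n| ≤ t * qd n := fun n => by
    have := abs_length_mul_sub_integral_le hq (right_mem_Icc.2 (hslab n))
    rw [show ((n : ℝ) + 1) * t - n * t = t by ring] at this
    simpa only [hqn, hQ, hqd, Nat.cast_add, Nat.cast_one] using this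
  have hqqd : ∀ n, |qn (n + 1) - qn n| ≤ qd n := fun n => by
    have := abs_sub_le_integral_abs_deriv hq (right_mem_Icc.2 (hslab n))
      (left_mem_Icc.2 (hslab n))
    simpa only [hqn, hqd, Nat.cast_add, Nat.cast_one] using this
  have hF := H.F_nonneg k
  have hLV := H.speed_lip_nonneg
  -- the series of the cell contributions
  have hsum : HasSum (fun i => ∑ n ∈ Finset.range M,
      (qn (n + 1) * ((e (n + 1) i - e n i) * Pc i)
        - Q n * (γ n i * (iv n i * pl (i + 1) - iv n (i - 1) * pl i) - γ n i * I n i)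
        + Q n * W i n))
      (-P.LambdaT (M * t) k (gridFun Δx t U) (fun t x => p x * q t) α) := by
    rw [H.neg_lambdaT_eq hU k hα hp hs hq ht M]
    refine hasSum_sum fun n _ => ?_
    have hE : ∀ n, HasSum (fun i => e n i * Pc i) (∫ x, |stepFun Δx (U n k) x - α| * p x) :=
      fun n => by
        refine (hasSum_setIntegral_cell hΔ (integrable_entropy (hU n) k hα hp hs)).congr_fun ?_
        intro i
        simp only [he, hPc]
        rw [← integral_const_mul]
        exact setIntegral_congr_fun (measurableSet_cell _ _) fun x hx => by
          simp only [stepFun_of_mem_cell hΔ _ hx]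
    have hX : HasSum (fun i => γ n i * (iv n i * pl (i + 1) - iv n (i - 1) * pl i) - γ n i * I n i)
        (∫ x, entropyFlux (P.f k) α (stepFun Δx (U n k) x) *
              (stepVelocity P Δx (U n) k x * deriv p x)) := by
      refine (hasSum_setIntegral_cell hΔ (H.integrable_flux (hU n) k hα hp hs)).congr_fun ?_
      intro i
      have h1 := setIntegral_cell_mul_deriv (H.stepVelocity_lipschitz (hU n) k) hp hΔ i
      rw [H.stepVelocity_right, H.stepVelocity_left, ← hpl_succ] at h1
      have h2 : ∫ x in cell Δx i, entropyFlux (P.f k) α (stepFun Δx (U n k) x) *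
          (stepVelocity P Δx (U n) k x * deriv p x) =
          γ n i * ∫ x in cell Δx i, stepVelocity P Δx (U n) k x * deriv p x := by
        rw [← integral_const_mul]
        exact setIntegral_congr_fun (measurableSet_cell _ _) fun x hx => by
          simp only [stepFun_of_mem_cell hΔ _ hx, hγ]
      rw [h2, h1]
      simp only [hI, hiv, hpl]
      ring
    have hWs : HasSum (fun i => W i n) (∫ x, sourceDensity P Δx α (U n) k x * p x) := by
      refine hasSum_setIntegral_cell hΔ ?_
      refine ((H.integrable_weight_deriv (hU n) k hα hp hs).sub
        (H.integrable_source (α := α) (hU n) k hp hs)).congr (ae_of_all _ fun x => ?_)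
      simp only [Pi.sub_apply, sourceDensity]
      ring
    have h1 := (((hE (n + 1)).sub (hE n)).mul_left (qn (n + 1))).sub (hX.mul_left (Q n))
    refine (h1.add (hWs.mul_left (Q n))).congr_fun fun i => ?_
    ring
  have htfin : (fun i => ∑ n ∈ Finset.range M, tele n i).support.Finite := by
    refine (finite_grid_support hs hΔ).subset fun i hi => ?_
    by_contra h0
    have h0' : pl i = 0 := not_not.1 h0
    refine hi (Finset.sum_eq_zero fun n _ => ?_)
    simp only [htele, h0']
    ring
  have hdiff := hsum.sub (hasSum_telescope htfin)
  rw [sub_zero] at hdiff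
  refine ofReal_le_tsum_of_hasSum hdiff fun i => ?_
  rw [← hpl_succ]
  -- one cell at all times
  have hcell : ∀ n ∈ Finset.range M,
      qn (n + 1) * ((e (n + 1) i - e n i) * Pc i)
        - Q n * (γ n i * (iv n i * pl (i + 1) - iv n (i - 1) * pl i) - γ n i * I n i)
        + Q n * W i n ≤ (tele n (i + 1) - tele n i)
      + (t * (qn (n + 1) * pd i * (1 / 2 * (V k * F k + β / lam) *
          (|U n k (i + 1) - U n k i| + |U n k i - U n k (i - 1)|)
            + (D₁ + 2 * κ * D₂) * Δx * F k * U n k i))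
        + t * (qd n * pl (i + 1) * (V k * F k * |U n k (i + 1) - U n k i|))
        + t * (qd n * Pc i * ((D₁ + 2 * κ * D₂) * F k * U n k i)))
      + (Q n * W i n - t * qn (n + 1) * (-(Pc i / Δx * σs n i))) := fun n _ => by
    have hΔP : Δx * (Pc i / Δx) = Pc i := by field_simp
    have hdr := H.abs_endpoint_sub_mean_le hp i (right_mem_Icc.2 (cell_le Δx hΔ i))
    have hdl := H.abs_endpoint_sub_mean_le hp i (left_mem_Icc.2 (cell_le Δx hΔ i))
    rw [← hpl_succ] at hdr
    have hI1 := H.abs_integral_deriv_velocity_sub_le (hU n) k hp hs i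
    have hI2 := H.abs_integral_deriv_velocity_le (hU n) k hp hs hp0 i
    have ab : ∀ x y : ℝ, |(|x - α| - |y - α|)| ≤ |x - y| := fun x y => by
      have := abs_abs_sub_abs_le (x - α) (y - α)
      rwa [sub_sub_sub_cancel_right] at this
    have hS0 : 0 ≤ 2 * (lam * Δx) * S := mul_nonneg (mul_nonneg zero_le_two ht.le) H.S_nonneg
    have hent := cell_entropy (H.f_lip k) hα hF hlam
      (H.interfaceVelocity_mem (hU n) k (i - 1)) (H.interfaceVelocity_mem (hU n) k i)
      (H.cfl_side k) (by have := H.cfl k; linarith) (hU n k (i - 1)) (hU n k i) (hU n k (i + 1))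
      (b' := U (n + 1) k i) (t := lam * Δx) (R := P.numSource Δx Nη (U n) k i)
      (by rw [hmarch, march])
    have key := cell_flux_le (lam := lam) (Δx := Δx) (β := β) (F := F k) (V := V k)
      (LV := D₁ + 2 * κ * D₂) (q' := qn (n + 1)) (qd := qd n) (Q := Q n) (pl := pl i)
      (pr := pl (i + 1)) (pm := Pc i / Δx) (pd := pd i) (νl := iv n (i - 1)) (νr := iv n i)
      (γl := γ n (i - 1)) (γ := γ n i) (γr := γ n (i + 1)) (ηl := e n (i - 1)) (η := e n i)
      (ηr := e n (i + 1)) (η' := e (n + 1) i) (u := U n k i) (dl := |U n k i - U n k (i - 1)|)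
      (dr := |U n k (i + 1) - U n k i|) (σs := σs n i) (I := I n i) (W := W i n)
      hlam hΔ hβ.le (hqn0 _) (div_nonneg (hP0 i) hΔ.le) (hp0 _) (hQqd n) hdr hdl
      (H.interfaceVelocity_mem (hU n) k (i - 1)) (H.interfaceVelocity_mem (hU n) k i)
      (abs_entropyFlux_sub_le (H.f_lip k) hα (hU n k (i + 1)) (hU n k i))
      (abs_entropyFlux_sub_le (H.f_lip k) hα (hU n k i) (hU n k (i - 1)))
      (abs_entropyFlux_le (H.f_lip k) (f_zero k) hα (hU n k i)) (ab _ _) (ab _ _) hI1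
      (by rw [hΔP]; exact hI2) (hent.trans_eq (by simp only [hσs, hγ, he, hiv]; ring))
    rw [hΔP] at key
    refine key.trans_eq ?_
    simp only [htele, add_sub_cancel_right, ht_def]
    ring
  -- `Z m` has the signs of level `m` and the velocities of level `m - 1`. Truncated subtraction at
  -- `m = 0` is harmless, since only `Z (n + 1)` occurs.
  have htime := time_shift_le ht.le (q := qn) (qd := qd) (Q := Q) (Y := W i)
    (Z := fun m => -(Pc i / Δx * σs (m - 1) i)) M hqn0 (fun n _ => hQqd n) (fun n _ => hqqd n)
  simp only [Nat.add_sub_cancel] at htime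
  have hWw : ∀ n, |W i n| ≤ w n i * Pc i := fun n =>
    (H.abs_integral_sourceDensity_le (hU n) k hα hp hs hp0 i).trans
      (mul_le_mul_of_nonneg_right (hw n i) (hP0 i))
  have hWZ : ∀ n, |W i (n + 1) - -(Pc i / Δx * σs n i)| ≤
      2 * F k * U (n + 1) k i * ((D₁ + 2 * κ * D₂) * Δx * pd i) + z n i * Pc i := fun n =>
    (H.abs_integral_sourceDensity_sub_le (hU (n + 1)) k hα hp hs hp0 (U' := U n) i).trans
      (add_le_add le_rfl (mul_le_mul_of_nonneg_right (hz n i) (hP0 i)))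
  have hq0' : qn 0 = q 0 := by simp [hqn]
  rw [sub_le_iff_le_add']
  refine (Finset.sum_le_sum hcell).trans ?_
  rw [Finset.sum_add_distrib, Finset.sum_add_distrib, Finset.sum_sub_distrib]
  have hfin : ∑ n ∈ Finset.range M,
      (t * (qn (n + 1) * pd i * (1 / 2 * (V k * F k + β / lam) *
          (|U n k (i + 1) - U n k i| + |U n k i - U n k (i - 1)|)
            + (D₁ + 2 * κ * D₂) * Δx * F k * U n k i))
        + t * (qd n * pl (i + 1) * (V k * F k * |U n k (i + 1) - U n k i|))
        + t * (qd n * Pc i * ((D₁ + 2 * κ * D₂) * F k * U n k i)))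
      + ∑ n ∈ Finset.range M, (2 * t * qd n * |W i n|
        + t * qn (n + 1) * |W i (n + 1) - -(Pc i / Δx * σs n i)|) ≤
      ∑ n ∈ Finset.range M, t * (qn (n + 1) * pd i * a n i + qd n * pl (i + 1) * b n i
        + qd n * Pc i * c n i + qn (n + 1) * Pc i * z n i) := by
    rw [← Finset.sum_add_distrib]
    refine Finset.sum_le_sum fun n _ => ?_
    have g1 := mul_le_mul_of_nonneg_left (ha n i) (mul_nonneg (hqn0 (n + 1)) (hpd0 i))
    have g2 := mul_le_mul_of_nonneg_left (hb n i) (mul_nonneg (hqd0 n) (hp0 ((((i + 1 : ℤ) : ℝ) - 1 / 2) * Δx)))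
    have g3 := mul_le_mul_of_nonneg_left (hc n i) (mul_nonneg (hqd0 n) (hP0 i))
    have g4 := mul_le_mul_of_nonneg_left (hWw n) (hqd0 n)
    have g5 := mul_le_mul_of_nonneg_left (hWZ n) (hqn0 (n + 1))
    have g2' : qd n * pl (i + 1) * (V k * F k * |U n k (i + 1) - U n k i|) ≤
      qd n * pl (i + 1) * b n i := g2
    have := mul_le_mul_of_nonneg_left (add_le_add (add_le_add g1 g2') (add_le_add g3
      (add_le_add (add_le_add g4 g4) g5))) ht.le
    linarith
  have hend : t * (qn 0 * |W i 0| + qn M * |W i M|) ≤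
      t * (q 0 * Pc i * w 0 i + qn M * Pc i * w M i) := by
    rw [hq0']
    have g1 := mul_le_mul_of_nonneg_left (hWw 0) (hq0 0)
    have g2 := mul_le_mul_of_nonneg_left (hWw M) (hqn0 M)
    have := mul_le_mul_of_nonneg_left (add_le_add g1 g2) ht.le
    linarith
  linarith

end Regime

/-! ### Averages over the centre of the mollifier. -/

/-- A family of functions on the plane whose positive parts have total integral at most `C`. -/
structure MeanLe (f : ℤ → ℝ × ℝ → ℝ) (C : ℝ) : Prop where
  nonneg : 0 ≤ C
  measurable : ∀ i, Measurable (f i)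
  le : ∫⁻ z, ∑' i, ENNReal.ofReal (f i z) ≤ ENNReal.ofReal C

namespace MeanLe

variable {f g : ℤ → ℝ × ℝ → ℝ} {C D : ℝ}

lemma add (hf : MeanLe f C) (hg : MeanLe g D) : MeanLe (fun i z => f i z + g i z) (C + D) where
  nonneg := add_nonneg hf.nonneg hg.nonneg
  measurable i := (hf.measurable i).add (hg.measurable i)
  le := calc
    _ ≤ ∫⁻ z, (∑' i, ENNReal.ofReal (f i z) + ∑' i, ENNReal.ofReal (g i z)) := by
      refine lintegral_mono fun z => ?_
      rw [← ENNReal.tsum_add]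
      exact ENNReal.tsum_le_tsum fun i => ENNReal.ofReal_add_le
    _ = (∫⁻ z, ∑' i, ENNReal.ofReal (f i z)) + ∫⁻ z, ∑' i, ENNReal.ofReal (g i z) :=
      lintegral_add_left (Measurable.tsum fun i => (hf.measurable i).ennreal_ofReal) _
    _ ≤ _ := by
      rw [ENNReal.ofReal_add hf.nonneg hg.nonneg]
      exact add_le_add hf.le hg.le

lemma const_mul (hf : MeanLe f C) {c : ℝ} (hc : 0 ≤ c) :
    MeanLe (fun i z => c * f i z) (c * C) where
  nonneg := mul_nonneg hc hf.nonneg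
  measurable i := (hf.measurable i).const_mul c
  le := by
    simp_rw [ENNReal.ofReal_mul hc, ENNReal.tsum_mul_left]
    rw [lintegral_const_mul' _ _ ENNReal.ofReal_ne_top]
    exact mul_le_mul_right hf.le _

lemma zero : MeanLe (fun _ _ => 0) 0 where
  nonneg := le_rfl
  measurable _ := measurable_const
  le := by simp

lemma sum {M : ℕ} {f : ℕ → ℤ → ℝ × ℝ → ℝ} (hf : ∀ n < M, MeanLe (f n) C) :
    MeanLe (fun i z => ∑ n ∈ Finset.range M, f n i z) (M * C) := by
  induction M with
  | zero => simpa using zero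
  | succ M ih =>
    simp only [Finset.sum_range_succ]
    have := (ih fun n hn => hf n (by omega)).add (hf M (by omega))
    rwa [show (M : ℝ) * C + C = ((M + 1 : ℕ) : ℝ) * C by push_cast; ring] at this

/-- By Tonelli: `X` and `Y i` depend on different variables, so a cell contributes at most `x y |a
i|`. -/
lemma of_mul {X : ℝ → ℝ} {Y : ℤ → ℝ → ℝ} {a : ℤ → ℝ} {x y A : ℝ} (hX : Continuous X)
    (hX0 : ∀ s, 0 ≤ X s) (hXx : ∫⁻ s, ENNReal.ofReal (X s) ≤ ENNReal.ofReal x) (hx : 0 ≤ x)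
    (hY : ∀ i, Continuous (Y i)) (hY0 : ∀ i s, 0 ≤ Y i s)
    (hYy : ∀ i, ∫⁻ s, ENNReal.ofReal (Y i s) ≤ ENNReal.ofReal y) (hy : 0 ≤ y)
    (ha : SumAbsLe a A) (ha0 : ∀ i, 0 ≤ a i) :
    MeanLe (fun i z => X z.1 * Y i z.2 * a i) (x * y * A) where
  nonneg := mul_nonneg (mul_nonneg hx hy) ha.nonneg
  measurable i := ((hX.measurable.comp measurable_fst).mul
    ((hY i).measurable.comp measurable_snd)).mul_const _
  le := by
    have hm : ∀ i, Measurable fun z : ℝ × ℝ => ENNReal.ofReal (X z.1 * Y i z.2 * a i) := fun i =>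
      (((hX.measurable.comp measurable_fst).mul
        ((hY i).measurable.comp measurable_snd)).mul_const _).ennreal_ofReal
    rw [lintegral_tsum fun i => (hm i).aemeasurable]
    calc
      _ ≤ ∑' i, ENNReal.ofReal x * ENNReal.ofReal y * ENNReal.ofReal |a i| := by
        refine ENNReal.tsum_le_tsum fun i => ?_
        have e : ∀ z : ℝ × ℝ, ENNReal.ofReal (X z.1 * Y i z.2 * a i) =
            ENNReal.ofReal (X z.1) * ENNReal.ofReal (Y i z.2) * ENNReal.ofReal |a i| := fun z => by
          rw [ENNReal.ofReal_mul (mul_nonneg (hX0 _) (hY0 _ _)), ENNReal.ofReal_mul (hX0 _),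
            abs_of_nonneg (ha0 i)]
        simp_rw [e]
        rw [lintegral_mul_const' _ _ ENNReal.ofReal_ne_top, Measure.volume_eq_prod,
          lintegral_prod_mul hX.measurable.ennreal_ofReal.aemeasurable
            (hY i).measurable.ennreal_ofReal.aemeasurable]
        gcongr
        exact hYy i
      _ = ENNReal.ofReal x * ENNReal.ofReal y * ∑' i, ENNReal.ofReal |a i| := ENNReal.tsum_mul_left
      _ ≤ ENNReal.ofReal x * ENNReal.ofReal y * ENNReal.ofReal A := by
        gcongr
        exact ha.tsum_ofReal_le
      _ = _ := by rw [← ENNReal.ofReal_mul hx, ← ENNReal.ofReal_mul (mul_nonneg hx hy)]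

end MeanLe

/-! ### Moments of the scaled mollifier. -/

section Mollifier

/-- A non-integrable function has integral zero, which `C ≥ 0` covers. Hence integrability of the
entropy functional in the centre need not be checked. -/
lemma integral_le_of_lintegral_ofReal_le {X : Type*} [MeasurableSpace X] {μ : Measure X} {f : X → ℝ}
    {C : ℝ} (hC : 0 ≤ C) (h : ∫⁻ x, ENNReal.ofReal (f x) ∂μ ≤ ENNReal.ofReal C) :
    ∫ x, f x ∂μ ≤ C := by
  by_cases hf : Integrable f μ
  · rw [integral_eq_lintegral_pos_part_sub_lintegral_neg_part hf]
    have := ENNReal.toReal_le_of_le_ofReal hC h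
    linarith [ENNReal.toReal_nonneg (a := ∫⁻ x, ENNReal.ofReal (-f x) ∂μ)]
  · rwa [integral_undef hf]

variable {Θ : ℝ → ℝ} (hΘ : IsMollifier Θ) {a : ℝ} (ha : 0 < a)
include hΘ

lemma IsMollifier.hasCompactSupport : HasCompactSupport Θ :=
  HasCompactSupport.of_support_subset_isCompact isCompact_Icc ((subset_tsupport Θ).trans hΘ.supp)

lemma scaled_contDiff : ContDiff ℝ 1 (scaled Θ a) :=
  contDiff_const.mul ((hΘ.smooth.of_le (by exact_mod_cast le_top)).comp (contDiff_id.div_const a))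

include ha

lemma scaled_nonneg (x : ℝ) : 0 ≤ scaled Θ a x :=
  mul_nonneg (by positivity) (hΘ.nonneg _)

lemma scaled_hasCompactSupport : HasCompactSupport (scaled Θ a) := by
  have h := hΘ.hasCompactSupport.comp_homeomorph (Homeomorph.mulRight₀ a⁻¹ (inv_ne_zero ha.ne'))
  exact h.mul_left (f := fun _ => 1 / a)

lemma integral_scaled : ∫ x, scaled Θ a x = 1 := by
  simp only [scaled]
  rw [integral_const_mul, Measure.integral_comp_div, hΘ.mass, abs_of_pos ha, smul_eq_mul, mul_one]
  field_simp

lemma integral_abs_deriv_scaled :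
    ∫ x, |deriv (scaled Θ a) x| = (∫ x, |deriv Θ x|) / a := by
  have e : ∀ x, |deriv (scaled Θ a) x| = 1 / a ^ 2 * |deriv Θ (x / a)| := fun x => by
    have hd : DifferentiableAt ℝ Θ (x / a) := hΘ.smooth.differentiable (by simp) _
    have h1 := (hd.hasDerivAt.comp x ((hasDerivAt_id x).div_const a)).const_mul (1 / a)
    have h2 : deriv (scaled Θ a) x = 1 / a * (deriv Θ (x / a) * (1 / a)) := h1.deriv
    rw [h2, abs_mul, abs_mul, abs_of_pos (by positivity : 0 < 1 / a)]
    field_simp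
  simp_rw [e]
  rw [integral_const_mul, Measure.integral_comp_div (fun x => |deriv Θ x|), abs_of_pos ha, smul_eq_mul]
  field_simp

omit hΘ ha in
lemma continuous_integral_translate {h : ℝ → ℝ} (hh : Continuous h) (b c : ℝ) :
    Continuous fun y => ∫ x in b..c, |h (x - y)| :=
  intervalIntegral.continuous_parametric_intervalIntegral_of_continuous'
    (f := fun y x => |h (x - y)|) (by fun_prop) b c

omit hΘ ha in
/-- Averages over translates. -/
lemma lintegral_integral_translate {h : ℝ → ℝ} (hh : Continuous h) (hs : HasCompactSupport h)
    {b c : ℝ} (hbc : b ≤ c) :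
    ∫⁻ y, ENNReal.ofReal (∫ x in b..c, |h (x - y)|) ≤
      ENNReal.ofReal ((c - b) * ∫ x, |h x|) := by
  have hi : Integrable fun x => |h x| := (hh.integrable_of_hasCompactSupport hs).abs
  have e : ∀ y, ENNReal.ofReal (∫ x in b..c, |h (x - y)|) =
      ∫⁻ x in Ioc b c, ENNReal.ofReal |h (x - y)| := fun y => by
    rw [intervalIntegral.integral_of_le hbc, ofReal_integral_eq_lintegral_ofReal]
    · exact (hi.comp_sub_right y).integrableOn
    · exact ae_of_all _ fun _ => abs_nonneg _
  simp_rw [e]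
  rw [lintegral_lintegral_swap (by
    have : Measurable fun z : ℝ × ℝ => ENNReal.ofReal |h (z.2 - z.1)| :=
      (by fun_prop : Continuous fun z : ℝ × ℝ => |h (z.2 - z.1)|).measurable.ennreal_ofReal
    exact this.aemeasurable)]
  have e2 : ∀ x, ∫⁻ y, ENNReal.ofReal |h (x - y)| = ENNReal.ofReal (∫ x, |h x|) := fun x => by
    rw [lintegral_sub_left_eq_self (fun y => ENNReal.ofReal |h y|) x,
      ofReal_integral_eq_lintegral_ofReal hi (ae_of_all _ fun _ => abs_nonneg _)]
  simp_rw [e2]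
  rw [setLIntegral_const, Real.volume_Ioc, mul_comm,
    ← ENNReal.ofReal_mul (sub_nonneg.2 hbc)]

lemma lintegral_scaled_translate (x : ℝ) :
    ∫⁻ y, ENNReal.ofReal (scaled Θ a (x - y)) ≤ ENNReal.ofReal 1 := by
  rw [lintegral_sub_left_eq_self (fun y => ENNReal.ofReal (scaled Θ a y)) x,
    ← ofReal_integral_eq_lintegral_ofReal ((scaled_contDiff hΘ).continuous.integrable_of_hasCompactSupport
      (scaled_hasCompactSupport hΘ ha)) (ae_of_all _ (scaled_nonneg hΘ ha)), integral_scaled hΘ ha]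

lemma lintegral_integral_scaled_translate {b c : ℝ} (hbc : b ≤ c) :
    ∫⁻ y, ENNReal.ofReal (∫ x in b..c, |scaled Θ a (x - y)|) ≤ ENNReal.ofReal (c - b) := by
  refine (lintegral_integral_translate (scaled_contDiff hΘ).continuous
    (scaled_hasCompactSupport hΘ ha) hbc).trans_eq ?_
  simp_rw [fun x => abs_of_nonneg (scaled_nonneg hΘ ha x)]
  rw [integral_scaled hΘ ha, mul_one]

lemma lintegral_integral_deriv_scaled_translate {b c : ℝ} (hbc : b ≤ c) :
    ∫⁻ y, ENNReal.ofReal (∫ x in b..c, |deriv (scaled Θ a) (x - y)|) ≤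
      ENNReal.ofReal ((c - b) * ((∫ x, |deriv Θ x|) / a)) := by
  rw [← integral_abs_deriv_scaled hΘ ha]
  exact lintegral_integral_translate ((scaled_contDiff hΘ).continuous_deriv le_rfl)
    (scaled_hasCompactSupport hΘ ha).deriv hbc

end Mollifier

namespace Regime

variable {N : ℕ} {P : LaneModel N} {β lam Δx : ℝ} {Nη : ℕ} {F V : Fin N → ℝ}
  {Fm D₁ D₂ D₁₁ D₂₁ D₂₂ κ S : ℝ}
  (H : Regime P β lam Δx Nη F V Fm D₁ D₂ D₁₁ D₂₁ D₂₂ κ S)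
include H

/-! ### Summability of the error weights. -/

section ErrorWeights

variable {U U' : Fin N → ℤ → ℝ} (hU : ∀ k i, U k i ∈ Icc (0 : ℝ) 1)
  (hU' : ∀ k i, U' k i ∈ Icc (0 : ℝ) 1) (k : Fin N) {μ y τ : ℝ}
include hU

omit hU in
-- CFL trades the sup norm of the velocity for `β/λ`, so that the final constant does not involve
-- `V`.
lemma velocity_mul_le : V k * F k ≤ β / lam := by
  rw [le_div_iff₀ H.lam_pos]
  linarith [H.cfl_side k]

lemma sumAbsLe_source_weight (hm : SumAbsLe (totalDensity U) (μ / Δx)) :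
    SumAbsLe (fun i => 2 * F k * (D₁ + 2 * κ * D₂) * U k i + 2 * S * totalDensity U i)
      ((2 * Fm * (D₁ + 2 * κ * D₂) + 2 * S) * (μ / Δx)) := by
  have hL := H.speed_lip_nonneg
  have hF := H.F_nonneg k
  have h1 := (sumAbsLe_lane hU hm k).const_mul
    (mul_nonneg (mul_nonneg zero_le_two hF) hL)
  have h2 := hm.const_mul (mul_nonneg zero_le_two H.S_nonneg)
  refine (h1.add h2).of_le ?_
  have := hm.nonneg
  have := H.F_le k
  rw [add_mul]
  gcongr

lemma sumAbsLe_time_weight (hm : SumAbsLe (totalDensity U) (μ / Δx)) :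
    SumAbsLe (fun i => (D₁ + 2 * κ * D₂) * F k * U k i
        + 2 * (2 * F k * (D₁ + 2 * κ * D₂) * U k i + 2 * S * totalDensity U i))
      ((5 * Fm * (D₁ + 2 * κ * D₂) + 4 * S) * (μ / Δx)) := by
  have hL := H.speed_lip_nonneg
  have hF := H.F_nonneg k
  have h1 := (sumAbsLe_lane hU hm k).const_mul (mul_nonneg hL hF)
  have h2 := (H.sumAbsLe_source_weight hU k hm).const_mul zero_le_two
  refine (h1.add h2).of_le ?_
  have := hm.nonneg
  calc
    _ ≤ (D₁ + 2 * κ * D₂) * Fm * (μ / Δx)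
        + 2 * ((2 * Fm * (D₁ + 2 * κ * D₂) + 2 * S) * (μ / Δx)) := by
      gcongr
      exact H.F_le k
    _ = _ := by ring

omit hU in
lemma sumAbsLe_jump_weight (hy : SumAbsLe (totalJump U) y) :
    SumAbsLe (fun i => V k * F k * |U k (i + 1) - U k i|) (β / lam * y) := by
  have h := ((sumAbsLe_jump hy k).const_mul (mul_nonneg (H.V_nonneg k) (H.F_nonneg k))).of_le
    (mul_le_mul_of_nonneg_right (H.velocity_mul_le k) hy.nonneg)
  exact h.mono fun i => by simp only [abs_mul, abs_abs, le_refl]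

include hU' in
lemma sumAbsLe_space_weight (hm : SumAbsLe (totalDensity U) (μ / Δx))
    (hm' : SumAbsLe (totalDensity U') (μ / Δx)) (hy : SumAbsLe (totalJump U) y) :
    SumAbsLe (fun i => 1 / 2 * (V k * F k + β / lam) *
        (|U k (i + 1) - U k i| + |U k i - U k (i - 1)|)
      + (D₁ + 2 * κ * D₂) * Δx * F k * U k i
      + 2 * F k * U' k i * ((D₁ + 2 * κ * D₂) * Δx))
      (2 * (β / lam) * y + 3 * Fm * (D₁ + 2 * κ * D₂) * μ) := by
  have hL := H.speed_lip_nonneg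
  have hF := H.F_nonneg k
  have hΔ := H.Δx_pos
  have hv := H.velocity_mul_le k
  have hv0 := mul_nonneg (H.V_nonneg k) hF
  have hβ : 0 ≤ β / lam := div_nonneg H.β_pos.le H.lam_pos.le
  have hj : SumAbsLe (fun i => |U k (i + 1) - U k i|) y :=
    (sumAbsLe_jump hy k).mono fun i => (abs_abs _).le
  have h0 := (hj.add (hj.shift (-1))).const_mul
    (c := 1 / 2 * (V k * F k + β / lam)) (by positivity)
  have h1 := (sumAbsLe_lane hU hm k).const_mul (mul_nonneg (mul_nonneg hL hΔ.le) hF)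
  have h2 := (sumAbsLe_lane hU' hm' k).const_mul
    (mul_nonneg (mul_nonneg zero_le_two hF) (mul_nonneg hL hΔ.le))
  refine (((h0.add h1).add h2).of_le ?_).mono fun i => ?_
  · have hm0 := hm.nonneg
    have e1 : (D₁ + 2 * κ * D₂) * Δx * F k * (μ / Δx) ≤ (D₁ + 2 * κ * D₂) * Δx * Fm * (μ / Δx) := by
      gcongr
      exact H.F_le k
    have e2 : 2 * F k * ((D₁ + 2 * κ * D₂) * Δx) * (μ / Δx) ≤
        2 * Fm * ((D₁ + 2 * κ * D₂) * Δx) * (μ / Δx) := by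
      gcongr
      exact H.F_le k
    have e3 : 1 / 2 * (V k * F k + β / lam) * (y + y) ≤ 1 / 2 * (β / lam + β / lam) * (y + y) := by
      have := hy.nonneg
      gcongr
    have e4 : (D₁ + 2 * κ * D₂) * Δx * Fm * (μ / Δx) = Fm * (D₁ + 2 * κ * D₂) * μ := by
      field_simp
    have e5 : 2 * Fm * ((D₁ + 2 * κ * D₂) * Δx) * (μ / Δx) = 2 * (Fm * (D₁ + 2 * κ * D₂) * μ) := by
      field_simp
    rw [e4] at e1
    rw [e5] at e2
    linarith
  · rw [show i + -1 + 1 = i by ring, ← sub_eq_add_neg]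
    apply le_of_eq
    congr 1
    ring

include hU' in
-- Dividing by `Δx` is harmless: the mixed velocity difference is `O(Δx τ)` in `ℓ¹`, with `Δx` from
-- the spatial difference and `τ` from the time increment.
lemma sumAbsLe_increment_weight (hm' : SumAbsLe (totalDensity U') (μ / Δx))
    (hτ : SumAbsLe (fun i => ∑ k, |U' k i - U k i|) τ) :
    SumAbsLe (fun i => 2 * F k * (|(interfaceVelocity P Δx Nη k (U' k) i
            - interfaceVelocity P Δx Nη k (U' k) (i - 1))
            - (interfaceVelocity P Δx Nη k (U k) i
            - interfaceVelocity P Δx Nη k (U k) (i - 1))| / Δx)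
          + 8 * Fm * (2 * (D₁ + 2 * κ * D₂) * Δx) * totalDensity U' i
          + |P.numSource Δx Nη U' k i - P.numSource Δx Nη U k i|)
      (2 * Fm * (D₂₁ + 4 * κ * D₂₂ + 2 * κ * D₂) * τ + 16 * Fm * (D₁ + 2 * κ * D₂) * μ
        + 8 * S * N * τ) := by
  have hL := H.speed_lip_nonneg
  have hF := H.F_nonneg k
  have hFm := H.Fm_nonneg
  have hΔ := H.Δx_pos
  have hκ := H.κ_nonneg
  have hD := H.D₂_nonneg
  have hD' := H.D₂₁_nonneg
  have hD'' := H.D₂₂_nonneg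
  have hlane : ∀ j, SumAbsLe (fun i => U' j i - U j i) τ := fun j => hτ.mono' fun i =>
    Finset.single_le_sum (f := fun k => |U' k i - U k i|) (fun _ _ => abs_nonneg _)
      (Finset.mem_univ j)
  have hτ0 := hτ.nonneg
  have hc : ∀ j, SumAbsLe (fun i => |P.cFull Δx Nη (fun i => U' j i - U j i) i|) τ := fun j =>
    (H.sumAbsLe_cFull (hlane j)).mono fun i => (abs_abs _).le
  have h1 := ((((H.sumAbsLe_cHalf (hlane k)).mono (a := fun i =>
    |P.cHalf Δx Nη (fun i => U' k i - U k i) i|) fun i => (abs_abs _).le).const_mul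
      (c := (D₂₁ + 4 * κ * D₂₂) * Δx) (by positivity)).add
    (((H.sumAbsLe_cHalf_sub (hlane k)).mono (a := fun i =>
    |P.cHalf Δx Nη (fun i => U' k i - U k i) i - P.cHalf Δx Nη (fun i => U' k i - U k i) (i - 1)|)
      fun i => (abs_abs _).le).const_mul hD)).const_mul (c := 2 * F k / Δx) (by positivity)
  have h2 := hm'.const_mul (c := 8 * Fm * (2 * (D₁ + 2 * κ * D₂) * Δx)) (by positivity)
  have h3 := (SumAbsLe.sum (t := Finset.univ) fun j (_ : j ∈ Finset.univ) =>
    ((hlane j).mono (a := fun i => |U' j i - U j i|) fun i => (abs_abs _).le).add (hc j)).const_mul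
      (c := 4 * S) (mul_nonneg (by norm_num) H.S_nonneg)
  refine (((h1.add h2).add h3).of_le ?_).mono' fun i => ?_
  · rw [Finset.sum_const, Finset.card_univ, Fintype.card_fin, nsmul_eq_mul]
    have e1 : 2 * F k / Δx * ((D₂₁ + 4 * κ * D₂₂) * Δx * τ + D₂ * (2 * κ * Δx * τ)) =
        2 * F k * ((D₂₁ + 4 * κ * D₂₂ + 2 * κ * D₂) * τ) := by
      field_simp
    have e2 : 8 * Fm * (2 * (D₁ + 2 * κ * D₂) * Δx) * (μ / Δx) =
        16 * Fm * (D₁ + 2 * κ * D₂) * μ := by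
      field_simp
      ring
    have e3 : 2 * F k * ((D₂₁ + 4 * κ * D₂₂ + 2 * κ * D₂) * τ) ≤
        2 * Fm * ((D₂₁ + 4 * κ * D₂₂ + 2 * κ * D₂) * τ) := by
      gcongr
      exact H.F_le k
    rw [e1, e2]
    linarith
  · have hd : 0 ≤ totalDensity U' i := Finset.sum_nonneg fun j _ => (hU' j i).1
    rw [abs_of_nonneg (by positivity)]
    refine add_le_add (add_le_add ?_ le_rfl) (H.abs_numSource_sub_le hU' hU k i)
    rw [mul_div_assoc', div_mul_eq_mul_div]
    gcongr
    exact H.abs_interfaceVelocity_mixed_difference_le k (hU' k) (hU k) i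

end ErrorWeights

end Regime

/-! ### Mean of all error terms. -/

section Moments

variable {Θ : ℝ → ℝ} (hΘ : IsMollifier Θ) {ε ε₀ h t : ℝ} (hε : 0 < ε) (hε₀ : 0 < ε₀)
  {a b c z : ℕ → ℤ → ℝ} {w : ℕ → ℤ → ℝ} {A B C Z W : ℝ} {M : ℕ}
include hΘ hε hε₀

/-- The mean over all centres `(s, y)` of the mollifier of the cellwise error terms. -/
lemma meanLe_errorTerms (hh : 0 < h) (ht : 0 ≤ t)
    (ha : ∀ n < M, SumAbsLe (a n) A) (ha0 : ∀ n i, 0 ≤ a n i)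
    (hb : ∀ n < M, SumAbsLe (b n) B) (hb0 : ∀ n i, 0 ≤ b n i)
    (hc : ∀ n < M, SumAbsLe (c n) C) (hc0 : ∀ n i, 0 ≤ c n i)
    (hz : ∀ n < M, SumAbsLe (z n) Z) (hz0 : ∀ n i, 0 ≤ z n i)
    (hw : ∀ n ≤ M, SumAbsLe (w n) W) (hw0 : ∀ n i, 0 ≤ w n i) :
    MeanLe (fun i x => ∑ n ∈ Finset.range M, t *
        (scaled Θ ε₀ ((n + 1 : ℕ) * t - x.1) *
            (∫ y in (((i : ℝ) - 1 / 2) * h)..(((i : ℝ) + 1 / 2) * h),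
              |deriv (scaled Θ ε) (y - x.2)|) * a n i
          + (∫ s in (n * t)..((n + 1) * t), |deriv (scaled Θ ε₀) (s - x.1)|) *
              scaled Θ ε (((i : ℝ) + 1 / 2) * h - x.2) * b n i
          + (∫ s in (n * t)..((n + 1) * t), |deriv (scaled Θ ε₀) (s - x.1)|) *
              (∫ y in (((i : ℝ) - 1 / 2) * h)..(((i : ℝ) + 1 / 2) * h),
                |scaled Θ ε (y - x.2)|) * c n i
          + scaled Θ ε₀ ((n + 1 : ℕ) * t - x.1) *
              (∫ y in (((i : ℝ) - 1 / 2) * h)..(((i : ℝ) + 1 / 2) * h),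
                |scaled Θ ε (y - x.2)|) * z n i)
        + t * (scaled Θ ε₀ (0 - x.1) *
              (∫ y in (((i : ℝ) - 1 / 2) * h)..(((i : ℝ) + 1 / 2) * h),
                |scaled Θ ε (y - x.2)|) * w 0 i
          + scaled Θ ε₀ (M * t - x.1) *
              (∫ y in (((i : ℝ) - 1 / 2) * h)..(((i : ℝ) + 1 / 2) * h),
                |scaled Θ ε (y - x.2)|) * w M i))
      (M * (t * (1 * (h * ((∫ x, |deriv Θ x|) / ε)) * A
          + t * ((∫ x, |deriv Θ x|) / ε₀) * 1 * B
          + t * ((∫ x, |deriv Θ x|) / ε₀) * h * C + 1 * h * Z))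
        + t * (1 * h * W + 1 * h * W)) := by
  have hθ : 0 ≤ ∫ x, |deriv Θ x| := integral_nonneg fun _ => abs_nonneg _
  have hcell : ∀ i : ℤ, ((i : ℝ) - 1 / 2) * h ≤ ((i : ℝ) + 1 / 2) * h := fun i => by
    gcongr; linarith
  have hslab : ∀ n : ℕ, (n : ℝ) * t ≤ (n + 1) * t := fun n => by gcongr; linarith
  have cs : ∀ {a : ℝ}, Continuous (scaled Θ a) := (scaled_contDiff hΘ).continuous
  have cd : ∀ {a : ℝ}, Continuous (deriv (scaled Θ a)) :=
    (scaled_contDiff hΘ).continuous_deriv le_rfl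
  -- moments in time
  have X1 : ∀ r, Continuous fun s => scaled Θ ε₀ (r - s) := fun r => cs.comp (by fun_prop)
  have X1n : ∀ r s, 0 ≤ scaled Θ ε₀ (r - s) := fun r s => scaled_nonneg hΘ hε₀ _
  have X1m := fun r => lintegral_scaled_translate hΘ hε₀ r
  have X2 : ∀ n : ℕ, Continuous fun s' =>
      ∫ s in (n * t)..((n + 1) * t), |deriv (scaled Θ ε₀) (s - s')| :=
    fun n => continuous_integral_translate cd _ _
  have X2n : ∀ (n : ℕ) s', 0 ≤ ∫ s in (n * t)..((n + 1) * t), |deriv (scaled Θ ε₀) (s - s')| :=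
    fun n s' => intervalIntegral.integral_nonneg (hslab n) fun _ _ => abs_nonneg _
  have X2m : ∀ n : ℕ, _ := fun n => lintegral_integral_deriv_scaled_translate hΘ hε₀ (hslab n)
  have et : ∀ n : ℕ, ((n : ℝ) + 1) * t - n * t = t := fun n => by ring
  simp_rw [et] at X2m
  -- moments in space
  have Y1 : ∀ i : ℤ, Continuous fun y' =>
      ∫ y in (((i : ℝ) - 1 / 2) * h)..(((i : ℝ) + 1 / 2) * h), |deriv (scaled Θ ε) (y - y')| :=
    fun i => continuous_integral_translate cd _ _
  have Y1n : ∀ (i : ℤ) y', 0 ≤ ∫ y in (((i : ℝ) - 1 / 2) * h)..(((i : ℝ) + 1 / 2) * h),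
      |deriv (scaled Θ ε) (y - y')| :=
    fun i y' => intervalIntegral.integral_nonneg (hcell i) fun _ _ => abs_nonneg _
  have Y1m : ∀ i : ℤ, _ := fun i => lintegral_integral_deriv_scaled_translate hΘ hε (hcell i)
  have Y2 : ∀ i : ℤ, Continuous fun y' => scaled Θ ε (((i : ℝ) + 1 / 2) * h - y') :=
    fun i => cs.comp (by fun_prop)
  have Y2n : ∀ (i : ℤ) y', 0 ≤ scaled Θ ε (((i : ℝ) + 1 / 2) * h - y') :=
    fun i y' => scaled_nonneg hΘ hε _
  have Y2m : ∀ i : ℤ, _ := fun i => lintegral_scaled_translate hΘ hε (((i : ℝ) + 1 / 2) * h)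
  have Y3 : ∀ i : ℤ, Continuous fun y' =>
      ∫ y in (((i : ℝ) - 1 / 2) * h)..(((i : ℝ) + 1 / 2) * h), |scaled Θ ε (y - y')| :=
    fun i => continuous_integral_translate cs _ _
  have Y3n : ∀ (i : ℤ) y', 0 ≤ ∫ y in (((i : ℝ) - 1 / 2) * h)..(((i : ℝ) + 1 / 2) * h),
      |scaled Θ ε (y - y')| :=
    fun i y' => intervalIntegral.integral_nonneg (hcell i) fun _ _ => abs_nonneg _
  have Y3m : ∀ i : ℤ, _ := fun i => lintegral_integral_scaled_translate hΘ hε (hcell i)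
  have eh : ∀ i : ℤ, ((i : ℝ) + 1 / 2) * h - ((i : ℝ) - 1 / 2) * h = h := fun i => by ring
  simp_rw [eh] at Y1m Y3m
  have hX2 : 0 ≤ t * ((∫ x, |deriv Θ x|) / ε₀) := by positivity
  have hY1 : 0 ≤ h * ((∫ x, |deriv Θ x|) / ε) := by positivity
  -- `m1` pairs a value in time with a derivative in space; `m2` and `m3` pair a derivative in time
  -- with a point value or a cell integral; the others contain no derivative.
  have m1 := fun n (hn : n < M) => MeanLe.of_mul (X1 ((n + 1 : ℕ) * t)) (X1n _) (X1m _)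
    zero_le_one Y1 Y1n Y1m hY1 (ha n hn) (ha0 n)
  have m2 := fun n (hn : n < M) => MeanLe.of_mul (X2 n) (X2n n) (X2m n) hX2 Y2 Y2n Y2m
    zero_le_one (hb n hn) (hb0 n)
  have m3 := fun n (hn : n < M) => MeanLe.of_mul (X2 n) (X2n n) (X2m n) hX2 Y3 Y3n Y3m
    hh.le (hc n hn) (hc0 n)
  have m4 := fun n (hn : n < M) => MeanLe.of_mul (X1 ((n + 1 : ℕ) * t)) (X1n _) (X1m _)
    zero_le_one Y3 Y3n Y3m hh.le (hz n hn) (hz0 n)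
  have m5 := MeanLe.of_mul (X1 0) (X1n _) (X1m _)
    zero_le_one Y3 Y3n Y3m hh.le (hw 0 (Nat.zero_le _)) (hw0 0)
  have m6 := MeanLe.of_mul (X1 (M * t)) (X1n _) (X1m _)
    zero_le_one Y3 Y3n Y3m hh.le (hw M le_rfl) (hw0 M)
  exact (MeanLe.sum fun n hn =>
    ((((m1 n hn).add (m2 n hn)).add (m3 n hn)).add (m4 n hn)).const_mul ht).add
      ((m5.add m6).const_mul ht)

end Moments

/-! ### From fixed constants to the relative entropy. -/

/-- A measurable representative is needed to pass from almost every point of each time slice to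
almost every point of the strip. -/
lemma ae_range_of_measurable {T : ℝ} {v : ℝ → ℝ → ℝ}
    (hm : AEStronglyMeasurable (fun z : ℝ × ℝ => v z.1 z.2) (volume.restrict (QT T)))
    (hv : ∀ t ∈ Icc 0 T, ∀ᵐ x, v t x ∈ Icc (0 : ℝ) 1) :
    ∀ᵐ z ∂(volume.restrict (QT T)), v z.1 z.2 ∈ Icc (0 : ℝ) 1 := by
  have e : volume.restrict (QT T) = (volume.restrict (Ioo 0 T)).prod (volume : Measure ℝ) := by
    rw [QT, Measure.volume_eq_prod, ← Measure.prod_restrict, Measure.restrict_univ]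
  rw [e] at hm ⊢
  obtain ⟨w, hw, hvw⟩ := hm
  have h2 : ∀ᵐ t ∂(volume.restrict (Ioo 0 T)), ∀ᵐ x, v t x = w (t, x) :=
    Measure.ae_ae_of_ae_prod hvw
  have h3 : ∀ᵐ t ∂(volume.restrict (Ioo 0 T)), ∀ᵐ x, w (t, x) ∈ Icc (0 : ℝ) 1 := by
    filter_upwards [h2, ae_restrict_mem measurableSet_Ioo] with t ht htT
    filter_upwards [ht, hv t (Ioo_subset_Icc_self htT)] with x h1 h2
    rwa [← h1]
  have h4 : ∀ᵐ z ∂((volume.restrict (Ioo 0 T)).prod (volume : Measure ℝ)),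
      w z ∈ Icc (0 : ℝ) 1 :=
    (Measure.ae_prod_iff_ae_ae (hw.measurable measurableSet_Icc)).2 h3
  filter_upwards [hvw, h4] with z h1 h2
  rwa [h1]

namespace Regime

variable {N : ℕ} {P : LaneModel N} {β lam Δx : ℝ} {Nη : ℕ} {F V : Fin N → ℝ}
  {Fm D₁ D₂ D₁₁ D₂₁ D₂₂ κ S : ℝ}
  (H : Regime P β lam Δx Nη F V Fm D₁ D₂ D₁₁ D₂₁ D₂₂ κ S)
include H

/-- The relative entropy of a trajectory of the scheme with bounded mass, variation and increments
against any measurable function with values in `[0,1]`. -/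
lemma neg_relEntropy_le {Θ : ℝ → ℝ} (hΘ : IsMollifier Θ) {ε ε₀ : ℝ} (hε : 0 < ε) (hε₀ : 0 < ε₀)
    {U : ℕ → Fin N → ℤ → ℝ} (hU : ∀ n k i, U n k i ∈ Icc (0 : ℝ) 1)
    (hmarch : ∀ n, U (n + 1) = march P β lam Δx Nη (U n)) (k : Fin N) (M : ℕ) {μ y τ : ℝ}
    (hμ : ∀ n ≤ M, SumAbsLe (totalDensity (U n)) (μ / Δx))
    (hy : ∀ n ≤ M, SumAbsLe (totalJump (U n)) y)
    (hτ : ∀ n < M, SumAbsLe (fun i => ∑ k, |U (n + 1) k i - U n k i|) τ)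
    {v : Fin N → ℝ → ℝ → ℝ}
    (hv : ∀ᵐ z ∂(volume.restrict (QT (M * (lam * Δx)))), v k z.1 z.2 ∈ Icc (0 : ℝ) 1) :
    -P.relEntropy (M * (lam * Δx)) Θ ε ε₀ k (gridFun Δx (lam * Δx) U) v ≤
      (M * (lam * Δx) * ((∫ x, |deriv Θ x|) *
          (2 * (β / lam) * y + 3 * Fm * (D₁ + 2 * κ * D₂) * μ + β / lam * y
            + (5 * Fm * (D₁ + 2 * κ * D₂) + 4 * S) * μ)
          + (2 * Fm * (D₂₁ + 4 * κ * D₂₂ + 2 * κ * D₂) * τ + 16 * Fm * (D₁ + 2 * κ * D₂) * μ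
        + 8 * S * N * τ) / lam) + 2 * ((2 * Fm * (D₁ + 2 * κ * D₂) + 2 * S) * μ)) *
        (Δx / ε + lam * Δx / ε₀ + lam * Δx) := by
  have hΔ := H.Δx_pos
  have hlam := H.lam_pos
  set t := lam * Δx with ht_def
  have ht : 0 < t := mul_pos hlam hΔ
  have hF := H.F_nonneg k
  have hFm := H.Fm_nonneg
  have hS := H.S_nonneg
  have hL := H.speed_lip_nonneg
  have hκ := H.κ_nonneg
  have hD := H.D₂_nonneg
  have hD' := H.D₂₁_nonneg
  have hD'' := H.D₂₂_nonneg
  have hθ : 0 ≤ ∫ x, |deriv Θ x| := integral_nonneg fun _ => abs_nonneg _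
  have hβ : 0 ≤ β / lam := div_nonneg H.β_pos.le hlam.le
  have hVF := mul_nonneg (H.V_nonneg k) hF
  have hμ0 : 0 ≤ μ := by
    have := mul_nonneg (hμ 0 (Nat.zero_le _)).nonneg hΔ.le
    rwa [div_mul_cancel₀ _ hΔ.ne'] at this
  have hy0 : 0 ≤ y := (hy 0 (Nat.zero_le _)).nonneg
  have htot : ∀ n i, 0 ≤ totalDensity (U n) i := fun n i =>
    Finset.sum_nonneg fun j _ => (hU n j i).1
  have hUk : ∀ n i, 0 ≤ U n k i := fun n i => (hU n k i).1
  have key := meanLe_errorTerms hΘ hε hε₀ (M := M) hΔ ht.le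
    (fun n hn => H.sumAbsLe_space_weight (hU n) (hU (n + 1)) k (hμ n hn.le) (hμ (n + 1) hn)
      (hy n hn.le))
    (fun n i => by have := hUk n i; have := hUk (n + 1) i; positivity)
    (fun n hn => H.sumAbsLe_jump_weight k (hy n hn.le))
    (fun n i => by positivity)
    (fun n hn => H.sumAbsLe_time_weight (hU n) k (hμ n hn.le))
    (fun n i => by have := hUk n i; have := htot n i; positivity)
    (fun n hn => H.sumAbsLe_increment_weight (hU n) (hU (n + 1)) k (hμ (n + 1) hn) (hτ n hn))
    (fun n i => by have := htot (n + 1) i; positivity)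
    (fun n hn => H.sumAbsLe_source_weight (hU n) k (hμ n hn))
    (fun n i => by have := hUk n i; have := htot n i; positivity)
  have hconst : M * (t * (1 * (Δx * ((∫ x, |deriv Θ x|) / ε)) *
            (2 * (β / lam) * y + 3 * Fm * (D₁ + 2 * κ * D₂) * μ)
          + t * ((∫ x, |deriv Θ x|) / ε₀) * 1 * (β / lam * y)
          + t * ((∫ x, |deriv Θ x|) / ε₀) * Δx *
            ((5 * Fm * (D₁ + 2 * κ * D₂) + 4 * S) * (μ / Δx))
          + 1 * Δx * (2 * Fm * (D₂₁ + 4 * κ * D₂₂ + 2 * κ * D₂) * τ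
            + 16 * Fm * (D₁ + 2 * κ * D₂) * μ + 8 * S * N * τ)))
        + t * (1 * Δx * ((2 * Fm * (D₁ + 2 * κ * D₂) + 2 * S) * (μ / Δx))
          + 1 * Δx * ((2 * Fm * (D₁ + 2 * κ * D₂) + 2 * S) * (μ / Δx))) ≤
      (M * t * ((∫ x, |deriv Θ x|) *
          (2 * (β / lam) * y + 3 * Fm * (D₁ + 2 * κ * D₂) * μ + β / lam * y
            + (5 * Fm * (D₁ + 2 * κ * D₂) + 4 * S) * μ)
          + (2 * Fm * (D₂₁ + 4 * κ * D₂₂ + 2 * κ * D₂) * τ + 16 * Fm * (D₁ + 2 * κ * D₂) * μ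
        + 8 * S * N * τ) / lam) + 2 * ((2 * Fm * (D₁ + 2 * κ * D₂) + 2 * S) * μ)) *
        (Δx / ε + t / ε₀ + t) := by
    -- The increment bound makes `τ` nonnegative only if there is a time step, so the factor `M` is
    -- kept.
    have hZ : 0 ≤ M * (2 * Fm * (D₂₁ + 4 * κ * D₂₂ + 2 * κ * D₂) * τ
        + 16 * Fm * (D₁ + 2 * κ * D₂) * μ + 8 * S * N * τ) := by
      rcases Nat.eq_zero_or_pos M with rfl | hM
      · simp
      · have := (hτ 0 hM).nonneg
        positivity
    have hA : 0 ≤ 2 * (β / lam) * y + 3 * Fm * (D₁ + 2 * κ * D₂) * μ := by positivity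
    have hB : 0 ≤ β / lam * y := by positivity
    have hC : 0 ≤ (5 * Fm * (D₁ + 2 * κ * D₂) + 4 * S) * μ := by positivity
    have hW : 0 ≤ (2 * Fm * (D₁ + 2 * κ * D₂) + 2 * S) * μ := by positivity
    have hMt : 0 ≤ (M : ℝ) * t := by positivity
    generalize 2 * Fm * (D₂₁ + 4 * κ * D₂₂ + 2 * κ * D₂) * τ
        + 16 * Fm * (D₁ + 2 * κ * D₂) * μ + 8 * S * N * τ = Z at *
    generalize 2 * (β / lam) * y + 3 * Fm * (D₁ + 2 * κ * D₂) * μ = A at *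
    generalize β / lam * y = B at *
    generalize 5 * Fm * (D₁ + 2 * κ * D₂) + 4 * S = c at *
    generalize 2 * Fm * (D₁ + 2 * κ * D₂) + 2 * S = w at *
    generalize (∫ x, |deriv Θ x|) = θ at *
    have eZ : 0 ≤ M * t * (Z / lam) := by
      rw [show M * t * (Z / lam) = t * (M * Z) / lam by ring]
      positivity
    -- `Δx` cancels the `1/Δx` of the mass bounds, and `Δx Z = t Z / λ` turns a leftover cell length
    -- into `Δt`.
    have e : M * (t * (1 * (Δx * (θ / ε)) * A + t * (θ / ε₀) * 1 * B + t * (θ / ε₀) * Δx *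
          (c * (μ / Δx)) + 1 * Δx * Z)) + t * (1 * Δx * (w * (μ / Δx)) + 1 * Δx * (w * (μ / Δx))) =
        M * t * θ * A * (Δx / ε) + M * t * θ * (B + c * μ) * (t / ε₀)
          + (M * t * (Z / lam) + 2 * (w * μ)) * t := by
      rw [ht_def]
      field_simp
      ring
    rw [e]
    have x0 : 0 ≤ Δx / ε := by positivity
    have x1 : 0 ≤ t / ε₀ := by positivity
    have r0 : M * t * θ * A ≤ M * t * (θ * (A + B + c * μ) + Z / lam) + 2 * (w * μ) := by
      have := mul_nonneg (mul_nonneg hMt hθ) (add_nonneg hB hC)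
      linarith
    have r1 : M * t * θ * (B + c * μ) ≤
        M * t * (θ * (A + B + c * μ) + Z / lam) + 2 * (w * μ) := by
      have := mul_nonneg (mul_nonneg hMt hθ) hA
      linarith
    have r2 : M * t * (Z / lam) + 2 * (w * μ) ≤
        M * t * (θ * (A + B + c * μ) + Z / lam) + 2 * (w * μ) := by
      have := mul_nonneg (mul_nonneg hMt hθ) (add_nonneg (add_nonneg hA hB) hC)
      linarith
    have := mul_le_mul_of_nonneg_right r0 x0
    have := mul_le_mul_of_nonneg_right r1 x1
    have := mul_le_mul_of_nonneg_right r2 ht.le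
    linarith
  have hcell : ∀ i : ℤ, ((i : ℝ) - 1 / 2) * Δx ≤ ((i : ℝ) + 1 / 2) * Δx := fun i => by
    gcongr; linarith
  have habs : ∀ (i : ℤ) y', ∫ x in cell Δx i, scaled Θ ε (x - y') =
      ∫ x in (((i : ℝ) - 1 / 2) * Δx)..(((i : ℝ) + 1 / 2) * Δx), |scaled Θ ε (x - y')| :=
    fun i y' => by
      simp_rw [abs_of_nonneg (scaled_nonneg hΘ hε _)]
      rw [intervalIntegral.integral_of_le (hcell i), ← integral_Ico_eq_integral_Ioc, cell]
  rw [LaneModel.relEntropy, ← integral_neg]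
  refine (integral_le_of_lintegral_ofReal_le key.nonneg ?_).trans hconst
  -- Centres range over the strip, but the nonnegative majorant is integrated over the whole plane,
  -- where its moments are explicit.
  refine (lintegral_mono_ae ?_).trans ((setLIntegral_le_lintegral (QT (M * t)) _).trans key.le)
  filter_upwards [hv] with z hα
  refine (H.ofReal_neg_lambdaT_le hU hmarch k hα
    (p := fun x => scaled Θ ε (x - z.2)) (q := fun t => scaled Θ ε₀ (t - z.1))
    ((scaled_contDiff hΘ).comp (contDiff_id.sub contDiff_const))
    ((scaled_hasCompactSupport hΘ hε).comp_homeomorph (Homeomorph.subRight z.2))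
    (fun x => scaled_nonneg hΘ hε _)
    ((scaled_contDiff hΘ).comp (contDiff_id.sub contDiff_const))
    (fun x => scaled_nonneg hΘ hε₀ _) M (fun _ _ => le_rfl) (fun _ _ => le_rfl)
    (fun _ _ => le_rfl) (fun _ _ => le_rfl) (fun _ _ => le_rfl)).trans_eq ?_
  simp only [deriv_comp_sub_const, habs]
  rfl

end Regime

/-! ### Mean value estimates for the velocity. -/

section MeanValue

variable {φ : ℝ → ℝ} {s : Set ℝ} {C D : ℝ}

lemma abs_sub_le_of_abs_deriv_le (hφ : Differentiable ℝ φ) (hs : Convex ℝ s)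
    (hC : ∀ x ∈ s, |deriv φ x| ≤ C) {a b : ℝ} (ha : a ∈ s) (hb : b ∈ s) :
    |φ a - φ b| ≤ C * |a - b| :=
  hs.norm_image_sub_le_of_norm_deriv_le (fun x _ => hφ x) hC hb ha

lemma differentiable_deriv_of_contDiff_two (hφ : ContDiff ℝ 2 φ) : Differentiable ℝ (deriv φ) :=
  ((contDiff_succ_iff_deriv (n := 1)).1 hφ).2.2.differentiable one_ne_zero

lemma abs_deriv_sub_le_of_iteratedDeriv_two (hφ : ContDiff ℝ 2 φ) (hs : Convex ℝ s)
    (hC : ∀ x ∈ s, |iteratedDeriv 2 φ x| ≤ C) {a b : ℝ} (ha : a ∈ s) (hb : b ∈ s) :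
    |deriv φ a - deriv φ b| ≤ C * |a - b| :=
  abs_sub_le_of_abs_deriv_le (differentiable_deriv_of_contDiff_two hφ) hs
    (fun x hx => by simpa only [iteratedDeriv_succ, iteratedDeriv_zero] using hC x hx) ha hb

/-- It is an increment over `h` of `s ↦ φ(s) - φ(s - h)`, whose derivative is at most `C h`. -/
lemma abs_second_difference_le (hφ : ContDiff ℝ 2 φ) (hC : ∀ x, |iteratedDeriv 2 φ x| ≤ C)
    (x : ℝ) {h : ℝ} (hh : 0 ≤ h) : |φ (x + h) - 2 * φ x + φ (x - h)| ≤ C * h ^ 2 := by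
  have hd : Differentiable ℝ φ := hφ.differentiable two_ne_zero
  have hder : ∀ s, HasDerivAt (fun s => φ s - φ (s - h)) (deriv φ s - deriv φ (s - h)) s :=
    fun s => (hd s).hasDerivAt.sub ((hd (s - h)).hasDerivAt.comp_sub_const s h)
  have := abs_sub_le_of_abs_deriv_le (φ := fun s => φ s - φ (s - h)) (C := C * h) (s := univ)
    (fun s => (hder s).differentiableAt) convex_univ (fun s _ => by
      rw [(hder s).deriv]
      have := abs_deriv_sub_le_of_iteratedDeriv_two hφ convex_univ (fun x _ => hC x)
        (mem_univ s) (mem_univ (s - h))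
      rwa [sub_sub_cancel, abs_of_nonneg hh] at this) (mem_univ (x + h)) (mem_univ x)
  rw [add_sub_cancel_right, add_sub_cancel_left, abs_of_nonneg hh] at this
  calc
    _ = |φ (x + h) - φ x - (φ x - φ (x - h))| := by congr 1; ring
    _ ≤ C * h * h := this
    _ = _ := by ring

/-- Comparison of two increments of a function with bounded first and second derivatives. -/
lemma abs_increment_sub_increment_le (hφ : ContDiff ℝ 2 φ) (hs : Convex ℝ s)
    (hD : ∀ x ∈ s, |deriv φ x| ≤ D) (hC : ∀ x ∈ s, |iteratedDeriv 2 φ x| ≤ C) (hC0 : 0 ≤ C)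
    {a a' b b' : ℝ} (ha : a ∈ s) (ha' : a' ∈ s) (hb : b ∈ s) (hb' : b' ∈ s) :
    |(φ a - φ a') - (φ b - φ b')| ≤
      D * |a - a' - (b - b')| + C * |a - a'| * (|a - b| + |a' - b'|) := by
  have hd : Differentiable ℝ φ := hφ.differentiable two_ne_zero
  have hmem : ∀ {x y}, x ∈ s → y ∈ s → ∀ θ ∈ Icc (0 : ℝ) 1, y + θ * (x - y) ∈ s :=
    fun hx hy θ hθ => by simpa using hs.add_smul_sub_mem hy hx hθ
  have hpath : ∀ x y θ, HasDerivAt (fun θ => φ (y + θ * (x - y)))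
      (deriv φ (y + θ * (x - y)) * (x - y)) θ := fun x y θ => by
    have h1 : HasDerivAt (fun θ : ℝ => y + θ * (x - y)) (x - y) θ := by
      simpa using ((hasDerivAt_id θ).mul_const (x - y)).const_add y
    exact (hd _).hasDerivAt.comp θ h1
  have hder := fun θ => (hpath a a' θ).sub (hpath b b' θ)
  -- Both increments are followed along segments with the same parameter `θ`; the derivatives differ
  -- in their directions and in the points where `φ'` is taken.
  have key := abs_sub_le_of_abs_deriv_le (s := Icc (0 : ℝ) 1)
    (φ := fun θ => φ (a' + θ * (a - a')) - φ (b' + θ * (b - b')))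
    (C := D * |a - a' - (b - b')| + C * |a - a'| * (|a - b| + |a' - b'|))
    (fun θ => (hder θ).differentiableAt) (convex_Icc 0 1) (fun θ hθ => by
      have e := (hder θ).deriv
      simp only [Pi.sub_def] at e
      rw [e]
      set p := a' + θ * (a - a')
      set r := b' + θ * (b - b')
      have hp : p ∈ s := hmem ha ha' θ hθ
      have hr : r ∈ s := hmem hb hb' θ hθ
      have h1 := abs_deriv_sub_le_of_iteratedDeriv_two hφ hs hC hp hr
      have h2 : |p - r| ≤ |a - b| + |a' - b'| := by
        have e2 : p - r = θ * (a - b) + (1 - θ) * (a' - b') := by simp only [p, r]; ring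
        rw [e2]
        refine (abs_add_le _ _).trans (add_le_add ?_ ?_)
        · rw [abs_mul, abs_of_nonneg hθ.1]
          exact mul_le_of_le_one_left (abs_nonneg _) hθ.2
        · rw [abs_mul, abs_of_nonneg (sub_nonneg.2 hθ.2)]
          exact mul_le_of_le_one_left (abs_nonneg _) (by linarith [hθ.1])
      have e3 : deriv φ p * (a - a') - deriv φ r * (b - b') =
          deriv φ r * (a - a' - (b - b')) + (deriv φ p - deriv φ r) * (a - a') := by ring
      rw [e3]
      refine (abs_add_le _ _).trans (add_le_add ?_ ?_)
      · rw [abs_mul]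
        exact mul_le_mul_of_nonneg_right (hD r hr) (abs_nonneg _)
      · rw [abs_mul]
        calc
          _ ≤ C * (|a - b| + |a' - b'|) * |a - a'| := by
            gcongr
            exact h1.trans (by gcongr)
          _ = _ := by ring) (right_mem_Icc.2 zero_le_one) (left_mem_Icc.2 zero_le_one)
  rw [sub_sub_sub_comm]
  simpa using key

end MeanValue

/-! ### Verification of the normalized hypotheses. -/

/-- The kernel is largest at 0, where its extension by zero jumps by `w 0`; the variation bounds
this jump. -/
lemma le_of_eVariationOn_indicator_le {w : ℝ → ℝ} {η κ : ℝ} (hη : 0 ≤ η)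
    (hw : AntitoneOn w (Icc 0 η)) (h0 : ∀ y ∈ Icc 0 η, 0 ≤ w y)
    (h : eVariationOn (indicator (Icc 0 η) w) univ ≤ ENNReal.ofReal κ) :
    ∀ y ∈ Icc 0 η, w y ≤ |κ| := fun y hy => by
  have hz : (0 : ℝ) ∈ Icc 0 η := left_mem_Icc.2 hη
  refine (hw hz hy hy.1).trans ?_
  have h1 := (eVariationOn.edist_le (indicator (Icc 0 η) w) (mem_univ (0 : ℝ))
    (mem_univ (-1 : ℝ))).trans h
  have h2 : (-1 : ℝ) ∉ Icc 0 η := fun h => by linarith [h.1]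
  rw [indicator_of_mem hz, indicator_of_notMem h2, edist_dist, Real.dist_eq, sub_zero,
    abs_of_nonneg (h0 0 hz)] at h1
  have h3 := h1.trans (ENNReal.ofReal_le_ofReal (le_abs_self κ))
  exact (ENNReal.ofReal_le_ofReal_iff (abs_nonneg κ)).1 h3

/-- As `f(a) = a g(a)`, dividing the Lipschitz bound at 0 by `a` works on the open interval, and
continuity reaches the end points. -/
lemma LaneModel.g_le_of_f_lipschitz {N : ℕ} {P : LaneModel N} {k : Fin N} {F : ℝ}
    (hg : Continuous (P.g k)) (hf : ∀ a ∈ Icc (0 : ℝ) 1, ∀ b ∈ Icc (0 : ℝ) 1,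
      |P.f k a - P.f k b| ≤ F * |a - b|) : ∀ a ∈ Icc (0 : ℝ) 1, P.g k a ≤ F := by
  have hpos : ∀ a ∈ Ioo (0 : ℝ) 1, P.g k a ≤ F := fun a ha => by
    have := (le_abs_self _).trans (hf a (Ioo_subset_Icc_self ha) 0 (by simp))
    simp only [LaneModel.f, zero_mul, sub_zero, abs_of_pos ha.1] at this
    rw [mul_comm] at this
    exact le_of_mul_le_mul_right this ha.1
  intro a ha
  rw [← closure_Ioo zero_ne_one] at ha
  exact closure_minimal (s := Ioo (0 : ℝ) 1) (t := {a | P.g k a ≤ F}) hpos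
    (isClosed_le hg continuous_const) ha

/-- The entry `6β` of the minimum gives the side condition. The entry `4 - 6β` gives the second
claim when `S` is negative and gets truncated to 0. -/
lemma cfl_of_le_min {β lam t S a : ℝ} (hlam : 0 < lam) (ha : 0 ≤ a)
    (h : lam ≤ min (min 1 (4 - 6 * β)) (min (6 * β) (1 - 2 * t * S)) / (1 + 6 * a))
    (h' : β + lam * a + 2 * t * S ≤ 1) :
    lam * a ≤ β ∧ β + lam * a + 2 * t * max S 0 ≤ 1 := by
  rw [le_div_iff₀ (by positivity)] at h
  have h1 := h.trans ((min_le_left _ _).trans (min_le_right _ _))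
  have h2 := h.trans ((min_le_right _ _).trans (min_le_left _ _))
  refine ⟨by linarith, ?_⟩
  rcases le_total 0 S with hS | hS
  · rwa [max_eq_left hS]
  · rw [max_eq_right hS]
    linarith

/-- The hypotheses of the model and of the discretization in normalized form. -/
lemma LaneModel.BoundedBy.regime {N : ℕ} {P : LaneModel N} {u₀ : Fin N → ℝ → ℝ} {M : DataBounds N}
    {β lam Δx : ℝ} {Nη : ℕ} {V : Fin N → ℝ} (hP : P.Admissible) (hM : P.BoundedBy u₀ M)
    (hβ : 0 < β) (hlam : 0 < lam)
    (hV : ∀ k x, ∀ A ∈ Icc (0 : ℝ) 1, |P.ν k x A| ≤ V k) (hΔ : 0 < Δx) (hη : P.η = Nη * Δx)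
    (h₁ : ∀ k, lam ≤ min (min 1 (4 - 6 * β)) (min (6 * β) (1 - 2 * (lam * Δx) * M.S))
        / (1 + 6 * M.f k * V k))
    (h₂ : ∀ k, β + lam * M.f k * V k + 2 * (lam * Δx) * M.S ≤ 1) :
    Regime P β lam Δx Nη M.f V (∑ k, M.f k) |M.D₁ν| |M.D₂ν| |M.D₁₁ν| |M.D₂₁ν| |M.D₂₂ν| |M.ker|
      (max M.S 0) := by
  have hF : ∀ k, 0 ≤ M.f k := fun k => by
    have := (abs_nonneg _).trans (hM.f_le k 1 (by simp) 0 (by simp))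
    simpa using this
  have hF_le : ∀ k, M.f k ≤ ∑ k, M.f k := fun k =>
    Finset.single_le_sum (fun k _ => hF k) (Finset.mem_univ k)
  have hV0 : ∀ k, 0 ≤ V k := fun k => (abs_nonneg _).trans (hV k 0 0 (by simp))
  have hg : ∀ k, Continuous (P.g k) := fun k => (hP.g_lip k).choose_spec.continuous
  have hcfl := fun k => cfl_of_le_min hlam (mul_nonneg (hF k) (hV0 k))
    ((h₁ k).trans_eq (by rw [mul_assoc 6])) (by rw [← mul_assoc]; exact h₂ k)
  have hx : ∀ k A, Differentiable ℝ fun x => P.ν k x A := fun k A =>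
    (hP.ν_contDiff_left k A).differentiable two_ne_zero
  have hA : ∀ k x, Differentiable ℝ (P.ν k x) := fun k x =>
    (hP.ν_contDiff_right k x).differentiable two_ne_zero
  have hI : Convex ℝ (Icc (0 : ℝ) 1) := convex_Icc 0 1
  exact
  { f_lip := hM.f_le
    F_nonneg := hF
    F_le := hF_le
    Fm_nonneg := Finset.sum_nonneg fun k _ => hF k
    g_cont := hg
    g_one := hP.g_one
    g_antitone := hP.g_antitone
    g_le := fun k a ha => (LaneModel.g_le_of_f_lipschitz (hg k) (hM.f_le k) a ha).trans (hF_le k)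
    ν_nonneg := hP.ν_nonneg
    ν_le := fun k x A hA => (le_abs_self _).trans (hV k x A hA)
    V_nonneg := hV0
    ν_x := fun k x y A hA => abs_sub_le_of_abs_deriv_le (hx k A) convex_univ
      (fun x _ => (hM.D₁ν_le k x A hA).trans (le_abs_self _)) (mem_univ x) (mem_univ y)
    ν_A := fun k x A hA' B hB => abs_sub_le_of_abs_deriv_le (hA k x) hI
      (fun A hA => (hM.D₂ν_le k x A hA).trans (le_abs_self _)) hA' hB
    ν_xx := fun k x h hh A hA => abs_second_difference_le (hP.ν_contDiff_left k A)
      (fun x => (hM.D₁₁ν_le k x A hA).trans (le_abs_self _)) x hh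
    ν_xA := fun k x y A hA' B hB => by
      have := abs_sub_le_of_abs_deriv_le (φ := fun A => P.ν k x A - P.ν k y A) (s := Icc 0 1)
        (C := |M.D₂₁ν| * |x - y|) ((hA k x).sub (hA k y)) hI (fun A hA' => by
          rw [show (fun A => P.ν k x A - P.ν k y A) = P.ν k x - P.ν k y from rfl,
            deriv_sub (hA k x A) (hA k y A)]
          exact (hM.D₂₁ν_le k x y A hA').trans (by gcongr; exact le_abs_self _)) hA' hB
      rwa [sub_sub_sub_comm] at this
    ν_AA := fun k x A hA A' hA' B hB B' hB' =>
      abs_increment_sub_increment_le (hP.ν_contDiff_right k x) hI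
        (fun A hA => (hM.D₂ν_le k x A hA).trans (le_abs_self _))
        (fun A hA => (hM.D₂₂ν_le k x A hA).trans (le_abs_self _)) (abs_nonneg _)
        hA hA' hB hB'
    D₁_nonneg := abs_nonneg _
    D₂_nonneg := abs_nonneg _
    D₁₁_nonneg := abs_nonneg _
    D₂₁_nonneg := abs_nonneg _
    D₂₂_nonneg := abs_nonneg _
    ker_nonneg := hP.ker_nonneg
    ker_le := le_of_eVariationOn_indicator_le hP.η_pos.le hP.ker_antitone hP.ker_nonneg hM.ker_le
    ker_antitone := hP.ker_antitone
    ker_cont := hP.ker_contDiff.continuousOn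
    ker_mass := hP.ker_mass
    κ_nonneg := abs_nonneg _
    η_pos := hP.η_pos
    η_eq := hη
    S_nonneg := le_max_right _ _
    S_lip := fun k l hkl x a ha b hb A hA B hB a' ha' b' hb' A' hA' B' hB' =>
      (hM.S_le k l hkl x a ha b hb A hA B hB a' ha' b' hb' A' hA' B' hB').trans (by
        gcongr
        exact le_max_left _ _)
    β_pos := hβ
    lam_pos := hlam
    Δx_pos := hΔ
    cfl_side := fun k => by rw [mul_assoc]; exact (hcfl k).1
    cfl := fun k => by rw [mul_assoc lam]; exact (hcfl k).2 }

end Multilane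

end

/-! ### The relative entropy estimate. -/

open Multilane
theorem lemma5p1 {N : ℕ} (T β lam : ℝ) (hT : 0 < T) (hβ : 0 < β) (hβ' : β < 2 / 3)
    (hlam : 0 < lam) (Θ : ℝ → ℝ) (hΘ : IsMollifier Θ) (M : DataBounds N) :
    ∃ L : ℝ, ∀ (P : LaneModel N) (u₀ : Fin N → ℝ → ℝ) (u : Fin N → ℝ → ℝ → ℝ)
      (V : Fin N → ℝ) (Δx Δt : ℝ) (Nη NT : ℕ) (ε ε₀ : ℝ),
      P.Admissible →
      (∀ k, Integrable (u₀ k) ∧ ∀ᵐ x, u₀ k x ∈ Set.Icc (0 : ℝ) 1) →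
      P.BoundedBy u₀ M →
      (∀ k x, ∀ A ∈ Set.Icc (0 : ℝ) 1, |P.ν k x A| ≤ V k) →
      0 < Δx → Δt = lam * Δx → P.η = Nη * Δx → T = NT * Δt →
      (∀ k, lam ≤ min (min 1 (4 - 6 * β)) (min (6 * β) (1 - 2 * Δt * M.S))
        / (1 + 6 * M.f k * V k)) →
      (∀ k, β + lam * M.f k * V k + 2 * Δt * M.S ≤ 1) →
      P.IsEntropySolution T u₀ u →
      0 < ε → 0 < ε₀ →
      ∀ k : Fin N,
        -P.relEntropy T Θ ε ε₀ k (P.approx β Δx Δt Nη u₀) u ≤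
          L * (Δx / ε + Δt / ε₀ + Δt) := by
  -- The constant is fixed before any model is given, so entries of `M` may be negative; absolute
  -- values and truncations keep the bounds valid.
  set Fm := ∑ k, M.f k
  set D₁ := |M.D₁ν|
  set D₂ := |M.D₂ν|
  set κ := |M.ker|
  set S := max M.S 0
  set y₀ := max M.tv 0
  set μ := Real.exp (2 * N * S * T) * |M.mass|
  set a := Fm * (D₁ + 2 * κ * D₂) + N * (2 * κ * Fm * D₂ + 4 * S)
  set b := N * Fm * ((|M.D₁₁ν| + 4 * κ * |M.D₂₁ν| + 8 * κ ^ 2 * |M.D₂₂ν|)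
    + 8 * (D₁ + 2 * κ * D₂)) * μ
  set y := Real.exp (a * T) * (N * (y₀ + 1) + b * T)
  set τ := N * (2 * β * y + lam * (Fm * (D₁ + 2 * κ * D₂) + 2 * S) * μ)
  -- The division by `λ` converts `Δx` into `Δt` in the increment errors; the doubled last term
  -- comes from the initial and terminal boundary terms of `time_shift_le`.
  refine ⟨T * ((∫ x, |deriv Θ x|) *
      (2 * (β / lam) * y + 3 * Fm * (D₁ + 2 * κ * D₂) * μ + β / lam * y
        + (5 * Fm * (D₁ + 2 * κ * D₂) + 4 * S) * μ)
      + (2 * Fm * (|M.D₂₁ν| + 4 * κ * |M.D₂₂ν| + 2 * κ * D₂) * τ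
        + 16 * Fm * (D₁ + 2 * κ * D₂) * μ + 8 * S * N * τ) / lam)
      + 2 * ((2 * Fm * (D₁ + 2 * κ * D₂) + 2 * S) * μ), ?_⟩
  rintro P u₀ u V Δx _ Nη NT ε ε₀ hP h₀ hM hV hΔ rfl hη hNT h₁ h₂ hu hε hε₀ k
  have H := hM.regime hP hβ hlam hV hΔ hη h₁ h₂
  have hμ0 : 0 ≤ μ := by positivity
  have hμ : ∀ n : ℕ, n * (lam * Δx) ≤ T →
      SumAbsLe (totalDensity (P.scheme β Δx (lam * Δx) Nη u₀ n)) (μ / Δx) := fun n hn =>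
    H.scheme_mass h₀ (hM.mass_le.trans (le_abs_self _)) (abs_nonneg _) hn
  have hy : ∀ n : ℕ, n * (lam * Δx) ≤ T →
      SumAbsLe (totalJump (P.scheme β Δx (lam * Δx) Nη u₀ n)) y := fun n hn =>
    H.scheme_jump h₀ rfl rfl hμ0 hμ (fun k => (hM.tv_le k).trans
      (ENNReal.ofReal_le_ofReal (le_max_left _ _))) (le_max_right _ _) hn
  have hle : ∀ n ≤ NT, (n : ℝ) * (lam * Δx) ≤ T := fun n hn => by
    rw [hNT]
    gcongr
  have hrange := ae_range_of_measurable (hu.measurable k) (hu.range k)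
  rw [hNT] at hrange
  have key := H.neg_relEntropy_le hΘ hε hε₀ (H.scheme_mem h₀)
    (fun n => scheme_succ P β hlam.ne' hΔ.ne' Nη u₀ n) k NT (fun n hn => hμ n (hle n hn))
    (fun n hn => hy n (hle n hn)) (fun n hn => H.scheme_time h₀ hμ hy (hle n hn.le)) hrange
  rw [← hNT] at key
  exact key
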